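/- Throughout, $\mathrm{Tr}$ is the trace of an $N\times N$ matrix, $\mathrm{tr}=\frac1N\mathrm{Tr}$, and $k_r$ is the $r$-th classical joint cumulant of complex random variables, $$k_r\{Y_1,\dots,Y_r\}=\sum_{\pi}(-1)^{|\pi|-1}(|\pi|-1)!\prod_{B\in\pi}\mathrm E\Big\{\prod_{i\in B}Y_i\Big\},$$ the sum being over all partitions $\pi$ of $\{1,\dots,r\}$ (so $k_1\{a\}=\mathrm E\{a\}$, $k_2\{a,b\}=\mathrm E\{ab\}-\mathrm E\{a\}\mathrm E\{b\}$). All random matrices are assumed to have entries with moments of all orders. **Definitions.** (1) A *second order non-commutative probability space* $(\mathcal A,\varphi,\rho)$ is a unital complex algebra $\mathcal A$ with a tracial linear functional $\varphi:\mathcal A\to\mathbb C$, $\varphi(1)=1$, and a bilinear functional $\rho:\mathcal A\times\mathcal A\to\mathbb C$ which is tracial in each argument and satisfies $\rho(a,1)=0=\rho(1,b)$ for all $a,b$. (2) Let $\mathcal A_1,\dots,\mathcal A_r\subset\mathcal A$ be unital subalgebras. A tuple $(a_1,\dots,a_n)$, $n\ge1$, is *centered* if $\varphi(a_k)=0$ for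 all $k$, and *cyclically alternating* if there are $i(1),\dots,i(n)$ with $a_k\in\mathcal A_{i(k)}$ and, if $n\ge2$, $i(k)\ne i(k+1)$ for all $k$ (indices modulo $n$). The subalgebras are *free of second order* if they are free with respect to $\varphi$ (that is, $\varphi(a_1\cdots a_n)=0$ whenever $n\ge 1$, $a_k\in\mathcal A_{i(k)}$, $\varphi(a_k)=0$ for all $k$ and $i(k)\ne i(k+1)$ for $1\le k<n$), $\rho(a,b)=0$ for $a\in\mathcal A_i$, $b\in\mathcal A_j$, $i\neq j$, and for all centered and cyclically alternating $(a_1,\dots,a_n)$, $(b_1,\dots,b_m)$ one has $\rho(a_1\cdots a_n,b_1\cdots b_m)=0$ if $n\ne m$, and, if $n=m\ge2$, $$\rho(a_1\cdots a_n,b_1\cdots b_n)=\sum_{k=0}^{n-1}\varphi(a_1b_{n+k})\varphi(a_2b_{n-1+k})\cdots\varphi(a_nb_{1+k}),$$ with indices of the $b$'s taken modulo $n$. (3) A sequence $\{A_i\mid i\in I\}_N$ of families of $N\times N$ random matrices has a *second order limit distribution*, given by $a_i\in\mathcal A$ ($i\in I$) in a second order non-commutative probability space $(\mathcal A,\varphi,\rho)$,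 if for all polynomials $p_1,p_2,\dots$ in non-commuting indeterminates indexed by $I$, as $N\to\infty$: $k_1\{\mathrm{tr}[p_1(A)]\}\to\varphi(p_1(a))$; $k_2\{\mathrm{Tr}[p_1(A)],\mathrm{Tr}[p_2(A)]\}\to\rho(p_1(a),p_2(a))$; and $k_r\{\mathrm{Tr}[p_1(A)],\dots,\mathrm{Tr}[p_r(A)]\}\to0$ for every $r\ge3$. (4) Two sequences $\{A_i\mid i\in I\}_N$, $\{B_j\mid j\in J\}_N$ are *asymptotically free of second order* if the joint sequence $\{A_i,B_j\mid i\in I,\ j\in J\}_N$ has a second order limit distribution, given by $a_i,b_j$ in some $(\mathcal A,\varphi,\rho)$, and the unital algebras generated by $\{a_i\mid i\in I\}$ and by $\{b_j\mid j\in J\}$ are free of second order with respect to $(\varphi,\rho)$. (5) Let $\mathcal H_{\mathbb R}$ be a real Hilbert space. A *family of Hermitian Gaussian $N\times N$ random matrices* is a family $X_N(f)=(x_{ij}(f))_{i,j=1}^N$, $f\in\mathcal H_{\mathbb R}$, of Hermitian random matrices whose entries $\{x_{ij}(f)\}$ form a centered Gaussian family (real and imaginary parts are jointly Gaussian) with $\mathrm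 E\{x_{ij}(f)x_{kl}(g)\}=0$ for $i<j$, $k<l$, and $\mathrm E\{x_{ij}(f)\overline{x_{kl}(g)}\}=\delta_{ik}\delta_{jl}\frac1N\langle f,g\rangle$ for $i\le j$, $k\le l$, for all $f,g\in\mathcal H_{\mathbb R}$. **Theorem.** For each $N$ let $\{X_N(f)\mid f\in\mathcal H_{\mathbb R}\}$ be a family of Hermitian Gaussian $N\times N$ random matrices. (a) Let $\{A_1,\dots,A_s\}_N$ be a sequence of $N\times N$ random matrices, defined for each $N$ on the same probability space as the $X_N(f)$, which has a second order limit distribution. If, for each $N$, $\{X_N(f)\mid f\in\mathcal H_{\mathbb R}\}$ and $\{A_1,\dots,A_s\}_N$ are independent, then $\{X_N(f)\mid f\in\mathcal H_{\mathbb R}\}_N$ and $\{A_1,\dots,A_s\}_N$ are asymptotically free of second order. (b) In particular, let $\{D_1,\dots,D_s\}_N$ be a sequence of non-random $N\times N$ matrices with a limit distribution: there are a unital complex algebra $\mathcal D$, a tracial linear functional $\psi$ on $\mathcal D$ with $\psi(1)=1$, and $d_1,\dots,d_s\in\mathcal D$ with $\lim_{N\to\infty}\mathrm{tr}[p(D_1,\dots,D_s)]=\psi(p(d_1,\dots,d_s))$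 for all polynomials $p$ in $s$ non-commuting indeterminates. Then $\{X_N(f)\mid f\in\mathcal H_{\mathbb R}\}_N$ and $\{D_1,\dots,D_s\}_N$ are asymptotically free of second order. -/

import Mathlib

open MeasureTheory ProbabilityTheory Filter Topology

universe u v w

/-! ### Second order non-commutative probability spaces and second order freeness -/

/-- The functionals `φ` and `ρ` of a second order non-commutative probability space
`(𝒜, φ, ρ)` on the unital complex algebra `𝒜`. -/
structure SecondOrderNCPS (𝒜 : Type*) [Ring 𝒜] [Algebra ℂ 𝒜] where
  φ : 𝒜 →ₗ[ℂ] ℂ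
  ρ : 𝒜 →ₗ[ℂ] 𝒜 →ₗ[ℂ] ℂ
  φ_one : φ 1 = 1
  φ_tracial : ∀ a b, φ (a * b) = φ (b * a)
  ρ_tracial_left : ∀ a b c, ρ (a * b) c = ρ (b * a) c
  ρ_tracial_right : ∀ a b c, ρ c (a * b) = ρ c (b * a)
  ρ_one_right : ∀ a, ρ a 1 = 0
  ρ_one_left : ∀ b, ρ 1 b = 0

/-- The (noncommutative, ordered) product `a₁ a₂ ⋯ aₙ` of a tuple. -/
def tupleProd {𝒜 : Type*} [Ring 𝒜] {n : ℕ} (a : Fin n → 𝒜) : 𝒜 := (List.ofFn a).prod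

/-- First order (Voiculescu) freeness of unital subalgebras with respect to `φ`: the
functional vanishes on every product of centered elements in which neighbouring factors come
from different subalgebras. -/
def IsFreeFamily {𝒜 : Type*} [Ring 𝒜] [Algebra ℂ 𝒜] {κ : Type*}
    (φ : 𝒜 →ₗ[ℂ] ℂ) (B : κ → Subalgebra ℂ 𝒜) : Prop :=
  ∀ (n : ℕ), 1 ≤ n → ∀ (i : Fin n → κ) (a : Fin n → 𝒜),
    (∀ k, a k ∈ B (i k)) →
    (∀ (k : ℕ) (h : k + 1 < n), i ⟨k, Nat.lt_of_succ_lt h⟩ ≠ i ⟨k + 1, h⟩) →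
    (∀ k, φ (a k) = 0) →
    φ (tupleProd a) = 0

/-- A tuple `(a₁, …, aₙ)`, `n ≥ 1`, is cyclically alternating: each `aₖ` lies in some
`B (i k)`, where, if `n ≥ 2`, cyclic neighbours have different indices
(`k + 1` is addition modulo `n` in `Fin n`). -/
def CyclicallyAlternating {𝒜 : Type*} [Ring 𝒜] [Algebra ℂ 𝒜] {κ : Type*}
    (B : κ → Subalgebra ℂ 𝒜) {n : ℕ} [NeZero n] (a : Fin n → 𝒜) : Prop :=
  ∃ i : Fin n → κ, (∀ k, a k ∈ B (i k)) ∧ (2 ≤ n → ∀ k, i k ≠ i (k + 1))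

/-- Freeness of second order of unital subalgebras with respect to `(φ, ρ)`.
In `spoke`, `j.rev + k` is the 0-based version of the cyclic index `n + 1 - j + k`, so that the
sum is `∑ₖ φ(a₁ b_{n+k}) φ(a₂ b_{n-1+k}) ⋯ φ(aₙ b_{1+k})`. -/
structure SecondOrderNCPS.IsFreeOfSecondOrder {𝒜 : Type*} [Ring 𝒜] [Algebra ℂ 𝒜] {κ : Type*}
    (S : SecondOrderNCPS 𝒜) (B : κ → Subalgebra ℂ 𝒜) : Prop where
  free : IsFreeFamily S.φ B
  length_ne : ∀ (n m : ℕ) [NeZero n] [NeZero m] (a : Fin n → 𝒜) (b : Fin m → 𝒜),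
    CyclicallyAlternating B a → CyclicallyAlternating B b →
    (∀ k, S.φ (a k) = 0) → (∀ k, S.φ (b k) = 0) →
    n ≠ m → S.ρ (tupleProd a) (tupleProd b) = 0
  different : ∀ (i j : κ), i ≠ j → ∀ a ∈ B i, ∀ b ∈ B j, S.ρ a b = 0
  spoke : ∀ (n : ℕ) [NeZero n] (a b : Fin n → 𝒜), 2 ≤ n →
    CyclicallyAlternating B a → CyclicallyAlternating B b →
    (∀ k, S.φ (a k) = 0) → (∀ k, S.φ (b k) = 0) →
    S.ρ (tupleProd a) (tupleProd b) = ∑ k : Fin n, ∏ j : Fin n, S.φ (a j * b (j.rev + k))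

/-! ### Cumulants and limit distributions of random matrices -/

/-- The classical joint cumulant `k_r{Y₁, …, Y_r}` of complex random variables (`r ≥ 1`):
the sum over all partitions `π` of `{1, …, r}` of
`(-1)^(|π| - 1) (|π| - 1)! ∏_{B ∈ π} E{∏_{i ∈ B} Yᵢ}`. In particular `k₁{a} = E{a}` and
`k₂{a, b} = E{a b} - E{a} E{b}`. -/
noncomputable def jointCumulant {Ω : Type*} [MeasurableSpace Ω] (P : Measure Ω) {r : ℕ}
    (Y : Fin r → Ω → ℂ) : ℂ :=
  ∑ π : Finpartition (Finset.univ : Finset (Fin r)),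
    (-1) ^ (π.parts.card - 1) * ((π.parts.card - 1).factorial : ℂ) *
      ∏ B ∈ π.parts, ∫ ω, ∏ i ∈ B, Y i ω ∂P

/-- The matrix `p(A)`, for a polynomial `p` in the non-commuting indeterminates indexed by `ι`. -/
noncomputable def matrixPoly {ι : Type*} {N : ℕ} (A : ι → Matrix (Fin N) (Fin N) ℂ)
    (p : FreeAlgebra ℂ ι) : Matrix (Fin N) (Fin N) ℂ :=
  FreeAlgebra.lift ℂ A p

/-- The normalized trace `tr = (1/N) Tr`. -/
noncomputable def normTrace {N : ℕ} (M : Matrix (Fin N) (Fin N) ℂ) : ℂ := (1 / (N : ℂ)) * M.trace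

/-- The sequence `{A_i | i ∈ ι}_N` of families of `N × N` random matrices (with entries having
moments of all orders, so that all the cumulants exist) has the second order limit
distribution given by the elements `a_i` of `(𝒜, φ, ρ)`. -/
structure ConvergesToSecondOrder {ι : Type*} {Ω : ℕ → Type*} [∀ N, MeasurableSpace (Ω N)]
    (P : ∀ N, Measure (Ω N)) (A : ∀ N, ι → Ω N → Matrix (Fin N) (Fin N) ℂ)
    {𝒜 : Type*} [Ring 𝒜] [Algebra ℂ 𝒜] (S : SecondOrderNCPS 𝒜) (a : ι → 𝒜) : Prop where
  moments : ∀ N i k l (q : NNReal), MemLp (fun ω => A N i ω k l) q (P N)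
  first : ∀ p : FreeAlgebra ℂ ι,
    Tendsto (fun N => jointCumulant (P N)
        ![fun ω => normTrace (matrixPoly (fun i => A N i ω) p)])
      atTop (𝓝 (S.φ (FreeAlgebra.lift ℂ a p)))
  second : ∀ p₁ p₂ : FreeAlgebra ℂ ι,
    Tendsto (fun N => jointCumulant (P N)
        ![fun ω => (matrixPoly (fun i => A N i ω) p₁).trace,
          fun ω => (matrixPoly (fun i => A N i ω) p₂).trace])
      atTop (𝓝 (S.ρ (FreeAlgebra.lift ℂ a p₁) (FreeAlgebra.lift ℂ a p₂)))
  higher : ∀ r : ℕ, 3 ≤ r → ∀ p : Fin r → FreeAlgebra ℂ ι,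
    Tendsto (fun N => jointCumulant (P N)
        fun j ω => (matrixPoly (fun i => A N i ω) (p j)).trace)
      atTop (𝓝 0)

/-- The sequence has a second order limit distribution. -/
def HasSecondOrderLimitDistribution {ι : Type*} {Ω : ℕ → Type*} [∀ N, MeasurableSpace (Ω N)]
    (P : ∀ N, Measure (Ω N)) (A : ∀ N, ι → Ω N → Matrix (Fin N) (Fin N) ℂ) : Prop :=
  ∃ (𝒜 : Type w) (_ : Ring 𝒜) (_ : Algebra ℂ 𝒜) (S : SecondOrderNCPS 𝒜) (a : ι → 𝒜),
    ConvergesToSecondOrder P A S a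

/-- Two sequences `{A_i | i ∈ ι}_N` and `{B_j | j ∈ κ}_N` of families of random matrices, defined
on common probability spaces, are asymptotically free of second order. -/
def AsymptoticallyFreeOfSecondOrder {ι : Type u} {κ : Type v} {Ω : ℕ → Type*}
    [∀ N, MeasurableSpace (Ω N)] (P : ∀ N, Measure (Ω N))
    (A : ∀ N, ι → Ω N → Matrix (Fin N) (Fin N) ℂ)
    (B : ∀ N, κ → Ω N → Matrix (Fin N) (Fin N) ℂ) : Prop :=
  ∃ (𝒜 : Type (max u v)) (_ : Ring 𝒜) (_ : Algebra ℂ 𝒜) (S : SecondOrderNCPS 𝒜)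
    (a : ι → 𝒜) (b : κ → 𝒜),
    ConvergesToSecondOrder P (fun N => Sum.elim (A N) (B N)) S (Sum.elim a b) ∧
    S.IsFreeOfSecondOrder
      ![Algebra.adjoin ℂ (Set.range a), Algebra.adjoin ℂ (Set.range b)]

/-- A sequence of families of non-random `N × N` matrices has a limit distribution with respect
to the normalized trace. -/
def HasLimitDistribution {ι : Type*} (D : ∀ N : ℕ, ι → Matrix (Fin N) (Fin N) ℂ) : Prop :=
  ∃ (𝒟 : Type w) (_ : Ring 𝒟) (_ : Algebra ℂ 𝒟) (ψ : 𝒟 →ₗ[ℂ] ℂ) (d : ι → 𝒟),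
    ψ 1 = 1 ∧ (∀ x y, ψ (x * y) = ψ (y * x)) ∧
    ∀ p : FreeAlgebra ℂ ι,
      Tendsto (fun N => normTrace (matrixPoly (D N) p)) atTop
        (𝓝 (ψ (FreeAlgebra.lift ℂ d p)))

/-! ### Gaussian random matrices -/

/-- `{X(f) | f ∈ H}` is a family of Hermitian Gaussian `N × N` random matrices indexed by the real
Hilbert space `H`: the entries `x_{ij}(f)` form a centered (complex) Gaussian family, i.e. their
real and imaginary parts are jointly Gaussian, with the prescribed covariance. -/
structure IsHermitianGaussianFamily {H : Type*} [NormedAddCommGroup H] [InnerProductSpace ℝ H]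
    {Ω : Type*} [MeasurableSpace Ω] (P : Measure Ω) (N : ℕ)
    (X : H → Ω → Matrix (Fin N) (Fin N) ℂ) : Prop where
  hermitian : ∀ f, ∀ᵐ ω ∂P, (X f ω).IsHermitian
  gaussian : IsGaussianProcess
    (fun (t : H × Fin N × Fin N) (ω : Ω) => X t.1 ω t.2.1 t.2.2) P
  centered : ∀ f i j, ∫ ω, X f ω i j ∂P = 0
  cov : ∀ f g (i j k l : Fin N), i < j → k < l → ∫ ω, X f ω i j * X g ω k l ∂P = 0
  cov_conj : ∀ f g (i j k l : Fin N), i ≤ j → k ≤ l →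
    ∫ ω, X f ω i j * (starRingEnd ℂ) (X g ω k l) ∂P =
      (if i = k then 1 else 0) * (if j = l then 1 else 0) * (1 / (N : ℂ)) * (inner ℝ f g : ℂ)

/-! The engine is Gaussian integration by parts. In an expectation of a product of traces, a letter
`x(f)` at the head of a word `x(f) w` acts as a derivation: it pairs with every other letter `x(g)`
with weight `⟨f, g⟩ / N`. A partner inside the same trace splits that trace into two; a partner in
another trace merges the two traces into one. This is the loop equation `traceMoment_loop`; matrices
independent of the Gaussian family are inert.

Cumulants are characterised by `k_a ⋆ m = m(a, ·)`, where `⋆` is the sum over splittings of a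
multiset. This agrees with the partition formula (`jointCumulant_eq_abstractCumulant`), and since
`m` is cancellable for `⋆`, the loop equation passes from moments to cumulants
(`abstractCumulant_loop`). Every use removes a Gaussian letter. By induction on their number, all
cumulants of words, first ones divided by `N`, converge, and those with at least three arguments
tend to zero (`cumulantConverges_word`). The induction starts from the cumulants of the other family
alone; for non-random matrices these vanish beyond the first.

The limits define functionals `φ` and `ρ` on the free algebra itself (`limitSpace`). With `D_f` the
free difference quotient, the loop equations become `φ(x_f w) = (φ ⊗ φ)(D_f w)` and `ρ(x_f w, v) =
(φ ⊗ ρ(·, v) + ρ(·, v) ⊗ φ)(D_f w) + φ(w · flip(D_f v))`.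

What remains is algebra (`LoopCalculus`). Let `C` be generated by the `x_f`, and `B` by the other
family, where `D_f` vanishes. Let `W n` be spanned by alternating products of centered elements
beginning and ending in `B`, with `n` factors from `C`. Cutting such a product at a letter of `C`
leaves a shorter alternating product in each tensor leg; hence `φ(w z) = 0` for `w ∈ C`, `z ∈ W n`
(`alternatingProducts_le`), which is freeness. For `ρ` on two cyclic products, rotate so that the
first starts with `a₀ ∈ C`. Only the merging term survives (`ρ_mul_eq`): it pairs `a₀` with some
`b_l` and opens the second cycle there, leaving `φ` of a product of two alternating words
(`ρ_tupleProd`). That value collapses from the middle outwards into `∏ φ(a b)` (`φ_reverse_mul`), or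
is zero for unequal lengths. Summing over `l` gives the spoke formula. -/

/-! ### Convolution of functions on multisets and abstract cumulants -/

/-- The convolution `∑ g(t₁) h(t₂)` over all splittings `s = t₁ + t₂`. -/
noncomputable def multisetConv {V : Type*} (g h : Multiset V → ℂ) (s : Multiset V) : ℂ :=
  (s.antidiagonal.map fun p => g p.1 * h p.2).sum

section MultisetConv
variable {V : Type*}

@[simp] lemma multisetConv_zero (g h : Multiset V → ℂ) : multisetConv g h 0 = g 0 * h 0 := by
  simp [multisetConv]

/-- A Leibniz rule: adjoining a letter to the argument is a derivation for the convolution. The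
inductions on multisets below rest on it. -/
lemma multisetConv_cons (g h : Multiset V → ℂ) (a : V) (s : Multiset V) :
    multisetConv g h (a ::ₘ s) = multisetConv g (fun t => h (a ::ₘ t)) s +
      multisetConv (fun t => g (a ::ₘ t)) h s := by
  simp [multisetConv, Multiset.map_map]

lemma multisetConv_singleton (g h : Multiset V → ℂ) (a : V) :
    multisetConv g h {a} = g 0 * h {a} + g {a} * h 0 := by
  rw [← Multiset.cons_zero, multisetConv_cons]
  simp

lemma multisetConv_add_left (g g' h : Multiset V → ℂ) :
    multisetConv (fun s => g s + g' s) h = fun s => multisetConv g h s + multisetConv g' h s := by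
  funext s
  simp [multisetConv, add_mul]

lemma multisetConv_add_right (g h h' : Multiset V → ℂ) :
    multisetConv g (fun s => h s + h' s) = fun s => multisetConv g h s + multisetConv g h' s := by
  funext s
  simp [multisetConv, mul_add]

lemma multisetConv_smul_left (c : ℂ) (g h : Multiset V → ℂ) :
    multisetConv (fun s => c * g s) h = fun s => c * multisetConv g h s := by
  funext s
  simp [multisetConv, mul_assoc, Multiset.sum_map_mul_left]

lemma multisetConv_zero_left (h : Multiset V → ℂ) :
    multisetConv (fun _ => 0) h = fun _ => 0 := by
  funext s
  simp [multisetConv]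

lemma multisetConv_list_sum_left {β : Type*} (L : List β) (g : β → Multiset V → ℂ)
    (h : Multiset V → ℂ) :
    multisetConv (fun s => (L.map fun b => g b s).sum) h =
      fun s => (L.map fun b => multisetConv (g b) h s).sum := by
  induction L with
  | nil => simpa using multisetConv_zero_left h
  | cons b L ih => simp [multisetConv_add_left, ih]

lemma multisetConv_comm (g h : Multiset V → ℂ) (s : Multiset V) :
    multisetConv g h s = multisetConv h g s := by
  rw [multisetConv, ← Multiset.map_swap_antidiagonal, Multiset.map_map, multisetConv]
  simp [mul_comm]

lemma multisetConv_assoc (g h k : Multiset V → ℂ) (s : Multiset V) :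
    multisetConv (multisetConv g h) k s = multisetConv g (multisetConv h k) s := by
  induction s using Multiset.induction generalizing g h k with
  | empty => simp [mul_assoc]
  | cons a s ih =>
    rw [multisetConv_cons, multisetConv_cons, ih,
      funext (fun t => multisetConv_cons g h a t), funext (fun t => multisetConv_cons h k a t),
      multisetConv_add_left, multisetConv_add_right]
    simp only [ih]
    ring

lemma filter_antidiagonal_snd_eq_zero (s : Multiset V) :
    (s.antidiagonal.filter fun p => p.2.card = 0) = {(s, 0)} := by
  induction s using Multiset.induction with
  | empty => simp
  | cons a s ih =>
    rw [Multiset.antidiagonal_cons, Multiset.filter_add, Multiset.filter_map, Multiset.filter_map]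
    simp [Function.comp_def, ih]

lemma multisetConv_eq_add (g h : Multiset V → ℂ) (s : Multiset V) :
    multisetConv g h s = g s * h 0 +
      ((s.antidiagonal.filter fun p => ¬ p.2.card = 0).map fun p => g p.1 * h p.2).sum := by
  conv_lhs => rw [multisetConv, ← Multiset.filter_add_not
    (fun p : Multiset V × Multiset V => p.2.card = 0) s.antidiagonal, Multiset.map_add,
    Multiset.sum_add, filter_antidiagonal_snd_eq_zero]
  simp

lemma card_fst_lt_of_mem_filter {s : Multiset V} {p : Multiset V × Multiset V}
    (hp : p ∈ s.antidiagonal.filter fun p => ¬ p.2.card = 0) : p.1.card < s.card := by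
  rw [Multiset.mem_filter, Multiset.mem_antidiagonal] at hp
  have := hp.2
  rw [← hp.1, Multiset.card_add]
  omega

/-- The term `g s * m 0` is isolated; all others involve `g` on strictly smaller multisets, so `g`
is determined recursively. -/
lemma multisetConv_left_cancel {g g' m : Multiset V → ℂ} (hm : m 0 = 1)
    (h : ∀ s, multisetConv g m s = multisetConv g' m s) : g = g' := by
  funext s
  induction hn : s.card using Nat.strong_induction_on generalizing s with
  | _ n ih =>
    have hs := h s
    rw [multisetConv_eq_add, multisetConv_eq_add, hm, mul_one, mul_one] at hs
    refine add_right_cancel (hs.trans ?_)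
    congr 2
    refine Multiset.map_congr rfl fun p hp => ?_
    rw [ih _ (hn ▸ card_fst_lt_of_mem_filter hp) p.1 rfl]

/-- The solution `k` of `k ⋆ m = g` (for `m 0 = 1`). -/
noncomputable def multisetDeconv (g m : Multiset V → ℂ) (s : Multiset V) : ℂ :=
  g s - ((s.antidiagonal.filter fun p => ¬ p.2.card = 0).attach.map
    fun p => multisetDeconv g m p.1.1 * m p.1.2).sum
termination_by s.card
decreasing_by exact card_fst_lt_of_mem_filter p.2

lemma multisetDeconv_conv {g m : Multiset V → ℂ} (hm : m 0 = 1) (s : Multiset V) :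
    multisetConv (multisetDeconv g m) m s = g s := by
  rw [multisetConv_eq_add, multisetDeconv, hm, mul_one,
    Multiset.attach_map_val' _ (fun p : Multiset V × Multiset V => multisetDeconv g m p.1 * m p.2)]
  ring

/-- The abstract joint cumulant of `a` and the members of `s`, for a moment function `m`. -/
noncomputable def abstractCumulant (m : Multiset V → ℂ) (a : V) : Multiset V → ℂ :=
  multisetDeconv (fun s => m (a ::ₘ s)) m

lemma abstractCumulant_conv {m : Multiset V → ℂ} (hm : m 0 = 1) (a : V) (s : Multiset V) :
    multisetConv (abstractCumulant m a) m s = m (a ::ₘ s) :=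
  multisetDeconv_conv hm s

/-- The tool for computing cumulants: guess a candidate and verify the moment identity. -/
lemma eq_abstractCumulant {m : Multiset V → ℂ} (hm : m 0 = 1) {a : V} {g : Multiset V → ℂ}
    (h : ∀ s, multisetConv g m s = m (a ::ₘ s)) : g = abstractCumulant m a :=
  multisetConv_left_cancel hm fun s => (h s).trans (abstractCumulant_conv hm a s).symm

lemma abstractCumulant_zero {m : Multiset V → ℂ} (hm : m 0 = 1) (a : V) :
    abstractCumulant m a 0 = m {a} := by
  simpa [hm] using abstractCumulant_conv hm a 0

/-- Moments with two distinguished entries in terms of cumulants. -/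
lemma moment_cons_cons {m : Multiset V → ℂ} (hm : m 0 = 1) (a b : V) (s : Multiset V) :
    m (a ::ₘ b ::ₘ s) = multisetConv (fun t => abstractCumulant m a (b ::ₘ t) +
      multisetConv (abstractCumulant m a) (abstractCumulant m b) t) m s := by
  rw [← abstractCumulant_conv hm a, multisetConv_cons, multisetConv_add_left]
  simp only [multisetConv_assoc]
  rw [funext (abstractCumulant_conv hm b), add_comm]

/-- The recursion singles out one argument. Symmetry comes back because `m` is symmetric in its
arguments and the product term of `moment_cons_cons` is commutative. -/
lemma abstractCumulant_swap {m : Multiset V → ℂ} (hm : m 0 = 1) (a b : V) (s : Multiset V) :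
    abstractCumulant m a (b ::ₘ s) = abstractCumulant m b (a ::ₘ s) := by
  have := congrFun (multisetConv_left_cancel hm fun s =>
    (moment_cons_cons hm a b s).symm.trans
      ((congrArg m (Multiset.cons_swap a b s)).trans (moment_cons_cons hm b a s))) s
  rw [multisetConv_comm (abstractCumulant m b)] at this
  exact add_right_cancel this

lemma abstractCumulant_congr {m : Multiset V → ℂ} (hm : m 0 = 1) {a b : V}
    (h : ∀ s, m (a ::ₘ s) = m (b ::ₘ s)) : abstractCumulant m a = abstractCumulant m b :=
  eq_abstractCumulant hm fun s => (abstractCumulant_conv hm a s).trans (h s)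

/-- The sum of `K b (s \ b)` over all members `b` of `s`. -/
noncomputable def sumErase [DecidableEq V] (K : V → Multiset V → ℂ) (s : Multiset V) : ℂ :=
  (s.map fun b => K b (s.erase b)).sum

variable [DecidableEq V]

@[simp] lemma sumErase_zero (K : V → Multiset V → ℂ) : sumErase K 0 = 0 := by simp [sumErase]

lemma sumErase_cons (K : V → Multiset V → ℂ) (a : V) (s : Multiset V) :
    sumErase K (a ::ₘ s) = K a s + sumErase (fun b t => K b (a ::ₘ t)) s := by
  rw [sumErase, Multiset.map_cons, Multiset.sum_cons, Multiset.erase_cons_head, sumErase]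
  congr 2
  refine Multiset.map_congr rfl fun b hb => ?_
  by_cases hba : b = a
  · subst hba
    rw [Multiset.erase_cons_head, Multiset.cons_erase hb]
  · rw [Multiset.erase_cons_tail _ (Ne.symm hba)]

lemma sumErase_add (K K' : V → Multiset V → ℂ) (s : Multiset V) :
    sumErase (fun b t => K b t + K' b t) s = sumErase K s + sumErase K' s := by
  simp [sumErase]

/-- Each removed member lies in one of the two parts of a splitting; those with the removal in the
left part are exactly the terms collected here. -/
lemma sumErase_conv (K : V → Multiset V → ℂ) (m : Multiset V → ℂ) (s : Multiset V) :
    sumErase (fun b => multisetConv (K b) m) s = multisetConv (sumErase K) m s := by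
  induction s using Multiset.induction generalizing K m with
  | empty => simp
  | cons a s ih =>
    rw [sumErase_cons, multisetConv_cons, funext (fun t => sumErase_cons K a t),
      multisetConv_add_left]
    simp only [multisetConv_cons, sumErase_add, ← ih]
    ring

/-- A loop equation for moments yields the corresponding loop equation for cumulants. -/
lemma abstractCumulant_loop {m : Multiset V → ℂ} (hm : m 0 = 1) (T : V) (c : ℂ)
    (L : List (ℂ × V × V)) (Z : V → List (ℂ × V))
    (h : ∀ s, m (T ::ₘ s) = c * ((L.map fun q => q.1 * m (q.2.1 ::ₘ q.2.2 ::ₘ s)).sum +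
      sumErase (fun b t => ((Z b).map fun q => q.1 * m (q.2 ::ₘ t)).sum) s)) (s : Multiset V) :
    abstractCumulant m T s = c * ((L.map fun q => q.1 *
        (abstractCumulant m q.2.1 (q.2.2 ::ₘ s) +
          multisetConv (abstractCumulant m q.2.1) (abstractCumulant m q.2.2) s)).sum +
      sumErase (fun b t => ((Z b).map fun q => q.1 * abstractCumulant m q.2 t).sum) s) := by
  -- Convolving the candidate with `m` must give back the moment equation: `moment_cons_cons`
  -- restores the quadratic terms and `sumErase_conv` the sum over removed arguments.
  refine (congrFun (eq_abstractCumulant hm (a := T) (g := fun s => c * ((L.map fun q => q.1 *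
        (abstractCumulant m q.2.1 (q.2.2 ::ₘ s) +
          multisetConv (abstractCumulant m q.2.1) (abstractCumulant m q.2.2) s)).sum +
      sumErase (fun b t => ((Z b).map fun q => q.1 * abstractCumulant m q.2 t).sum) s))
    fun s => ?_) s).symm
  rw [multisetConv_smul_left, multisetConv_add_left, multisetConv_list_sum_left, h s]
  dsimp only
  rw [← sumErase_conv]
  simp only [multisetConv_list_sum_left, multisetConv_smul_left, abstractCumulant_conv hm,
    ← moment_cons_cons hm]

end MultisetConv

/-! ### Recursion for classical cumulants -/

section PartitionCumulant
variable {ι : Type*} [DecidableEq ι]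

/-- The signed sum over set partitions that defines cumulants, for a function on finite sets. -/
noncomputable def partitionCumulant (f : Finset ι → ℂ) (S : Finset ι) : ℂ :=
  ∑ π : Finpartition S,
    (-1) ^ (π.parts.card - 1) * ((π.parts.card - 1).factorial : ℂ) * ∏ B ∈ π.parts, f B

/-- The set partitions of `S`, as finite sets of finite sets. -/
def partitionsOf (S : Finset ι) : Finset (Finset (Finset ι)) :=
  (Finset.univ : Finset (Finpartition S)).image Finpartition.parts

lemma mem_partitionsOf {S : Finset ι} {Q : Finset (Finset ι)} :
    Q ∈ partitionsOf S ↔ ∃ π : Finpartition S, π.parts = Q := by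
  simp [partitionsOf]

lemma partitionCumulant_eq (f : Finset ι → ℂ) (S : Finset ι) :
    partitionCumulant f S = ∑ Q ∈ partitionsOf S,
      (-1) ^ (Q.card - 1) * ((Q.card - 1).factorial : ℂ) * ∏ B ∈ Q, f B := by
  rw [partitionsOf, Finset.sum_image fun π _ π' _ h => Finpartition.ext h, partitionCumulant]

lemma insert_sdiff_mem_partitionsOf {S T : Finset ι} {i : ι} (hi : i ∉ S) (hT : T ⊆ S)
    (hne : T ≠ S) {Q : Finset (Finset ι)} (hQ : Q ∈ partitionsOf (insert i T)) :
    insert (S \ T) Q ∈ partitionsOf (insert i S) ∧ S \ T ∉ Q ∧ i ∉ S \ T := by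
  obtain ⟨π, rfl⟩ := mem_partitionsOf.1 hQ
  have hST : S \ T ≠ ∅ := fun h => hne (hT.antisymm (Finset.sdiff_eq_empty_iff_subset.1 h))
  have hi' : i ∉ S \ T := fun h => hi (Finset.sdiff_subset h)
  refine ⟨mem_partitionsOf.2 ⟨π.extend (b := S \ T) hST ?_ ?_, rfl⟩, fun h => ?_, hi'⟩
  · exact (Finset.disjoint_insert_left.2 ⟨hi', Finset.disjoint_sdiff⟩)
  · rw [Finset.sup_eq_union, Finset.insert_union, Finset.union_sdiff_of_subset hT]
  · obtain ⟨x, hx⟩ := Finset.nonempty_iff_ne_empty.2 hST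
    rcases Finset.mem_insert.1 (π.subset h hx) with rfl | hxT
    · exact hi' hx
    · exact (Finset.mem_sdiff.1 hx).2 hxT

lemma erase_mem_partitionsOf {S C : Finset ι} {i : ι} {Q : Finset (Finset ι)}
    (hQ : Q ∈ partitionsOf (insert i S)) (hC : C ∈ Q) (hiC : i ∉ C) :
    Q.erase C ∈ partitionsOf (insert i (S \ C)) ∧ C ⊆ S ∧ C.Nonempty := by
  obtain ⟨π, rfl⟩ := mem_partitionsOf.1 hQ
  have hCS : C ⊆ S := fun x hx => by
    rcases Finset.mem_insert.1 (π.subset hC hx) with rfl | h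
    · exact absurd hx hiC
    · exact h
  refine ⟨mem_partitionsOf.2 ⟨π.ofSubset (Finset.erase_subset C π.parts) ?_, rfl⟩, hCS,
    π.nonempty_of_mem_parts hC⟩
  ext x
  simp only [Finset.mem_sup, Finset.mem_erase, id_eq, Finset.mem_insert, Finset.mem_sdiff]
  constructor
  · rintro ⟨D, ⟨hDC, hD⟩, hx⟩
    rcases Finset.mem_insert.1 (π.subset hD hx) with rfl | h
    · exact Or.inl rfl
    · exact Or.inr ⟨h, fun hxC => hDC (π.eq_of_mem_parts hD hC hx hxC)⟩
  · intro h
    have hx : x ∈ insert i S := by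
      rcases h with rfl | h
      · exact Finset.mem_insert_self _ _
      · exact Finset.mem_insert_of_mem h.1
    obtain ⟨D, hD, hxD⟩ := π.exists_mem hx
    refine ⟨D, ⟨?_, hD⟩, hxD⟩
    rintro rfl
    rcases h with rfl | h
    · exact hiC hxD
    · exact h.2 hxD

/-- Exactly one block contains `i`. -/
lemma card_filter_notMem_of_mem_partitionsOf {S : Finset ι} {i : ι} {Q : Finset (Finset ι)}
    (hQ : Q ∈ partitionsOf (insert i S)) :
    (Q.filter fun C => i ∉ C).card = Q.card - 1 ∧ 1 ≤ Q.card := by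
  obtain ⟨π, rfl⟩ := mem_partitionsOf.1 hQ
  have hi : i ∈ insert i S := Finset.mem_insert_self _ _
  have hp := π.part_mem.2 hi
  have : (π.parts.filter fun C => i ∉ C) = π.parts.erase (π.part i) := by
    ext C
    simp only [Finset.mem_filter, Finset.mem_erase]
    constructor
    · rintro ⟨hC, hiC⟩
      exact ⟨fun h => hiC (h ▸ π.mem_part_self.2 hi), hC⟩
    · rintro ⟨hne, hC⟩
      exact ⟨hC, fun hiC => hne (π.part_eq_of_mem hC hiC).symm⟩
  rw [this, Finset.card_erase_of_mem hp]
  exact ⟨rfl, Finset.card_pos.2 ⟨_, hp⟩⟩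

/-- The complement `S \ T` is added as a new block to a partition of `insert i T`. Conversely,
removing a block that avoids `i` from a partition of `insert i S` recovers `T` and its partition. -/
lemma sum_proper_partitionCumulant (f : Finset ι → ℂ) {i : ι} {S : Finset ι} (hi : i ∉ S) :
    ∑ T ∈ S.powerset.erase S, partitionCumulant f (insert i T) * f (S \ T) =
      ∑ Q ∈ partitionsOf (insert i S), ∑ _C ∈ Q.filter (fun C => i ∉ C),
        (-1) ^ (Q.card - 2) * ((Q.card - 2).factorial : ℂ) * ∏ B ∈ Q, f B := by
  simp only [partitionCumulant_eq, Finset.sum_mul]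
  rw [Finset.sum_sigma', Finset.sum_sigma']
  refine Finset.sum_bij' (fun x _ => ⟨insert (S \ x.1) x.2, S \ x.1⟩)
    (fun x _ => ⟨S \ x.2, x.1.erase x.2⟩) ?_ ?_ ?_ ?_ ?_
  · rintro ⟨T, Q⟩ h
    simp only [Finset.mem_sigma, Finset.mem_erase, Finset.mem_powerset] at h
    obtain ⟨h1, h2, h3⟩ := insert_sdiff_mem_partitionsOf hi h.1.2 h.1.1 h.2
    simp only [Finset.mem_sigma, Finset.mem_filter]
    exact ⟨h1, Finset.mem_insert_self _ _, h3⟩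
  · rintro ⟨Q, C⟩ h
    simp only [Finset.mem_sigma, Finset.mem_filter] at h
    obtain ⟨h1, h2, h3⟩ := erase_mem_partitionsOf h.1 h.2.1 h.2.2
    simp only [Finset.mem_sigma, Finset.mem_erase, Finset.mem_powerset]
    refine ⟨⟨fun h => ?_, Finset.sdiff_subset⟩, h1⟩
    obtain ⟨x, hx⟩ := h3
    rw [Finset.sdiff_eq_self_iff_disjoint] at h
    exact Finset.disjoint_left.1 h (h2 hx) hx
  · rintro ⟨T, Q⟩ h
    simp only [Finset.mem_sigma, Finset.mem_erase, Finset.mem_powerset] at h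
    obtain ⟨h1, h2, h3⟩ := insert_sdiff_mem_partitionsOf hi h.1.2 h.1.1 h.2
    simp only [Finset.sdiff_sdiff_eq_self h.1.2, Finset.erase_insert h2]
  · rintro ⟨Q, C⟩ h
    simp only [Finset.mem_sigma, Finset.mem_filter] at h
    obtain ⟨h1, h2, h3⟩ := erase_mem_partitionsOf h.1 h.2.1 h.2.2
    simp only [Finset.sdiff_sdiff_eq_self h2, Finset.insert_erase h.2.1]
  · rintro ⟨T, Q⟩ h
    simp only [Finset.mem_sigma, Finset.mem_erase, Finset.mem_powerset] at h
    obtain ⟨h1, h2, h3⟩ := insert_sdiff_mem_partitionsOf hi h.1.2 h.1.1 h.2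
    simp only [Finset.card_insert_of_notMem h2, Finset.prod_insert h2]
    rw [show Q.card + 1 - 2 = Q.card - 1 by omega]
    ring

/-- A partition with `k ≥ 2` blocks arises from the proper `T` in `k - 1` ways, each with
coefficient `(-1)^(k-2) (k-2)!`. This cancels its own coefficient `(-1)^(k-1) (k-1)!` from `T = S`,
so only the one-block partition survives. -/
lemma partitionCumulant_recursion {f : Finset ι → ℂ} (hf : f ∅ = 1) {i : ι} {S : Finset ι}
    (hi : i ∉ S) :
    ∑ T ∈ S.powerset, partitionCumulant f (insert i T) * f (S \ T) = f (insert i S) := by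
  have hne : insert i S ≠ ⊥ := (Finset.insert_nonempty i S).ne_empty
  rw [← Finset.add_sum_erase _ _ (Finset.mem_powerset_self S), sum_proper_partitionCumulant f hi,
    Finset.sdiff_self, hf, mul_one, partitionCumulant_eq, ← Finset.sum_add_distrib]
  rw [Finset.sum_eq_single {insert i S}]
  · simp [Finset.filter_singleton]
  · intro Q hQ hne
    obtain ⟨h1, h2⟩ := card_filter_notMem_of_mem_partitionsOf hQ
    rw [Finset.sum_const, h1, nsmul_eq_mul]
    have h3 : 2 ≤ Q.card := by
      by_contra h
      obtain ⟨B, rfl⟩ := Finset.card_eq_one.1 (show Q.card = 1 by omega)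
      obtain ⟨π, hπ⟩ := mem_partitionsOf.1 hQ
      refine hne ?_
      have := π.sup_parts
      rw [hπ, Finset.sup_singleton, id] at this
      rw [this]
    obtain ⟨k, hk⟩ := Nat.exists_eq_add_of_le' h3
    rw [hk, show k + 2 - 1 = k + 1 by omega, show k + 2 - 2 = k by omega, Nat.factorial_succ]
    push_cast
    ring
  · intro h
    exact absurd (mem_partitionsOf.2 ⟨Finpartition.indiscrete hne, rfl⟩) h

lemma multisetConv_map_val {V : Type*} (g h : Multiset V → ℂ) (y : ι → V) (S : Finset ι) :
    multisetConv g h (S.val.map y) =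
      ∑ T ∈ S.powerset, g (T.val.map y) * h ((S \ T).val.map y) := by
  induction S using Finset.induction generalizing g h with
  | empty => simp
  | insert i S hi ih =>
    rw [Finset.insert_val_of_notMem hi, Multiset.map_cons, multisetConv_cons, ih, ih,
      Finset.sum_powerset_insert hi]
    congr 1
    · refine Finset.sum_congr rfl fun T hT => ?_
      have hiT : i ∉ T := fun h => hi (Finset.mem_powerset.1 hT h)
      rw [Finset.insert_sdiff_of_notMem _ hiT, Finset.insert_val_of_notMem (by simp [hi]),
        Multiset.map_cons]
    · refine Finset.sum_congr rfl fun T hT => ?_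
      have hiT : i ∉ T := fun h => hi (Finset.mem_powerset.1 hT h)
      rw [Finset.insert_val_of_notMem hiT, Multiset.map_cons, Finset.insert_sdiff_insert,
        Finset.sdiff_insert_of_notMem hi]

/-- Both sides solve the same triangular recursion, so strong induction on `S` identifies them. -/
lemma partitionCumulant_eq_abstractCumulant {V : Type*} {m : Multiset V → ℂ} (hm : m 0 = 1)
    (y : ι → V) {i : ι} {S : Finset ι} (hi : i ∉ S) :
    partitionCumulant (fun B => m (B.val.map y)) (insert i S) =
      abstractCumulant m (y i) (S.val.map y) := by
  induction S using Finset.strongInduction with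
  | H S ih =>
    have h1 := partitionCumulant_recursion (f := fun B => m (B.val.map y)) (by simpa using hm) hi
    have h2 := abstractCumulant_conv hm (y i) (S.val.map y)
    rw [Finset.insert_val_of_notMem hi, Multiset.map_cons, ← h2, multisetConv_map_val,
      ← Finset.add_sum_erase _ _ (Finset.mem_powerset_self S),
      ← Finset.add_sum_erase S.powerset _ (Finset.mem_powerset_self S)] at h1
    simp only [Finset.sdiff_self, Finset.empty_val, Multiset.map_zero, hm, mul_one] at h1
    refine add_right_cancel (h1.trans ?_)
    congr 1
    refine Finset.sum_congr rfl fun T hT => ?_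
    rw [Finset.mem_erase, Finset.mem_powerset] at hT
    rw [ih T (hT.2.ssubset_of_ne hT.1) fun h => hi (hT.2 h)]

end PartitionCumulant

lemma jointCumulant_eq_abstractCumulant {Ω V : Type*} [MeasurableSpace Ω] {P : Measure Ω}
    {m : Multiset V → ℂ} (hm : m 0 = 1) {r : ℕ} (Y : Fin (r + 1) → Ω → ℂ) (y : Fin (r + 1) → V)
    (h : ∀ B : Finset (Fin (r + 1)), ∫ ω, ∏ i ∈ B, Y i ω ∂P = m (B.val.map y)) :
    jointCumulant P Y =
      abstractCumulant m (y 0) ((Finset.univ : Finset (Fin r)).val.map fun i => y i.succ) := by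
  have h0 : (0 : Fin (r + 1)) ∉ (Finset.univ : Finset (Fin r)).map (Fin.succEmb r) := by
    simp [Fin.succ_ne_zero]
  have h1 := partitionCumulant_eq_abstractCumulant hm y h0
  rw [Finset.map_val, Multiset.map_map] at h1
  have h2 : insert 0 ((Finset.univ : Finset (Fin r)).map (Fin.succEmb r)) = Finset.univ := by
    rw [Fin.univ_succ, Finset.cons_eq_insert]
    rfl
  rw [h2] at h1
  refine Eq.trans ?_ h1
  simp only [jointCumulant, partitionCumulant, h]

/-! ### Random variables with moments of all orders -/

/-- All moments of `f` are finite. -/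
def HasAllMoments {Ω : Type*} [MeasurableSpace Ω] (P : Measure Ω) (f : Ω → ℂ) : Prop :=
  ∀ q : NNReal, MemLp f q P

section HasAllMoments
variable {Ω : Type*} [MeasurableSpace Ω] {P : Measure Ω} {f g : Ω → ℂ}

lemma HasAllMoments.add (hf : HasAllMoments P f) (hg : HasAllMoments P g) :
    HasAllMoments P fun ω => f ω + g ω := fun q => (hf q).add (hg q)

lemma HasAllMoments.mul (hf : HasAllMoments P f) (hg : HasAllMoments P g) :
    HasAllMoments P fun ω => f ω * g ω := fun q => by
  -- Hölder with both exponents `2q`, available because all exponents are.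
  have : ENNReal.HolderTriple ((2 * q : NNReal) : ENNReal) ((2 * q : NNReal) : ENNReal) q := ⟨by
    rw [ENNReal.coe_mul, ENNReal.mul_inv (by simp) (by simp), ← add_mul]
    simp [ENNReal.inv_two_add_inv_two]⟩
  exact MemLp.mul' (p := ((2 * q : NNReal) : ENNReal)) (q := ((2 * q : NNReal) : ENNReal))
    (hg _) (hf _)

lemma hasAllMoments_const [IsFiniteMeasure P] (c : ℂ) : HasAllMoments P fun _ => c :=
  fun _ => memLp_const c

lemma HasAllMoments.const_mul (hf : HasAllMoments P f) (c : ℂ) :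
    HasAllMoments P fun ω => c * f ω := fun q => (hf q).const_mul c

lemma HasAllMoments.pow [IsFiniteMeasure P] (hf : HasAllMoments P f) (n : ℕ) :
    HasAllMoments P fun ω => f ω ^ n := by
  induction n with
  | zero => simpa using hasAllMoments_const 1
  | succ n ih => simpa only [pow_succ] using ih.mul hf

lemma HasAllMoments.integrable (hf : HasAllMoments P f) : Integrable f P :=
  memLp_one_iff_integrable.1 (by simpa using hf 1)

lemma HasAllMoments.eval [IsFiniteMeasure P] {T : Type*} {W : T → Ω → ℂ}
    (hW : ∀ t, HasAllMoments P (W t)) (F : MvPolynomial T ℂ) :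
    HasAllMoments P fun ω => MvPolynomial.eval (fun t => W t ω) F := by
  induction F using MvPolynomial.induction_on with
  | C a => simpa using hasAllMoments_const a
  | add p q hp hq => simpa using hp.add hq
  | mul_X p t hp => simpa using hp.mul (hW t)

end HasAllMoments

lemma measurable_mvPolynomial_eval {T : Type*} (F : MvPolynomial T ℂ) :
    Measurable fun x : T → ℂ => MvPolynomial.eval x F := by
  induction F using MvPolynomial.induction_on with
  | C a => simp
  | add p q hp hq => simp only [map_add]; exact hp.add hq
  | mul_X p t hp =>
    simp only [map_mul, MvPolynomial.eval_X]
    exact hp.mul (measurable_pi_apply t)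

/-! ### Moments of a real Gaussian variable -/

/-- The derivative of `x ^ n` times the density integrates to zero. For `n = 0` the truncated
exponent `n - 1` is harmless, being multiplied by `n`. -/
lemma integral_pow_gaussianReal (v : NNReal) (n : ℕ) :
    ∫ x, x ^ (n + 1) ∂(gaussianReal 0 v) = v * n * ∫ x, x ^ (n - 1) ∂(gaussianReal 0 v) := by
  by_cases hv : v = 0
  · simp [hv, gaussianReal_zero_var]
  have hv' : (v : ℝ) ≠ 0 := by exact_mod_cast hv
  have hint : ∀ k : ℕ, Integrable (fun x : ℝ => gaussianPDFReal 0 v x • x ^ k) volume := fun k => by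
    have h : Integrable (fun x : ℝ => x ^ k) (gaussianReal 0 v) := by
      refine ((memLp_id_gaussianReal (μ := 0) (v := v) k).integrable_norm_pow').mono'
        (by fun_prop) (Eventually.of_forall fun x => ?_)
      simp
    rw [gaussianReal_of_var_ne_zero 0 hv, gaussianPDF_def,
      integrable_withDensity_iff_integrable_smul' (by fun_prop) (by simp)] at h
    refine h.congr (Eventually.of_forall fun x => ?_)
    simp only [ENNReal.toReal_ofReal (gaussianPDFReal_nonneg 0 v x)]
  have hderiv : ∀ x : ℝ, HasDerivAt (fun x => gaussianPDFReal 0 v x • x ^ n)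
      (n * (gaussianPDFReal 0 v x • x ^ (n - 1)) -
        (v : ℝ)⁻¹ * (gaussianPDFReal 0 v x • x ^ (n + 1))) x := fun x => by
    have h1 : HasDerivAt (fun x => gaussianPDFReal 0 v x) (gaussianPDFReal 0 v x * (-x / v)) x := by
      have h2 : HasDerivAt (fun x : ℝ => -(x - 0) ^ 2 / (2 * v)) (-x / v) x := by
        have := ((((hasDerivAt_id x).sub_const 0).pow 2).neg).div_const (2 * v : ℝ)
        refine this.congr_deriv ?_
        simp
        field_simp
      refine (h2.exp.const_mul (√(2 * Real.pi * v))⁻¹).congr_deriv ?_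
      simp [gaussianPDFReal]
      ring
    refine (h1.mul (hasDerivAt_pow n x)).congr_deriv ?_
    simp only [smul_eq_mul]
    field_simp
    ring
  have h0 := integral_eq_zero_of_hasDerivAt_of_integrable hderiv
    (((hint _).const_mul _).sub ((hint _).const_mul _)) (hint n)
  rw [integral_sub ((hint _).const_mul _) ((hint _).const_mul _), integral_const_mul,
    integral_const_mul, sub_eq_zero] at h0
  rw [integral_gaussianReal_eq_integral_smul hv, integral_gaussianReal_eq_integral_smul hv,
    mul_assoc, h0]
  field_simp

/-! ### Gaussian integration by parts in one real direction -/

section Stein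
variable {Ω : Type*} [MeasurableSpace Ω] {P : Measure Ω} {T : Type*}

lemma ProbabilityTheory.HasGaussianLaw.hasAllMoments_ofReal {Z : Ω → ℝ} (hZ : HasGaussianLaw Z P) :
    HasAllMoments P fun ω => (Z ω : ℂ) := fun q => (hZ.memLp (p := q) (by simp)).ofReal

variable [IsProbabilityMeasure P]

/-- Stein's formula for `Zⁿ a(R)` with `Z` centered Gaussian and `R` independent of `Z`, in the
form of a polynomial in `Z` with coefficients polynomial in `R`. -/
lemma stein_polynomial {Z : Ω → ℝ} {v : NNReal} (hZ : HasGaussianLaw Z P)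
    (hlaw : P.map Z = gaussianReal 0 v) {R : T → Ω → ℂ} (hR : ∀ t, HasAllMoments P (R t))
    (hind : IndepFun Z (fun ω t => R t ω) P) (G : Polynomial (MvPolynomial T ℂ)) :
    ∫ ω, (Z ω : ℂ) * G.eval₂ (MvPolynomial.eval fun t => R t ω) (Z ω : ℂ) ∂P =
      v * ∫ ω, (Polynomial.derivative G).eval₂ (MvPolynomial.eval fun t => R t ω) (Z ω : ℂ) ∂P := by
  have hZm := hZ.hasAllMoments_ofReal
  have hG : ∀ G : Polynomial (MvPolynomial T ℂ), HasAllMoments P fun ω =>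
      G.eval₂ (MvPolynomial.eval fun t => R t ω) (Z ω : ℂ) := fun G => by
    induction G using Polynomial.induction_on' with
    | add p q hp hq => simpa using hp.add hq
    | monomial n a => simpa using (HasAllMoments.eval hR a).mul (hZm.pow n)
  have hmom : ∀ n : ℕ, ∫ ω, (Z ω : ℂ) ^ n ∂P = ((∫ x, x ^ n ∂(gaussianReal 0 v) : ℝ) : ℂ) := by
    intro n
    rw [← hlaw, integral_map hZ.aemeasurable (by fun_prop), ← integral_complex_ofReal]
    simp
  have hfac : ∀ (n : ℕ) (a : MvPolynomial T ℂ),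
      ∫ ω, (Z ω : ℂ) ^ n * MvPolynomial.eval (fun t => R t ω) a ∂P =
        (∫ ω, (Z ω : ℂ) ^ n ∂P) * ∫ ω, MvPolynomial.eval (fun t => R t ω) a ∂P := fun n a =>
    IndepFun.integral_fun_mul_eq_mul_integral
      (hind.comp (φ := fun x : ℝ => (x : ℂ) ^ n) (by fun_prop) (measurable_mvPolynomial_eval a))
      (hZm.pow n).integrable.aestronglyMeasurable
      (HasAllMoments.eval hR a).integrable.aestronglyMeasurable
  induction G using Polynomial.induction_on' with
  | add p q hp hq =>
    simp only [Polynomial.eval₂_add, mul_add, Polynomial.derivative_add]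
    rw [integral_add (hZm.mul (hG p)).integrable (hZm.mul (hG q)).integrable, hp, hq,
      integral_add (hG _).integrable (hG _).integrable, mul_add]
  | monomial n a =>
    have h1 : ∀ ω, (Z ω : ℂ) * (MvPolynomial.eval (fun t => R t ω) a * (Z ω : ℂ) ^ n) =
        (Z ω : ℂ) ^ (n + 1) * MvPolynomial.eval (fun t => R t ω) a := fun ω => by ring
    have h2 : ∀ ω, MvPolynomial.eval (fun t => R t ω) a * n * (Z ω : ℂ) ^ (n - 1) =
        n * ((Z ω : ℂ) ^ (n - 1) * MvPolynomial.eval (fun t => R t ω) a) := fun ω => by ring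
    simp only [Polynomial.derivative_monomial, Polynomial.eval₂_monomial, map_mul, map_natCast,
      h1, h2]
    rw [integral_const_mul, hfac, hfac, hmom, hmom, integral_pow_gaussianReal]
    push_cast
    ring

/-- Stein's formula for polynomials in variables `cₜ Z + Rₜ`. -/
lemma stein_of_indep {Z : Ω → ℝ} {v : NNReal} (hZ : HasGaussianLaw Z P)
    (hlaw : P.map Z = gaussianReal 0 v) {W : T → Ω → ℂ} (hW : ∀ t, HasAllMoments P (W t))
    (c : T → ℂ) (hind : IndepFun Z (fun ω t => W t ω - c t * Z ω) P) (F : MvPolynomial T ℂ) :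
    ∫ ω, (Z ω : ℂ) * MvPolynomial.eval (fun t => W t ω) F ∂P =
      ∫ ω, MvPolynomial.eval (fun t => W t ω)
        (MvPolynomial.mkDerivation ℂ (fun t => (MvPolynomial.C (v * c t) : MvPolynomial T ℂ)) F)
        ∂P := by
  have hZm := hZ.hasAllMoments_ofReal
  have hR : ∀ t, HasAllMoments P fun ω => W t ω - c t * Z ω := fun t => by
    simpa [sub_eq_add_neg] using (hW t).add (hZm.const_mul (-c t))
  -- `Φ` substitutes `c_t Z + R_t` for each variable, giving a polynomial in `Z` with coefficients
  -- in the residuals `R`. By the chain rule `hD`, the `Z`-derivative then corresponds to the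
  -- derivation with constant values `v c_t`.
  let Φ : MvPolynomial T ℂ →ₐ[ℂ] Polynomial (MvPolynomial T ℂ) := MvPolynomial.aeval fun t =>
    Polynomial.C (MvPolynomial.C (c t)) * Polynomial.X + Polynomial.C (MvPolynomial.X t)
  have hΦ : ∀ ω F, (Φ F).eval₂ (MvPolynomial.eval fun t => W t ω - c t * Z ω) (Z ω : ℂ) =
      MvPolynomial.eval (fun t => W t ω) F := fun ω F => by
    induction F using MvPolynomial.induction_on with
    | C a => simp [Φ, MvPolynomial.algebraMap_eq, IsScalarTower.algebraMap_apply ℂ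
        (MvPolynomial T ℂ) (Polynomial (MvPolynomial T ℂ)), Polynomial.algebraMap_eq]
    | add p q hp hq => simp [Polynomial.eval₂_add, hp, hq]
    | mul_X p t hp => simp [Polynomial.eval₂_mul, hp, Φ, Polynomial.eval₂_add]
  have hD : ∀ F, Polynomial.C (MvPolynomial.C (v : ℂ)) * Polynomial.derivative (Φ F) =
      Φ (MvPolynomial.mkDerivation ℂ
        (fun t => (MvPolynomial.C (v * c t) : MvPolynomial T ℂ)) F) := fun F => by
    induction F using MvPolynomial.induction_on with
    | C a => simp [Φ, MvPolynomial.algebraMap_eq, IsScalarTower.algebraMap_apply ℂ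
        (MvPolynomial T ℂ) (Polynomial (MvPolynomial T ℂ)), Polynomial.algebraMap_eq]
    | add p q hp hq => simp [mul_add, hp, hq]
    | mul_X p t hp =>
      rw [map_mul, Polynomial.derivative_mul, mul_add, ← mul_assoc, hp, Derivation.leibniz,
        MvPolynomial.mkDerivation_X, map_add, smul_eq_mul, smul_eq_mul, map_mul, map_mul]
      simp [Φ, MvPolynomial.algebraMap_eq, IsScalarTower.algebraMap_apply ℂ
        (MvPolynomial T ℂ) (Polynomial (MvPolynomial T ℂ)), Polynomial.algebraMap_eq]
      ring
  have h := stein_polynomial hZ hlaw hR hind (Φ F)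
  simp only [hΦ] at h
  rw [h, ← integral_const_mul]
  refine integral_congr_ae (Eventually.of_forall fun ω => ?_)
  dsimp only
  rw [← hΦ, ← hD]
  simp [Polynomial.eval₂_mul]

end Stein

/-! ### Gaussian integration by parts for complex processes -/

section GaussianProcess
variable {Ω : Type*} [MeasurableSpace Ω] {P : Measure Ω} {T : Type*}

lemma ProbabilityTheory.IsGaussianProcess.hasAllMoments {X : T → Ω → ℂ}
    (hX : IsGaussianProcess X P) (t : T) : HasAllMoments P (X t) := fun q =>
  (hX.hasGaussianLaw_eval t).memLp (by simp)

lemma integral_re_mul_add_im_mul {f g : Ω → ℂ} (hf : HasAllMoments P f) (hg : HasAllMoments P g) :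
    ∫ ω, f ω * g ω ∂P = ∫ ω, (Complex.reCLM (f ω) : ℂ) * g ω ∂P +
      Complex.I * ∫ ω, (Complex.imCLM (f ω) : ℂ) * g ω ∂P := by
  have h1 : HasAllMoments P fun ω => (Complex.reCLM (f ω) : ℂ) := fun q =>
    (Complex.reCLM.comp_memLp' (hf q)).ofReal
  have h2 : HasAllMoments P fun ω => (Complex.imCLM (f ω) : ℂ) := fun q =>
    (Complex.imCLM.comp_memLp' (hf q)).ofReal
  rw [← integral_const_mul, ← integral_add (h1.mul hg).integrable
    ((h2.mul hg).const_mul _).integrable]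
  refine integral_congr_ae (Eventually.of_forall fun ω => ?_)
  dsimp only
  conv_lhs => rw [← Complex.re_add_im (f ω)]
  simp only [Complex.reCLM_apply, Complex.imCLM_apply]
  ring

variable [IsProbabilityMeasure P]

/-- Residual variables after regression on a real part are independent of that part. -/
lemma indepFun_residual {X : T → Ω → ℂ} (hX : IsGaussianProcess X P)
    (h0 : ∀ t, ∫ ω, X t ω ∂P = 0) (t₀ : T) (L : ℂ →L[ℝ] ℝ) (c : T → ℂ)
    (hc : ∀ t, ∫ ω, (L (X t₀ ω) : ℂ) * (X t ω - c t * (L (X t₀ ω) : ℂ)) ∂P = 0) :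
    IndepFun (fun ω => L (X t₀ ω)) (fun ω t => X t ω - c t * (L (X t₀ ω) : ℂ)) P := by
  classical
  let Z : Unit → Ω → ℝ := fun _ ω => L (X t₀ ω)
  -- Uncorrelated implies independent for real jointly Gaussian families, so each residual is
  -- replaced by its real and imaginary parts and reassembled at the end.
  let K : Bool → ℂ →L[ℝ] ℝ := fun b => if b then Complex.reCLM else Complex.imCLM
  let Y : T × Bool → Ω → ℝ := fun p ω => K p.2 (X p.1 ω - c p.1 * (L (X t₀ ω) : ℂ))
  have hZY : IsGaussianProcess (Sum.elim Z Y) P := hX.of_isGaussianProcess fun s => by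
    rcases s with u | p
    · exact ⟨{t₀}, L ∘L ContinuousLinearMap.proj (R := ℝ)
        (φ := fun _ : ({t₀} : Finset T) => ℂ) ⟨t₀, by simp⟩, fun ω => rfl⟩
    · refine ⟨{t₀, p.1}, K p.2 ∘L (ContinuousLinearMap.proj (R := ℝ)
        (φ := fun _ : ({t₀, p.1} : Finset T) => ℂ) ⟨p.1, by simp⟩ -
        (ContinuousLinearMap.mul ℝ ℂ (c p.1)) ∘L Complex.ofRealCLM ∘L L ∘L
          ContinuousLinearMap.proj (R := ℝ)
            (φ := fun _ : ({t₀, p.1} : Finset T) => ℂ) ⟨t₀, by simp⟩), fun ω => ?_⟩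
      simp [Y]
  have hZg : HasGaussianLaw (fun ω => L (X t₀ ω)) P := (hX.hasGaussianLaw_eval t₀).map_fun L
  have hZm : HasAllMoments P fun ω => (L (X t₀ ω) : ℂ) := hZg.hasAllMoments_ofReal
  have hRm : ∀ t, HasAllMoments P fun ω => X t ω - c t * (L (X t₀ ω) : ℂ) := fun t => by
    simpa [sub_eq_add_neg] using (hX.hasAllMoments t).add (hZm.const_mul (-c t))
  have hZ0 : ∫ ω, L (X t₀ ω) ∂P = 0 := by
    rw [L.integral_comp_comm (hX.hasAllMoments t₀).integrable, h0, map_zero]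
  have hind := hZY.indepFun_of_covariance_eq_zero
    (fun u => hZg.aemeasurable)
    (fun p => (K p.2).continuous.measurable.comp_aemeasurable (hRm p.1).integrable.aemeasurable)
    (fun u p => by
      have hYp : HasGaussianLaw (Y p) P := hZY.hasGaussianLaw_eval (Sum.inr p)
      rw [covariance_eq_sub hZg.memLp_two hYp.memLp_two]
      have h1 : ∀ ω, (Z u * Y p) ω =
          K p.2 ((L (X t₀ ω) : ℂ) * (X p.1 ω - c p.1 * (L (X t₀ ω) : ℂ))) := fun ω => by
        rcases p with ⟨t, b⟩
        cases b <;> simp [Z, Y, K]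
      rw [integral_congr_ae (Eventually.of_forall h1),
        (K p.2).integral_comp_comm (hZm.mul (hRm p.1)).integrable, hc, map_zero]
      simp [hZ0])
  have hφ : Measurable fun x : Unit → ℝ => x () := measurable_pi_apply ()
  have := hind.comp (φ := fun x : Unit → ℝ => x ())
    (ψ := fun (x : T × Bool → ℝ) (t : T) => (x (t, true) : ℂ) + x (t, false) * Complex.I)
    hφ (by fun_prop)
  convert this using 1
  · rfl
  · funext ω t
    exact (Complex.re_add_im (X t ω - c t * (L (X t₀ ω) : ℂ))).symm

/-- Gaussian integration by parts against a real linear functional of one variable. -/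
lemma stein_real {X : T → Ω → ℂ} (hX : IsGaussianProcess X P)
    (h0 : ∀ t, ∫ ω, X t ω ∂P = 0) (t₀ : T) (L : ℂ →L[ℝ] ℝ) (F : MvPolynomial T ℂ) :
    ∫ ω, (L (X t₀ ω) : ℂ) * MvPolynomial.eval (fun t => X t ω) F ∂P =
      ∫ ω, MvPolynomial.eval (fun t => X t ω) (MvPolynomial.mkDerivation ℂ
        (fun t => (MvPolynomial.C (∫ ω, (L (X t₀ ω) : ℂ) * X t ω ∂P) : MvPolynomial T ℂ)) F) ∂P := by
  have hZg : HasGaussianLaw (fun ω => L (X t₀ ω)) P := (hX.hasGaussianLaw_eval t₀).map_fun L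
  have hZm : HasAllMoments P fun ω => (L (X t₀ ω) : ℂ) := hZg.hasAllMoments_ofReal
  have hZ0 : ∫ ω, L (X t₀ ω) ∂P = 0 := by
    rw [L.integral_comp_comm (hX.hasAllMoments t₀).integrable, h0, map_zero]
  set v : NNReal := Var[fun ω => L (X t₀ ω); P].toNNReal with hv
  have hlaw : P.map (fun ω => L (X t₀ ω)) = gaussianReal 0 v := by
    rw [hZg.map_eq_gaussianReal, hZ0]
  have hvar : ∫ ω, (L (X t₀ ω) : ℂ) * (L (X t₀ ω) : ℂ) ∂P = (v : ℂ) := by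
    have h1 : Var[fun ω => L (X t₀ ω); P] = ∫ ω, L (X t₀ ω) * L (X t₀ ω) ∂P := by
      rw [variance_of_integral_eq_zero hZg.aemeasurable hZ0]
      simp [sq]
    have h2 : ((v : ℝ) : ℂ) = ((∫ ω, L (X t₀ ω) * L (X t₀ ω) ∂P : ℝ) : ℂ) := by
      rw [hv, Real.coe_toNNReal _ (variance_nonneg _ _), h1]
    rw [h2, ← integral_complex_ofReal]
    simp
  -- A degenerate direction admits no regression coefficient, but then the variable vanishes almost
  -- surely and both sides are zero.
  by_cases hv0 : v = 0
  · have hZ : ∀ᵐ ω ∂P, L (X t₀ ω) = 0 := by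
      rw [hv0, gaussianReal_zero_var] at hlaw
      have : ∀ᵐ x ∂(P.map fun ω => L (X t₀ ω)), x = 0 := by
        rw [hlaw, ae_dirac_eq]
        rfl
      exact ae_of_ae_map hZg.aemeasurable this
    have hz : ∀ f : Ω → ℂ, ∫ ω, (L (X t₀ ω) : ℂ) * f ω ∂P = 0 := fun f =>
      integral_eq_zero_of_ae (by filter_upwards [hZ] with ω h; simp [h])
    have hD : MvPolynomial.mkDerivation ℂ
        (fun _ : T => (MvPolynomial.C 0 : MvPolynomial T ℂ)) = 0 :=
      MvPolynomial.derivation_ext fun t => by rw [MvPolynomial.mkDerivation_X]; simp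
    simp only [hz, hD]
    simp
  · have hv0' : (v : ℂ) ≠ 0 := by exact_mod_cast hv0
    have h := stein_of_indep hZg hlaw hX.hasAllMoments
      -- The regression coefficient, which makes the residual orthogonal to the direction; its
      -- factor `v⁻¹` cancels the variance in Stein's formula.
      (fun t => (v : ℂ)⁻¹ * ∫ ω, (L (X t₀ ω) : ℂ) * X t ω ∂P)
      (indepFun_residual hX h0 t₀ L _ fun t => by
        have h1 : ∀ (b : ℂ) (ω : Ω), (L (X t₀ ω) : ℂ) * (X t ω - b * (L (X t₀ ω) : ℂ)) =
            (L (X t₀ ω) : ℂ) * X t ω - b * ((L (X t₀ ω) : ℂ) * (L (X t₀ ω) : ℂ)) :=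
          fun b ω => by ring
        simp only [h1]
        rw [integral_sub (hZm.mul (hX.hasAllMoments t)).integrable
          ((hZm.mul hZm).const_mul _).integrable, integral_const_mul, hvar]
        field_simp
        simp) F
    simpa only [mul_inv_cancel_left₀ hv0'] using h

/-- Gaussian integration by parts for polynomials in a centered complex Gaussian process. -/
lemma stein_complex {X : T → Ω → ℂ} (hX : IsGaussianProcess X P)
    (h0 : ∀ t, ∫ ω, X t ω ∂P = 0) (t₀ : T) (F : MvPolynomial T ℂ) :
    ∫ ω, X t₀ ω * MvPolynomial.eval (fun t => X t ω) F ∂P =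
      ∫ ω, MvPolynomial.eval (fun t => X t ω) (MvPolynomial.mkDerivation ℂ
        (fun t => (MvPolynomial.C (∫ ω, X t₀ ω * X t ω ∂P) : MvPolynomial T ℂ)) F) ∂P := by
  have hm := hX.hasAllMoments
  rw [integral_re_mul_add_im_mul (hm t₀) (HasAllMoments.eval hm F), stein_real hX h0,
    stein_real hX h0, ← integral_const_mul, ← integral_add (HasAllMoments.eval hm _).integrable
    ((HasAllMoments.eval hm _).const_mul _).integrable]
  refine integral_congr_ae (Eventually.of_forall fun ω => ?_)
  dsimp only
  rw [← MvPolynomial.smul_eval, ← map_add, ← Derivation.smul_apply, ← Derivation.add_apply]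
  congr 2
  refine MvPolynomial.derivation_ext fun t => ?_
  simp [integral_re_mul_add_im_mul (hm t₀) (hm t), MvPolynomial.smul_eq_C_mul]

/-- Gaussian integration by parts for polynomials in a centered complex Gaussian process and in
random variables that are independent of it. -/
lemma stein_sum {X : T → Ω → ℂ} (hX : IsGaussianProcess X P)
    (h0 : ∀ t, ∫ ω, X t ω ∂P = 0) {T' : Type*} {A : T' → Ω → ℂ}
    (hA : ∀ t, HasAllMoments P (A t))
    (hind : IndepFun (fun ω t => X t ω) (fun ω t => A t ω) P) (t₀ : T)
    (F : MvPolynomial (T ⊕ T') ℂ) :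
    ∫ ω, X t₀ ω * MvPolynomial.eval (fun t => Sum.elim X A t ω) F ∂P =
      ∫ ω, MvPolynomial.eval (fun t => Sum.elim X A t ω) (MvPolynomial.mkDerivation ℂ
        (Sum.elim (fun t => (MvPolynomial.C (∫ ω, X t₀ ω * X t ω ∂P) : MvPolynomial (T ⊕ T') ℂ))
          fun _ => 0) F) ∂P := by
  have hm := hX.hasAllMoments
  have hall : ∀ t, HasAllMoments P (Sum.elim X A t) := fun t => by
    rcases t with t | t
    exacts [hm t, hA t]
  let D : Derivation ℂ (MvPolynomial (T ⊕ T') ℂ) (MvPolynomial (T ⊕ T') ℂ) :=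
    MvPolynomial.mkDerivation ℂ (Sum.elim (fun t =>
      (MvPolynomial.C (∫ ω, X t₀ ω * X t ω ∂P) : MvPolynomial (T ⊕ T') ℂ)) fun _ => 0)
  change _ = ∫ ω, MvPolynomial.eval (fun t => Sum.elim X A t ω) (D F) ∂P
  have hDl : ∀ t, D (MvPolynomial.X (Sum.inl t)) = MvPolynomial.C (∫ ω, X t₀ ω * X t ω ∂P) :=
    fun t => MvPolynomial.mkDerivation_X _ _ _
  have hDr : ∀ t, D (MvPolynomial.X (Sum.inr t)) = 0 := fun t => MvPolynomial.mkDerivation_X _ _ _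
  clear_value D
  -- Both sides are linear in `F`, so products `p(X) q(A)` suffice. For these, independence factors
  -- the expectation and `D` acts on `p(X)` only.
  have hspan : F ∈ Submodule.span ℂ (Set.range fun p : MvPolynomial T ℂ × MvPolynomial T' ℂ =>
      MvPolynomial.rename Sum.inl p.1 * MvPolynomial.rename Sum.inr p.2) := by
    induction F using MvPolynomial.induction_on with
    | C a => exact Submodule.subset_span ⟨(MvPolynomial.C a, 1), by simp⟩
    | add p q hp hq => exact add_mem hp hq
    | mul_X F t hF =>
      induction hF using Submodule.span_induction with
      | mem x hx =>
        obtain ⟨p, rfl⟩ := hx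
        rcases t with t | t
        · exact Submodule.subset_span ⟨(p.1 * MvPolynomial.X t, p.2), by simp; ring⟩
        · exact Submodule.subset_span ⟨(p.1, p.2 * MvPolynomial.X t), by simp; ring⟩
      | zero => simp
      | add x y _ _ hx hy => rw [add_mul]; exact add_mem hx hy
      | smul c x _ hx => rw [smul_mul_assoc]; exact Submodule.smul_mem _ _ hx
  induction hspan using Submodule.span_induction with
  | mem x hx =>
    obtain ⟨⟨p, q⟩, rfl⟩ := hx
    have hDp : D (MvPolynomial.rename Sum.inl p) = MvPolynomial.rename Sum.inl
        (MvPolynomial.mkDerivation ℂ (fun t =>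
          (MvPolynomial.C (∫ ω, X t₀ ω * X t ω ∂P) : MvPolynomial T ℂ)) p) := by
      induction p using MvPolynomial.induction_on with
      | C a => simp
      | add p q hp hq => simp [hp, hq]
      | mul_X p t hp => simp [hp, hDl]
    have hDq : D (MvPolynomial.rename Sum.inr q) = 0 := by
      induction q using MvPolynomial.induction_on with
      | C a => simp
      | add p q hp hq => simp [hp, hq]
      | mul_X p t hp => simp [hp, hDr]
    have hfac : ∀ p : MvPolynomial T ℂ, ∫ ω, MvPolynomial.eval (fun t => X t ω) p *
        MvPolynomial.eval (fun t => A t ω) q ∂P = (∫ ω, MvPolynomial.eval (fun t => X t ω) p ∂P) *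
        ∫ ω, MvPolynomial.eval (fun t => A t ω) q ∂P := fun p =>
      IndepFun.integral_fun_mul_eq_mul_integral
        (hind.comp (measurable_mvPolynomial_eval p) (measurable_mvPolynomial_eval q))
        (HasAllMoments.eval hm p).integrable.aestronglyMeasurable
        (HasAllMoments.eval hA q).integrable.aestronglyMeasurable
    have h1 := hfac (MvPolynomial.X t₀ * p)
    simp only [map_mul, MvPolynomial.eval_X, mul_assoc] at h1
    have h2 : D (MvPolynomial.rename Sum.inl p * MvPolynomial.rename Sum.inr q) =
        MvPolynomial.rename Sum.inl (MvPolynomial.mkDerivation ℂ (fun t =>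
          (MvPolynomial.C (∫ ω, X t₀ ω * X t ω ∂P) : MvPolynomial T ℂ)) p) *
        MvPolynomial.rename Sum.inr q := by
      rw [Derivation.leibniz, hDp, hDq, smul_zero, zero_add, smul_eq_mul, mul_comm]
    simp only [h2, map_mul, MvPolynomial.eval_rename, Function.comp_def, Sum.elim_inl,
      Sum.elim_inr]
    rw [h1, stein_complex hX h0, ← hfac]
  | zero => simp
  | add x y _ _ hx hy =>
    have hi := fun F : MvPolynomial (T ⊕ T') ℂ => HasAllMoments.eval hall F
    simp only [map_add, mul_add]
    rw [integral_add ((hm t₀).mul (hi x)).integrable ((hm t₀).mul (hi y)).integrable, hx, hy,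
      ← integral_add (hi _).integrable (hi _).integrable]
  | smul c x _ hx =>
    simp only [Derivation.map_smul, MvPolynomial.smul_eval, mul_left_comm _ c, integral_const_mul, hx]

end GaussianProcess

/-! ### Loop equations for traces of words in matrices -/

lemma multisetConv_map {V V' : Type*} (φ : V → V') (g h : Multiset V' → ℂ) (s : Multiset V) :
    multisetConv (fun t => g (t.map φ)) (fun t => h (t.map φ)) s =
      multisetConv g h (s.map φ) := by
  induction s using Multiset.induction generalizing g h with
  | empty => simp
  | cons a s ih =>
    simp only [multisetConv_cons, Multiset.map_cons]
    rw [← ih, ← ih]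

/-- Cumulants commute with relabelling the arguments; this transports statements between words,
polynomials and subfamilies. -/
lemma abstractCumulant_map {V V' : Type*} (φ : V → V') {m : Multiset V' → ℂ} (hm : m 0 = 1)
    (a : V) (s : Multiset V) :
    abstractCumulant m (φ a) (s.map φ) = abstractCumulant (fun t => m (t.map φ)) a s :=
  congrFun (eq_abstractCumulant (m := fun t => m (t.map φ)) (by simpa using hm)
    (g := fun t => abstractCumulant m (φ a) (t.map φ)) fun t => by
      rw [multisetConv_map, abstractCumulant_conv hm, Multiset.map_cons]) s

section Words
variable {α : Type*}

/-- All decompositions `w = u ++ a :: v` of a word, as triples `(a, u, v)`. -/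
def wordSplits : List α → List (α × List α × List α)
  | [] => []
  | a :: w => (a, [], w) :: (wordSplits w).map fun q => (q.1, a :: q.2.1, q.2.2)

lemma eq_of_mem_wordSplits {w : List α} {q : α × List α × List α} (hq : q ∈ wordSplits w) :
    w = q.2.1 ++ q.1 :: q.2.2 := by
  induction w generalizing q with
  | nil => simp [wordSplits] at hq
  | cons a w ih =>
    rw [wordSplits, List.mem_cons, List.mem_map] at hq
    rcases hq with rfl | ⟨q', hq', rfl⟩
    · rfl
    · simpa using ih hq'

variable {R : Type*} [CommRing R] [Algebra ℂ R] {n : Type*} [Fintype n] [DecidableEq n]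

/-- The product of the matrices `G a` along a word. -/
def wordMatrix (G : α → Matrix n n R) (w : List α) : Matrix n n R := (w.map G).prod

/-- The mixed moments of traces of words. -/
def traceMoment (G : α → Matrix n n R) (E : R →ₗ[ℂ] ℂ) (s : Multiset (List α)) : ℂ :=
  E (s.map fun w => (wordMatrix G w).trace).prod

/-- Integration by parts for the entries of the matrix `M`, against polynomials in the entries of
the matrices `G a`: the covariance of `M i j` with `G a k l` is `γ b(a) δ_{il} δ_{jk}`. -/
def MatrixStein (G : α → Matrix n n R) (E : R →ₗ[ℂ] ℂ) (M : Matrix n n R) (γ : ℂ)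
    (b : α → ℂ) : Prop :=
  ∀ i j, ∃ D : Derivation ℂ R R,
    (∀ a k l, D (G a k l) = algebraMap ℂ R (γ * (b a * if i = l ∧ j = k then 1 else 0))) ∧
    ∀ F, E (M i j * F) = E (D F)

variable {G : α → Matrix n n R} {E : R →ₗ[ℂ] ℂ} {γ : ℂ} {b : α → ℂ}

/-- The covariance `δ_{il} δ_{jk}` cuts the word at the differentiated letter: the left piece is
forced to end at index `j` and the right piece to start at `i`. -/
lemma derivation_wordMatrix {D : Derivation ℂ R R} {i j : n}
    (hD : ∀ a k l, D (G a k l) = algebraMap ℂ R (γ * (b a * if i = l ∧ j = k then 1 else 0)))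
    (w : List α) (k l : n) :
    D (wordMatrix G w k l) = ((wordSplits w).map fun q => (γ * b q.1) •
      (wordMatrix G q.2.1 k j * wordMatrix G q.2.2 i l)).sum := by
  induction w generalizing k with
  | nil =>
    simp only [wordMatrix, List.map_nil, List.prod_nil, wordSplits, List.sum_nil]
    by_cases h : k = l
    · subst h; simp
    · simp [Matrix.one_apply_ne h]
  | cons a w ih =>
    have h1 : ∀ w : List α, ∀ k l, wordMatrix G (a :: w) k l =
        ∑ p, G a k p * wordMatrix G w p l := fun w k l => by
      simp [wordMatrix, Matrix.mul_apply]
    rw [h1, map_sum]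
    simp only [Derivation.leibniz, hD, ih, Finset.sum_add_distrib, wordSplits, List.map_cons,
      List.sum_cons, List.map_map, Function.comp_def]
    rw [add_comm]
    congr 1
    · rw [Finset.sum_eq_single i]
      · by_cases hjk : j = k
        · subst hjk
          simp [wordMatrix, Algebra.smul_def, mul_comm]
        · simp [wordMatrix, hjk, Matrix.one_apply_ne (Ne.symm hjk)]
      · intro p _ hp
        simp [Ne.symm hp]
      · simp
    · simp only [h1, Finset.sum_mul, Finset.smul_sum]
      induction wordSplits w with
      | nil => simp
      | cons q L ihL =>
        simp only [List.map_cons, List.sum_cons, smul_add, Finset.sum_add_distrib, ihL]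
        congr 1
        refine Finset.sum_congr rfl fun p _ => ?_
        rw [smul_eq_mul, mul_smul_comm, mul_assoc]

lemma linearMap_mul_derivation_prod {V : Type*} [DecidableEq V] (E : R →ₗ[ℂ] ℂ)
    (D : Derivation ℂ R R) (τ : V → R) (F : R) (s : Multiset V) :
    E (F * D (s.map τ).prod) = sumErase (fun v t => E (F * D (τ v) * (t.map τ).prod)) s := by
  induction s using Multiset.induction generalizing F with
  | empty => simp
  | cons a s ih =>
    rw [sumErase_cons, Multiset.map_cons, Multiset.prod_cons, Derivation.leibniz, mul_add, map_add,
      add_comm]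
    congr 1
    · rw [smul_eq_mul]; congr 1; ring
    · rw [smul_eq_mul, ← mul_assoc, ih]
      congr 1
      funext v t
      rw [Multiset.map_cons, Multiset.prod_cons]
      congr 1
      ring

lemma list_sum_map_finset_sum {β ι M : Type*} [AddCommMonoid M] (S : Finset ι) (L : List β)
    (f : ι → β → M) : ∑ i ∈ S, (L.map (f i)).sum = (L.map fun q => ∑ i ∈ S, f i q).sum := by
  induction L with
  | nil => simp
  | cons q L ih => simp [Finset.sum_add_distrib, ih]

lemma sumErase_finset_sum {V ι : Type*} [DecidableEq V] (S : Finset ι)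
    (K : ι → V → Multiset V → ℂ) (s : Multiset V) :
    ∑ i ∈ S, sumErase (K i) s = sumErase (fun v t => ∑ i ∈ S, K i v t) s := by
  classical
  induction S using Finset.induction with
  | empty => simp [sumErase]
  | insert i S hi ih => simp only [Finset.sum_insert hi, ih, ← sumErase_add]

lemma sumErase_congr {V : Type*} [DecidableEq V] {K K' : V → Multiset V → ℂ}
    (h : ∀ v t, K v t = K' v t) (s : Multiset V) : sumErase K s = sumErase K' s := by
  rw [show K = K' from funext fun v => funext (h v)]

lemma sumErase_const_mul {V : Type*} [DecidableEq V] (c : ℂ) (K : V → Multiset V → ℂ)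
    (s : Multiset V) : sumErase (fun v t => c * K v t) s = c * sumErase K s := by
  simp [sumErase, Multiset.sum_map_mul_left]

/-- Summed over `i, j`, differentiating the rest `w` of the same trace closes two index cycles and
produces two traces; differentiating another trace `v = u a v'` closes one cycle and produces the
trace of `w v' u`. -/
lemma traceMoment_loop [DecidableEq α] {f : α} (h : MatrixStein G E (G f) γ b) (w : List α)
    (s : Multiset (List α)) :
    traceMoment G E ((f :: w) ::ₘ s) = γ * (((wordSplits w).map fun q => b q.1 *
        traceMoment G E (q.2.1 ::ₘ q.2.2 ::ₘ s)).sum +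
      sumErase (fun v t => ((wordSplits v).map fun q => b q.1 *
        traceMoment G E ((w ++ q.2.2 ++ q.2.1) ::ₘ t)).sum) s) := by
  choose D hD hE using h
  set τ : List α → R := fun w => (wordMatrix G w).trace with hτ
  set W := wordMatrix G w with hW
  have h1 : τ (f :: w) = ∑ i, ∑ j, G f i j * W j i := by
    simp [hτ, hW, wordMatrix, Matrix.trace, Matrix.mul_apply]
  have h2 : traceMoment G E ((f :: w) ::ₘ s) =
      ∑ i, ∑ j, E ((s.map τ).prod * D i j (W j i)) +
      ∑ i, ∑ j, E (W j i * D i j (s.map τ).prod) := by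
    rw [traceMoment, Multiset.map_cons, Multiset.prod_cons, ← hτ]
    change E (τ (f :: w) * _) = _
    rw [h1, ← Finset.sum_add_distrib, Finset.sum_mul, map_sum]
    refine Finset.sum_congr rfl fun i _ => ?_
    rw [← Finset.sum_add_distrib, Finset.sum_mul, map_sum]
    refine Finset.sum_congr rfl fun j _ => ?_
    rw [mul_assoc, hE, Derivation.leibniz, map_add, add_comm]
    rfl
  rw [h2, mul_add]
  congr 1
  · have h3 : ∀ i j, E ((s.map τ).prod * D i j (W j i)) = ((wordSplits w).map fun q =>
        γ * b q.1 * E ((s.map τ).prod *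
          (wordMatrix G q.2.1 j j * wordMatrix G q.2.2 i i))).sum := fun i j => by
      rw [derivation_wordMatrix (hD i j)]
      induction wordSplits w with
      | nil => simp
      | cons q L ih => simp [mul_add, ih]
    simp only [h3, list_sum_map_finset_sum]
    rw [← List.sum_map_mul_left]
    congr 1
    refine List.map_congr_left fun q _ => ?_
    simp only [← Finset.mul_sum, ← map_sum]
    rw [mul_assoc, traceMoment]
    congr 3
    simp only [Multiset.map_cons, Multiset.prod_cons, Matrix.trace, Matrix.diag_apply, hτ,
      ← Finset.sum_mul, ← Finset.mul_sum]
    ring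
  · simp only [linearMap_mul_derivation_prod, sumErase_finset_sum]
    rw [← sumErase_const_mul]
    refine sumErase_congr (fun v t => ?_) s
    have h3 : ∀ i j, E (W j i * D i j (τ v) * (t.map τ).prod) = ((wordSplits v).map fun q =>
        γ * b q.1 * E ((∑ k, W j i * (wordMatrix G q.2.1 k j * wordMatrix G q.2.2 i k)) *
          (t.map τ).prod)).sum := fun i j => by
      have h4 : D i j (τ v) = ((wordSplits v).map fun q => (γ * b q.1) •
          ∑ k, (wordMatrix G q.2.1 k j * wordMatrix G q.2.2 i k)).sum := by
        simp only [hτ, Matrix.trace, Matrix.diag_apply, map_sum, derivation_wordMatrix (hD i j),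
          list_sum_map_finset_sum, Finset.smul_sum]
      rw [h4]
      induction wordSplits v with
      | nil => simp
      | cons q L ih => simp [mul_add, add_mul, ih, Finset.mul_sum]
    simp only [h3, list_sum_map_finset_sum]
    rw [← List.sum_map_mul_left]
    congr 1
    refine List.map_congr_left fun q _ => ?_
    simp only [← Finset.mul_sum, ← map_sum]
    rw [mul_assoc, traceMoment, Multiset.map_cons, Multiset.prod_cons]
    congr 3
    simp only [← Finset.sum_mul]
    congr 1
    simp only [wordMatrix, List.map_append, List.prod_append, Matrix.trace, Matrix.diag_apply,
      Matrix.mul_apply, Finset.sum_mul, hW]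
    rw [Finset.sum_comm]
    refine Finset.sum_congr rfl fun j _ => ?_
    conv_rhs => rw [Finset.sum_comm]
    refine Finset.sum_congr rfl fun k _ => ?_
    rw [Finset.mul_sum]
    exact Finset.sum_congr rfl fun i _ => by ring

end Words

/-! ### Convergence of normalized cumulants -/

section Limits

/-- The cumulant normalized so as to have a limit: first cumulants are divided by `N`. -/
noncomputable def normCumulant {V : Type*} (m : ℕ → Multiset V → ℂ) (w : V) (s : Multiset V)
    (N : ℕ) : ℂ :=
  (if s.card = 0 then 1 / (N : ℂ) else 1) * abstractCumulant (m N) w s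

/-- The limit of the normalized cumulants. -/
noncomputable def limCumulant {V : Type*} (m : ℕ → Multiset V → ℂ) (w : V) (s : Multiset V) : ℂ :=
  limUnder atTop (normCumulant m w s)

/-- The normalized cumulants converge, to zero if there are at least three arguments. -/
def CumulantConverges {V : Type*} (m : ℕ → Multiset V → ℂ) (w : V) (s : Multiset V) : Prop :=
  Tendsto (normCumulant m w s) atTop (𝓝 (limCumulant m w s)) ∧ (2 ≤ s.card → limCumulant m w s = 0)

section General
variable {V : Type*} {m : ℕ → Multiset V → ℂ} {w : V} {s : Multiset V}

lemma cumulantConverges_of_tendsto {L : ℂ} (h : Tendsto (normCumulant m w s) atTop (𝓝 L))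
    (hL : 2 ≤ s.card → L = 0) : CumulantConverges m w s := by
  have : limCumulant m w s = L := h.limUnder_eq
  exact ⟨this ▸ h, this ▸ hL⟩

lemma normCumulant_of_ne (hs : s.card ≠ 0) (N : ℕ) :
    normCumulant m w s N = abstractCumulant (m N) w s := by
  simp only [normCumulant, if_neg hs, one_mul]

lemma normCumulant_zero (N : ℕ) :
    normCumulant m w 0 N = 1 / (N : ℂ) * abstractCumulant (m N) w 0 := by
  simp [normCumulant]

lemma normCumulant_swap (hm : ∀ N, m N 0 = 1) (a b : V) (s : Multiset V) :
    normCumulant m a (b ::ₘ s) = normCumulant m b (a ::ₘ s) := by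
  funext N
  simp [normCumulant, abstractCumulant_swap (hm N) a b]

lemma CumulantConverges.swap (hm : ∀ N, m N 0 = 1) {a b : V}
    (h : CumulantConverges m a (b ::ₘ s)) : CumulantConverges m b (a ::ₘ s) := by
  refine cumulantConverges_of_tendsto (L := limCumulant m a (b ::ₘ s)) ?_ fun h2 => h.2 (by
    simpa using h2)
  rw [normCumulant_swap hm b a]
  exact h.1

lemma tendsto_one_div_nat : Tendsto (fun N : ℕ => 1 / (N : ℂ)) atTop (𝓝 0) :=
  tendsto_one_div_atTop_nhds_zero_nat

lemma CumulantConverges.tendsto (h : CumulantConverges m w s) (hs : s.card ≠ 0) :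
    Tendsto (fun N => abstractCumulant (m N) w s) atTop (𝓝 (limCumulant m w s)) :=
  h.1.congr fun N => normCumulant_of_ne hs N

lemma CumulantConverges.tendsto_zero (h : CumulantConverges m w 0) :
    Tendsto (fun N : ℕ => 1 / (N : ℂ) * abstractCumulant (m N) w 0) atTop (𝓝 (limCumulant m w 0)) :=
  h.1.congr fun N => normCumulant_zero N

lemma CumulantConverges.tendsto_div (h : CumulantConverges m w s) (hs : s.card ≠ 0) :
    Tendsto (fun N : ℕ => 1 / (N : ℂ) * abstractCumulant (m N) w s) atTop (𝓝 0) := by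
  simpa using tendsto_one_div_nat.mul (h.tendsto hs)

end General

variable {α : Type*} [DecidableEq α] {m : ℕ → Multiset (List α) → ℂ} {f : α} {b : α → ℂ}

/-- The loop equation for moments of words starting with the letter `f`. -/
def LoopEquation (m : ℕ → Multiset (List α) → ℂ) (f : α) (b : α → ℂ) : Prop :=
  ∀ N w s, m N ((f :: w) ::ₘ s) = 1 / (N : ℂ) * (((wordSplits w).map fun q => b q.1 *
        m N (q.2.1 ::ₘ q.2.2 ::ₘ s)).sum +
      sumErase (fun v t => ((wordSplits v).map fun q => b q.1 *
        m N ((w ++ q.2.2 ++ q.2.1) ::ₘ t)).sum) s)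

lemma LoopEquation.cumulant (h : LoopEquation m f b) (hm : ∀ N, m N 0 = 1) (N : ℕ) (w : List α)
    (s : Multiset (List α)) :
    abstractCumulant (m N) (f :: w) s = 1 / (N : ℂ) * (((wordSplits w).map fun q => b q.1 *
        (abstractCumulant (m N) q.2.1 (q.2.2 ::ₘ s) + multisetConv (abstractCumulant (m N) q.2.1)
          (abstractCumulant (m N) q.2.2) s)).sum +
      sumErase (fun v t => ((wordSplits v).map fun q => b q.1 *
        abstractCumulant (m N) (w ++ q.2.2 ++ q.2.1) t).sum) s) := by
  have := abstractCumulant_loop (hm N) (f :: w) (1 / (N : ℂ))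
    ((wordSplits w).map fun q => (b q.1, q.2.1, q.2.2))
    (fun v => (wordSplits v).map fun q => (b q.1, w ++ q.2.2 ++ q.2.1))
    (fun s => by simpa [List.map_map, Function.comp_def] using h N w s) s
  simpa [List.map_map, Function.comp_def] using this

/-- After normalization the product of two first cumulants has order one, while the second cumulant
keeps a factor `1 / N²`. -/
lemma LoopEquation.tendsto_first (h : LoopEquation m f b) (hm : ∀ N, m N 0 = 1) (w : List α)
    (hw : ∀ q ∈ wordSplits w, CumulantConverges m q.2.1 0 ∧ CumulantConverges m q.2.2 0 ∧
      CumulantConverges m q.2.1 {q.2.2}) :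
    Tendsto (normCumulant m (f :: w) 0) atTop (𝓝 ((wordSplits w).map fun q => b q.1 *
      (limCumulant m q.2.1 0 * limCumulant m q.2.2 0)).sum) := by
  have h1 : ∀ N : ℕ, normCumulant m (f :: w) 0 N = ((wordSplits w).map fun q => b q.1 *
      (1 / (N : ℂ) * (1 / (N : ℂ) * abstractCumulant (m N) q.2.1 {q.2.2}) +
        (1 / (N : ℂ) * abstractCumulant (m N) q.2.1 0) *
          (1 / (N : ℂ) * abstractCumulant (m N) q.2.2 0))).sum := fun N => by
    rw [normCumulant_zero, h.cumulant hm, sumErase_zero, add_zero, ← mul_assoc,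
      ← List.sum_map_mul_left]
    congr 1
    refine List.map_congr_left fun q _ => ?_
    rw [multisetConv_zero, Multiset.cons_zero]
    ring
  simp only [funext h1]
  refine tendsto_list_sum _ fun q hq => ?_
  obtain ⟨hU, hV, hUV⟩ := hw q hq
  refine Tendsto.const_mul _ ?_
  simpa using (tendsto_one_div_nat.mul (hUV.tendsto_div (by simp))).add
    (hU.tendsto_zero.mul hV.tendsto_zero)

/-- The joint third cumulant is damped by `1 / N`. Each product contains exactly one first cumulant,
and each merged word is a first cumulant; these absorb the prefactor. -/
lemma LoopEquation.tendsto_second (h : LoopEquation m f b) (hm : ∀ N, m N 0 = 1) (w v : List α)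
    (hw : ∀ q ∈ wordSplits w, CumulantConverges m q.2.1 0 ∧ CumulantConverges m q.2.2 0 ∧
      CumulantConverges m q.2.1 {v} ∧ CumulantConverges m q.2.2 {v} ∧
      CumulantConverges m q.2.1 (q.2.2 ::ₘ {v}))
    (hv : ∀ q ∈ wordSplits v, CumulantConverges m (w ++ q.2.2 ++ q.2.1) 0) :
    Tendsto (normCumulant m (f :: w) {v}) atTop (𝓝 (((wordSplits w).map fun q => b q.1 *
      (limCumulant m q.2.1 0 * limCumulant m q.2.2 {v} +
        limCumulant m q.2.1 {v} * limCumulant m q.2.2 0)).sum +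
      ((wordSplits v).map fun q => b q.1 * limCumulant m (w ++ q.2.2 ++ q.2.1) 0).sum)) := by
  have h1 : ∀ N : ℕ, normCumulant m (f :: w) {v} N = ((wordSplits w).map fun q => b q.1 *
      (1 / (N : ℂ) * abstractCumulant (m N) q.2.1 (q.2.2 ::ₘ {v}) +
        ((1 / (N : ℂ) * abstractCumulant (m N) q.2.1 0) * abstractCumulant (m N) q.2.2 {v} +
        abstractCumulant (m N) q.2.1 {v} * (1 / (N : ℂ) * abstractCumulant (m N) q.2.2 0)))).sum +
      ((wordSplits v).map fun q => b q.1 *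
        (1 / (N : ℂ) * abstractCumulant (m N) (w ++ q.2.2 ++ q.2.1) 0)).sum := fun N => by
    rw [normCumulant_of_ne (by simp), h.cumulant hm, mul_add, ← List.sum_map_mul_left]
    congr 1
    · congr 1
      refine List.map_congr_left fun q _ => ?_
      rw [multisetConv_singleton]
      ring
    · simp only [sumErase, Multiset.map_singleton, Multiset.sum_singleton,
        Multiset.erase_singleton]
      rw [← List.sum_map_mul_left]
      congr 1
      refine List.map_congr_left fun q _ => ?_
      ring
  simp only [funext h1]
  refine (tendsto_list_sum _ fun q hq => ?_).add (tendsto_list_sum _ fun q hq => ?_)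
  · obtain ⟨hU, hV, hUv, hVv, hUVv⟩ := hw q hq
    refine Tendsto.const_mul _ ?_
    simpa using (hUVv.tendsto_div (by simp)).add ((hU.tendsto_zero.mul (hVv.tendsto (by simp))).add
      ((hUv.tendsto (by simp)).mul hV.tendsto_zero))
  · exact (hv q hq).tendsto_zero.const_mul _

/-- The prefactor `1 / N` is absorbed only by a first cumulant. Merging leaves at least two
arguments, hence no first cumulant; in a product, a first cumulant leaves a partner with at least
three arguments, which tends to zero. -/
lemma LoopEquation.tendsto_higher (h : LoopEquation m f b) (hm : ∀ N, m N 0 = 1) (w : List α)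
    {s : Multiset (List α)} (hs : 2 ≤ s.card)
    (hw : ∀ q ∈ wordSplits w, (∀ t ≤ s, CumulantConverges m q.2.1 t ∧
      CumulantConverges m q.2.2 t) ∧ CumulantConverges m q.2.1 (q.2.2 ::ₘ s))
    (hv : ∀ v ∈ s, ∀ q ∈ wordSplits v,
      CumulantConverges m (w ++ q.2.2 ++ q.2.1) (s.erase v)) :
    Tendsto (normCumulant m (f :: w) s) atTop (𝓝 0) := by
  have h1 : ∀ N : ℕ, normCumulant m (f :: w) s N = ((wordSplits w).map fun q => b q.1 *
      (1 / (N : ℂ) * abstractCumulant (m N) q.2.1 (q.2.2 ::ₘ s) +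
        (s.antidiagonal.map fun p => 1 / (N : ℂ) * (abstractCumulant (m N) q.2.1 p.1 *
          abstractCumulant (m N) q.2.2 p.2)).sum)).sum +
      (s.map fun v => ((wordSplits v).map fun q => b q.1 *
        (1 / (N : ℂ) * abstractCumulant (m N) (w ++ q.2.2 ++ q.2.1) (s.erase v))).sum).sum :=
      fun N => by
    rw [normCumulant_of_ne (by omega), h.cumulant hm, mul_add, ← List.sum_map_mul_left]
    congr 1
    · congr 1
      refine List.map_congr_left fun q _ => ?_
      rw [Multiset.sum_map_mul_left, multisetConv]
      ring
    · rw [sumErase, ← Multiset.sum_map_mul_left]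
      congr 1
      refine Multiset.map_congr rfl fun v _ => ?_
      rw [← List.sum_map_mul_left]
      congr 1
      refine List.map_congr_left fun q _ => ?_
      ring
  simp only [funext h1]
  -- Zero is written in the shape of the expansion so that limits can be taken term by term.
  have z1 : (0 : ℂ) = ((wordSplits w).map fun q => b q.1 *
      (0 + (s.antidiagonal.map fun _ => (0 : ℂ)).sum)).sum +
      (s.map fun v => ((wordSplits v).map fun q => b q.1 * (0 : ℂ)).sum).sum := by simp
  rw [z1]
  refine (tendsto_list_sum _ fun q hq => ?_).add
    (tendsto_multiset_sum _ fun v hvs => tendsto_list_sum _ fun q hq => ?_)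
  · obtain ⟨hUV, hUVs⟩ := hw q hq
    refine Tendsto.const_mul _ ((hUVs.tendsto_div (by simp)).add
      (tendsto_multiset_sum _ fun p hp => ?_))
    rw [Multiset.mem_antidiagonal] at hp
    have hp1 : p.1 ≤ s := hp ▸ Multiset.le_add_right _ _
    have hp2 : p.2 ≤ s := hp ▸ Multiset.le_add_left _ _
    obtain ⟨hU, -⟩ := hUV _ hp1
    obtain ⟨-, hV⟩ := hUV _ hp2
    by_cases h01 : p.1.card = 0
    · rw [Multiset.card_eq_zero] at h01
      have hps : p.2 = s := by rw [← hp, h01, zero_add]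
      rw [h01] at hU
      have := hU.tendsto_zero.mul (hV.tendsto (by rw [hps]; omega))
      rw [hV.2 (by rw [hps]; exact hs), mul_zero] at this
      simpa [h01, mul_assoc] using this
    · by_cases h02 : p.2.card = 0
      · rw [Multiset.card_eq_zero] at h02
        have hps : p.1 = s := by rw [← hp, h02, add_zero]
        rw [h02] at hV
        have := hV.tendsto_zero.mul (hU.tendsto h01)
        rw [hU.2 (by rw [hps]; exact hs), mul_zero] at this
        refine this.congr fun N => ?_
        rw [h02]
        ring
      · have := (hU.tendsto_div h01).mul (hV.tendsto h02)
        rw [zero_mul] at this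
        simpa [mul_assoc] using this
  · refine Tendsto.const_mul _ ((hv v hvs q hq).tendsto_div ?_)
    rw [Multiset.card_erase_of_mem hvs, Nat.pred_eq_sub_one]
    omega

end Limits

/-! ### Convergence for words, by induction on the number of distinguished letters -/

section WordLimits
variable {α : Type*} {m : ℕ → Multiset (List α) → ℂ}

lemma moment_append_comm (hrot : ∀ N x w s, m N ((x :: w) ::ₘ s) = m N ((w ++ [x]) ::ₘ s))
    (N : ℕ) (u v : List α) (s : Multiset (List α)) :
    m N ((u ++ v) ::ₘ s) = m N ((v ++ u) ::ₘ s) := by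
  induction u generalizing v with
  | nil => simp
  | cons a u ih => rw [List.cons_append, hrot, List.append_assoc, ih]; simp

lemma CumulantConverges.of_append_comm (hm : ∀ N, m N 0 = 1)
    (hrot : ∀ N x w s, m N ((x :: w) ::ₘ s) = m N ((w ++ [x]) ::ₘ s)) {u v : List α}
    {s : Multiset (List α)} (h : CumulantConverges m (u ++ v) s) :
    CumulantConverges m (v ++ u) s := by
  refine cumulantConverges_of_tendsto (h.1.congr fun N => ?_) h.2
  rw [normCumulant, normCumulant,
    abstractCumulant_congr (hm N) fun s => moment_append_comm hrot N u v s]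

/-- The number of letters satisfying `p` in all the words of `s`. -/
def letterCount (p : α → Bool) (s : Multiset (List α)) : ℕ := (s.map (List.countP p)).sum

@[simp] lemma letterCount_zero (p : α → Bool) : letterCount p (0 : Multiset (List α)) = 0 := rfl

@[simp] lemma letterCount_cons (p : α → Bool) (w : List α) (s : Multiset (List α)) :
    letterCount p (w ::ₘ s) = w.countP p + letterCount p s := by simp [letterCount]

@[simp] lemma letterCount_singleton (p : α → Bool) (w : List α) :
    letterCount p {w} = w.countP p := by simp [letterCount]

lemma letterCount_mono (p : α → Bool) {s t : Multiset (List α)} (h : s ≤ t) :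
    letterCount p s ≤ letterCount p t := by
  obtain ⟨u, rfl⟩ := Multiset.le_iff_exists_add.1 h
  simp [letterCount]

lemma countP_of_mem_wordSplits (p : α → Bool) {w : List α} {q : α × List α × List α}
    (hq : q ∈ wordSplits w) : q.2.1.countP p + q.2.2.countP p ≤ w.countP p := by
  rw [eq_of_mem_wordSplits hq]
  simp only [List.countP_append, List.countP_cons]
  omega

variable [DecidableEq α] {p : α → Bool}

/-- If the letters satisfying `p` obey loop equations and the cumulants of words without such
letters converge, then all cumulants of words converge. -/
theorem cumulantConverges_word (hm : ∀ N, m N 0 = 1)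
    (hrot : ∀ N x w s, m N ((x :: w) ::ₘ s) = m N ((w ++ [x]) ::ₘ s))
    (hloop : ∀ f, p f → ∃ b, LoopEquation m f b)
    (hbase : ∀ w s, letterCount p (w ::ₘ s) = 0 → CumulantConverges m w s)
    (w : List α) (s : Multiset (List α)) : CumulantConverges m w s := by
  -- Every term of the loop equation has lost at least the leading letter `f`, so the count over all
  -- words together decreases.
  induction hn : letterCount p (w ::ₘ s) using Nat.strong_induction_on generalizing w s with
  | _ n ih =>
    have ih' : ∀ w s, letterCount p (w ::ₘ s) < n → CumulantConverges m w s :=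
      fun w s h => ih _ h w s rfl
    clear ih
    have key : ∀ f w s, p f → letterCount p ((f :: w) ::ₘ s) = n →
        CumulantConverges m (f :: w) s := by
      intro f w s hf hn
      obtain ⟨b, hb⟩ := hloop f hf
      simp only [letterCount_cons, List.countP_cons, hf, if_true] at hn
      rcases Nat.lt_or_ge s.card 2 with hs | hs
      · by_cases h0 : s.card = 0
        · rw [Multiset.card_eq_zero] at h0
          subst h0
          refine cumulantConverges_of_tendsto (hb.tendsto_first hm w fun q hq => ?_) (by simp)
          have := countP_of_mem_wordSplits p hq
          refine ⟨ih' _ _ ?_, ih' _ _ ?_, ih' _ _ ?_⟩ <;>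
          · simp only [letterCount_cons, letterCount_singleton, letterCount_zero] at hn ⊢
            omega
        · obtain ⟨v, rfl⟩ := Multiset.card_eq_one.1 (show s.card = 1 by omega)
          refine cumulantConverges_of_tendsto (hb.tendsto_second hm w v (fun q hq => ?_)
            fun q hq => ?_) (by simp)
          · have := countP_of_mem_wordSplits p hq
            refine ⟨ih' _ _ ?_, ih' _ _ ?_, ih' _ _ ?_, ih' _ _ ?_, ih' _ _ ?_⟩ <;>
            · simp only [letterCount_cons, letterCount_singleton, letterCount_zero] at hn ⊢
              omega
          · have := countP_of_mem_wordSplits p hq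
            refine ih' _ _ ?_
            simp only [letterCount_cons, letterCount_singleton, letterCount_zero,
              List.countP_append] at hn ⊢
            omega
      · refine cumulantConverges_of_tendsto (hb.tendsto_higher hm w hs (fun q hq => ?_)
          fun v hv q hq => ?_) fun _ => rfl
        · have := countP_of_mem_wordSplits p hq
          refine ⟨fun t ht => ?_, ih' _ _ ?_⟩
          · have := letterCount_mono p ht
            refine ⟨ih' _ _ ?_, ih' _ _ ?_⟩ <;>
            · simp only [letterCount_cons]
              omega
          · simp only [letterCount_cons]
            omega
        · have := countP_of_mem_wordSplits p hq
          have h2 : letterCount p s = v.countP p + letterCount p (s.erase v) := by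
            rw [← letterCount_cons, Multiset.cons_erase hv]
          refine ih' _ _ ?_
          simp only [letterCount_cons, List.countP_append]
          omega
    -- Cyclic invariance of the trace brings a distinguished letter to the front.
    have key' : ∀ w s, w.countP p ≠ 0 → letterCount p (w ::ₘ s) = n →
        CumulantConverges m w s := by
      intro w s hw hn
      obtain ⟨f, hfw, hf⟩ := List.countP_pos_iff.1 (Nat.pos_of_ne_zero hw)
      obtain ⟨u, v, rfl⟩ := List.append_of_mem hfw
      refine CumulantConverges.of_append_comm hm hrot (u := f :: v) (v := u) ?_
      rw [List.cons_append]
      refine key _ _ _ hf ?_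
      rw [← hn]
      simp only [letterCount_cons, List.countP_cons, List.countP_append]
      omega
    by_cases h0 : n = 0
    · exact hbase w s (hn.trans h0)
    -- If the first word has no distinguished letter but the count is positive, some other argument
    -- has one; symmetry of cumulants exchanges the two.
    by_cases hw : w.countP p = 0
    · have h1 : ∃ v ∈ s, v.countP p ≠ 0 := by
        by_contra h
        push Not at h
        refine h0 ?_
        rw [← hn, letterCount_cons, hw, zero_add, letterCount, Multiset.sum_eq_zero]
        simpa using h
      obtain ⟨v, hv, hvp⟩ := h1
      obtain ⟨s, rfl⟩ := Multiset.exists_cons_of_mem hv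
      refine CumulantConverges.swap hm (key' _ _ hvp ?_)
      rw [← hn, Multiset.cons_swap]
    · exact key' w s hw hn

end WordLimits

/-! ### From words to polynomials by multilinearity -/

section Multilinear
variable {V : Type*} [AddCommGroup V] [Module ℂ V]

/-- A moment function that is linear in each argument. -/
structure IsMultilinearMoment (m : Multiset V → ℂ) : Prop where
  zero : m 0 = 1
  add : ∀ a b s, m ((a + b) ::ₘ s) = m (a ::ₘ s) + m (b ::ₘ s)
  smul : ∀ (c : ℂ) a s, m ((c • a) ::ₘ s) = c * m (a ::ₘ s)

lemma IsMultilinearMoment.cumulant_add {m : Multiset V → ℂ} (h : IsMultilinearMoment m) (a b : V)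
    (s : Multiset V) :
    abstractCumulant m (a + b) s = abstractCumulant m a s + abstractCumulant m b s := by
  refine (congrFun (eq_abstractCumulant h.zero (a := a + b)
    (g := fun s => abstractCumulant m a s + abstractCumulant m b s) fun s => ?_) s).symm
  simp only [multisetConv_add_left, abstractCumulant_conv h.zero, h.add]

lemma IsMultilinearMoment.cumulant_smul {m : Multiset V → ℂ} (h : IsMultilinearMoment m) (c : ℂ)
    (a : V) (s : Multiset V) : abstractCumulant m (c • a) s = c * abstractCumulant m a s := by
  refine (congrFun (eq_abstractCumulant h.zero (a := c • a)
    (g := fun s => c * abstractCumulant m a s) fun s => ?_) s).symm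
  simp only [multisetConv_smul_left, abstractCumulant_conv h.zero, h.smul]

variable {m : ℕ → Multiset V → ℂ}

lemma tendsto_normCumulant_add (hm : ∀ N, IsMultilinearMoment (m N)) {a b : V} {s : Multiset V}
    {x y : ℂ} (ha : Tendsto (normCumulant m a s) atTop (𝓝 x))
    (hb : Tendsto (normCumulant m b s) atTop (𝓝 y)) :
    Tendsto (normCumulant m (a + b) s) atTop (𝓝 (x + y)) :=
  (ha.add hb).congr fun N => by
    simp only [normCumulant, (hm N).cumulant_add, mul_add]

lemma tendsto_normCumulant_smul (hm : ∀ N, IsMultilinearMoment (m N)) (c : ℂ) {a : V}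
    {s : Multiset V} {x : ℂ} (ha : Tendsto (normCumulant m a s) atTop (𝓝 x)) :
    Tendsto (normCumulant m (c • a) s) atTop (𝓝 (c * x)) :=
  (ha.const_mul c).congr fun N => by
    simp only [normCumulant, (hm N).cumulant_smul]
    ring

lemma cumulantConverges_of_mem_span (hm : ∀ N, IsMultilinearMoment (m N)) {S : Set V}
    {s : Multiset V} (h : ∀ a ∈ S, CumulantConverges m a s) {a : V}
    (ha : a ∈ Submodule.span ℂ S) : CumulantConverges m a s := by
  induction ha using Submodule.span_induction with
  | mem x hx => exact h x hx
  | zero =>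
    refine cumulantConverges_of_tendsto (L := 0) (tendsto_const_nhds.congr fun N => ?_)
      fun _ => rfl
    have := (hm N).cumulant_smul 0 0 s
    rw [zero_smul, zero_mul] at this
    rw [normCumulant, this, mul_zero]
  | add x y _ _ hx hy =>
    exact cumulantConverges_of_tendsto (tendsto_normCumulant_add hm hx.1 hy.1)
      fun hs => by rw [hx.2 hs, hy.2 hs, add_zero]
  | smul c x _ hx =>
    exact cumulantConverges_of_tendsto (tendsto_normCumulant_smul hm c hx.1)
      fun hs => by rw [hx.2 hs, mul_zero]

/-- Convergence of cumulants on a spanning set implies convergence everywhere. -/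
theorem cumulantConverges_of_span {β : Type*} (φ : β → V)
    (hφ : Submodule.span ℂ (Set.range φ) = ⊤) (hm : ∀ N, IsMultilinearMoment (m N))
    (h : ∀ w s, CumulantConverges (fun N t => m N (t.map φ)) w s) (a : V) (s : Multiset V) :
    CumulantConverges m a s := by
  have hm0 := fun N => (hm N).zero
  -- Arguments are freed one at a time: `s` holds those already arbitrary, `t` those still in the
  -- spanning family.
  have key : ∀ (s : Multiset V) (t : Multiset β) (w : β),
      CumulantConverges m (φ w) (s + t.map φ) := by
    intro s
    induction s using Multiset.induction with
    | empty =>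
      intro t w
      refine cumulantConverges_of_tendsto ((h w t).1.congr fun N => ?_)
        fun hs => (h w t).2 (by simpa using hs)
      rw [normCumulant, normCumulant, zero_add, abstractCumulant_map φ (hm0 N), Multiset.card_map]
    | cons p s ih =>
      intro t w
      rw [Multiset.cons_add]
      refine CumulantConverges.swap hm0 (cumulantConverges_of_mem_span hm (S := Set.range φ) ?_
        (hφ ▸ Submodule.mem_top))
      rintro _ ⟨w', rfl⟩
      rw [← Multiset.add_cons, ← Multiset.map_cons]
      exact ih _ _
  refine cumulantConverges_of_mem_span hm (S := Set.range φ) ?_ (hφ ▸ Submodule.mem_top)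
  rintro _ ⟨w, rfl⟩
  simpa using key s 0 w

/-- The limit of normalized first cumulants, as a linear functional. -/
noncomputable def limFirst (hm : ∀ N, IsMultilinearMoment (m N))
    (h : ∀ a s, CumulantConverges m a s) : V →ₗ[ℂ] ℂ where
  toFun a := limCumulant m a 0
  map_add' a b := tendsto_nhds_unique (h (a + b) 0).1
    (tendsto_normCumulant_add hm (h a 0).1 (h b 0).1)
  map_smul' c a := tendsto_nhds_unique (h (c • a) 0).1 (tendsto_normCumulant_smul hm c (h a 0).1)

lemma limCumulant_comm (hm : ∀ N, IsMultilinearMoment (m N)) (a b : V) :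
    limCumulant m a {b} = limCumulant m b {a} := by
  rw [limCumulant, ← Multiset.cons_zero, normCumulant_swap fun N => (hm N).zero]
  rfl

/-- The limit of second cumulants, as a bilinear functional. -/
noncomputable def limSecond (hm : ∀ N, IsMultilinearMoment (m N))
    (h : ∀ a s, CumulantConverges m a s) : V →ₗ[ℂ] V →ₗ[ℂ] ℂ :=
  have hadd : ∀ a b c, limCumulant m (a + b) {c} = limCumulant m a {c} + limCumulant m b {c} :=
    fun a b c => tendsto_nhds_unique (h (a + b) {c}).1
      (tendsto_normCumulant_add hm (h a {c}).1 (h b {c}).1)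
  have hsmul : ∀ (c : ℂ) a b, limCumulant m (c • a) {b} = c * limCumulant m a {b} :=
    fun c a b => tendsto_nhds_unique (h (c • a) {b}).1
      (tendsto_normCumulant_smul hm c (h a {b}).1)
  LinearMap.mk₂ ℂ (fun a b => limCumulant m a {b}) hadd hsmul
    (fun a b c => by
      rw [limCumulant_comm hm, hadd, limCumulant_comm hm b, limCumulant_comm hm c])
    (fun c a b => by
      rw [limCumulant_comm hm, hsmul, limCumulant_comm hm b, smul_eq_mul])

end Multilinear

/-! ### Cyclic tuples -/

section CyclicTuples

variable {𝒜 : Type*} [Ring 𝒜]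

lemma tupleProd_succ {k : ℕ} (a : Fin (k + 1) → 𝒜) :
    tupleProd a = a 0 * tupleProd fun j : Fin k => a j.succ := by
  simp [tupleProd, List.ofFn_succ]

lemma tupleProd_rotate {k : ℕ} (a : Fin (k + 1) → 𝒜) :
    tupleProd (fun j => a (j + 1)) = (tupleProd fun j : Fin k => a j.succ) * a 0 := by
  rw [tupleProd, List.ofFn_succ']
  simp [tupleProd, Fin.coeSucc_eq_succ, Fin.last_add_one]

/-- Opening the cycle at position `l` leaves the later entries followed by the earlier ones, which
is cyclic order starting at `l + 1`. -/
lemma drop_append_take_ofFn {α : Type*} {k : ℕ} (b : Fin (k + 1) → α) (l : Fin (k + 1)) :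
    (List.ofFn b).drop (l + 1) ++ (List.ofFn b).take l =
      List.ofFn fun j : Fin k => b (l + j.succ) := by
  refine List.ext_getElem (by simp; omega) fun i h1 h2 => ?_
  have hi : i < k := by simpa using h2
  rw [List.getElem_append]
  split_ifs with h
  · simp only [List.length_drop, List.length_ofFn] at h
    simp only [List.getElem_drop, List.getElem_ofFn]
    congr 1
    apply Fin.ext
    rw [Fin.val_add, Fin.val_succ, Nat.mod_eq_of_lt (by simp only; omega)]
    simp only
    omega
  · simp only [List.length_drop, List.length_ofFn] at h
    simp only [List.getElem_take, List.getElem_ofFn, List.length_drop, List.length_ofFn]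
    congr 1
    apply Fin.ext
    rw [Fin.val_add, Fin.val_succ, Nat.mod_eq_sub_mod (by simp only; omega),
      Nat.mod_eq_of_lt (by simp only; omega)]
    simp only
    omega

lemma fin_two_eq_zero : ∀ {s t : Fin 2}, s ≠ 0 → s ≠ t → t = 0 := by decide

lemma fin_rev_add {k : ℕ} (j : Fin (k + 1)) : j.rev + j = Fin.last k := by
  apply Fin.ext
  rw [Fin.val_add, Fin.val_rev, Nat.mod_eq_of_lt (by omega), Fin.val_last]
  omega

lemma fin_rev_add_one {k : ℕ} (j : Fin (k + 1)) : (j + 1).rev + 1 = j.rev := by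
  have h := (fin_rev_add (j + 1)).trans (fin_rev_add j).symm
  rw [add_comm j 1, ← add_assoc] at h
  rw [add_comm j 1]
  exact add_right_cancel h

open Fin.CommRing in
-- With only two colours, alternation means that each step adds one modulo `2`.
lemma alternating_add {n : ℕ} [NeZero n] {i : Fin n → Fin 2} (hi : ∀ k, i k ≠ i (k + 1))
    (l : Fin n) (t : ℕ) : i (l + (t : Fin n)) = i l + (t : Fin 2) := by
  induction t with
  | zero => simp
  | succ t ih =>
    have h := hi (l + (t : Fin n))
    rw [Nat.cast_succ, Nat.cast_succ, ← add_assoc, ← add_assoc, ← ih]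
    omega

open Fin.CommRing in
-- Going once around the cycle returns to the initial colour.
lemma alternating_even {n : ℕ} [NeZero n] {i : Fin n → Fin 2} (hi : ∀ k, i k ≠ i (k + 1)) :
    Even n := by
  have h := alternating_add hi 0 n
  rw [Fin.natCast_self, add_zero, left_eq_add] at h
  rw [Fin.natCast_eq_zero] at h
  exact even_iff_two_dvd.2 h

open Fin.CommRing in
lemma alternating_add_succ {k : ℕ} {i : Fin (k + 1) → Fin 2} (hi : ∀ k, i k ≠ i (k + 1))
    (l : Fin (k + 1)) (j : Fin k) : i (l + j.succ) = i l + Fin.ofNat 2 (j + 1) := by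
  change _ = i l + ((j + 1 : ℕ) : Fin 2)
  rw [← alternating_add hi]
  congr 2
  apply Fin.ext
  rw [Fin.val_natCast, Nat.mod_eq_of_lt (by omega), Fin.val_succ]

end CyclicTuples

/-! ### Freeness of second order from loop equations -/

section LoopCalculus

open scoped TensorProduct

variable {𝒜 : Type*} [Ring 𝒜] [Algebra ℂ 𝒜]

/-- The functional `a ⊗ b ↦ α(a) β(b)`. -/
noncomputable def tensorFunctional (α β : 𝒜 →ₗ[ℂ] ℂ) : 𝒜 ⊗[ℂ] 𝒜 →ₗ[ℂ] ℂ :=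
  LinearMap.mul' ℂ ℂ ∘ₗ TensorProduct.map α β

@[simp] lemma tensorFunctional_tmul (α β : 𝒜 →ₗ[ℂ] ℂ) (a b : 𝒜) :
    tensorFunctional α β (a ⊗ₜ b) = α a * β b := by simp [tensorFunctional]

/-- The map `a ⊗ b ↦ b a`. -/
noncomputable def flipMul : 𝒜 ⊗[ℂ] 𝒜 →ₗ[ℂ] 𝒜 :=
  LinearMap.mul' ℂ 𝒜 ∘ₗ (TensorProduct.comm ℂ 𝒜 𝒜).toLinearMap

@[simp] lemma flipMul_tmul (a b : 𝒜) : flipMul (a ⊗ₜ[ℂ] b) = b * a := by simp [flipMul]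

/-- The loop equations satisfied by the limit distribution of Gaussian matrices `x f` together
with matrices generating the subalgebra `B`, in terms of free difference quotients `D f`. -/
structure LoopCalculus (S : SecondOrderNCPS 𝒜) {ι : Type*} (x : ι → 𝒜)
    (B : Subalgebra ℂ 𝒜) where
  c : ι → ι → ℂ
  D : ι → 𝒜 →ₗ[ℂ] 𝒜 ⊗[ℂ] 𝒜
  D_mul : ∀ f a b, D f (a * b) = D f a * (1 ⊗ₜ b) + (a ⊗ₜ 1) * D f b
  D_gen : ∀ f g, D f (x g) = c f g • (1 ⊗ₜ 1)
  D_eq_zero : ∀ f, ∀ b ∈ B, D f b = 0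
  φ_loop : ∀ f w, S.φ (x f * w) = tensorFunctional S.φ S.φ (D f w)
  ρ_loop : ∀ f w v, S.ρ (x f * w) v = tensorFunctional S.φ (S.ρ.flip v) (D f w) +
    tensorFunctional (S.ρ.flip v) S.φ (D f w) + S.φ (w * flipMul (D f v))
  ρ_symm : ∀ a b, S.ρ a b = S.ρ b a

/-- The centered elements of a subalgebra. -/
def centeredPart (φ : 𝒜 →ₗ[ℂ] ℂ) (B : Subalgebra ℂ 𝒜) : Submodule ℂ 𝒜 :=
  Subalgebra.toSubmodule B ⊓ LinearMap.ker φ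

lemma mem_centeredPart {φ : 𝒜 →ₗ[ℂ] ℂ} {B : Subalgebra ℂ 𝒜} {a : 𝒜} :
    a ∈ centeredPart φ B ↔ a ∈ B ∧ φ a = 0 := by
  simp [centeredPart]

lemma SecondOrderNCPS.exists_eq_add (S : SecondOrderNCPS 𝒜) {B : Subalgebra ℂ 𝒜} {a : 𝒜}
    (ha : a ∈ B) : ∃ a' ∈ centeredPart S.φ B, a = a' + S.φ a • (1 : 𝒜) :=
  ⟨a - S.φ a • (1 : 𝒜), mem_centeredPart.2 ⟨B.sub_mem ha (B.smul_mem B.one_mem _), by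
    simp [S.φ_one]⟩, by simp⟩

/-- Products `a₀ p₁ a₁ ⋯ pₙ aₙ` of centered elements, alternatingly from `B` and `C`. -/
def alternatingProducts (φ : 𝒜 →ₗ[ℂ] ℂ) (C B : Subalgebra ℂ 𝒜) (n : ℕ) : Submodule ℂ 𝒜 :=
  (centeredPart φ B * centeredPart φ C) ^ n * centeredPart φ B

/-- The elements `u` with `φ(w u) = 0` for all `w` in `C`. -/
def orthogonalPart (φ : 𝒜 →ₗ[ℂ] ℂ) (C : Subalgebra ℂ 𝒜) : Submodule ℂ 𝒜 where
  carrier := {u | ∀ w ∈ C, φ (w * u) = 0}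
  add_mem' ha hb w hw := by rw [mul_add, map_add, ha w hw, hb w hw, add_zero]
  zero_mem' w _ := by simp
  smul_mem' c a ha w hw := by rw [mul_smul_comm, map_smul, ha w hw, smul_zero]

section Words
variable {ι : Type*} (x : ι → 𝒜)

lemma list_map_prod_mem_adjoin (L : List ι) :
    (L.map x).prod ∈ Algebra.adjoin ℂ (Set.range x) := by
  refine Subalgebra.list_prod_mem _ fun y hy => ?_
  obtain ⟨i, -, rfl⟩ := List.mem_map.1 hy
  exact Algebra.subset_adjoin ⟨i, rfl⟩

lemma adjoin_range_le_span : Subalgebra.toSubmodule (Algebra.adjoin ℂ (Set.range x)) ≤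
    Submodule.span ℂ (Set.range fun L : List ι => (L.map x).prod) := by
  rw [Algebra.adjoin_eq_span]
  refine Submodule.span_mono fun y hy => ?_
  obtain ⟨l, hl, rfl⟩ := Submonoid.exists_list_of_mem_closure hy
  clear hy
  induction l with
  | nil => exact ⟨[], rfl⟩
  | cons a l ih =>
    obtain ⟨L, hL⟩ := ih fun z hz => hl z (List.mem_cons_of_mem _ hz)
    obtain ⟨i, rfl⟩ := hl a List.mem_cons_self
    exact ⟨i :: L, by simp [← hL]⟩

/-- Induction on elements of the algebra generated by the `x i`, through words in the `x i`. -/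
lemma adjoin_range_induction {p : 𝒜 → Prop} (hword : ∀ L : List ι, p (L.map x).prod)
    (hadd : ∀ a b, p a → p b → p (a + b)) (hsmul : ∀ (c : ℂ) a, p a → p (c • a)) {a : 𝒜}
    (ha : a ∈ Algebra.adjoin ℂ (Set.range x)) : p a := by
  have h0 : p 0 := by simpa using hsmul 0 _ (hword [])
  have ha' := adjoin_range_le_span x ha
  clear ha
  induction ha' using Submodule.span_induction with
  | mem y hy =>
    obtain ⟨L, rfl⟩ := hy
    exact hword L
  | zero => exact h0
  | add a b _ _ ha hb => exact hadd a b ha hb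
  | smul c a _ ha => exact hsmul c a ha

variable {x} {D : 𝒜 →ₗ[ℂ] 𝒜 ⊗[ℂ] 𝒜}
  (hD : ∀ a b, D (a * b) = D a * (1 ⊗ₜ b) + (a ⊗ₜ 1) * D b)
include hD

lemma differenceQuotient_map_one : D 1 = 0 := by
  have := hD 1 1
  rw [← Algebra.TensorProduct.one_def, mul_one, mul_one, one_mul] at this
  simpa using this

/-- The value of a difference quotient on a word. -/
lemma differenceQuotient_word {c : ι → ℂ} (hx : ∀ i, D (x i) = c i • (1 ⊗ₜ 1)) (L : List ι) :
    D (L.map x).prod = ((wordSplits L).map fun q =>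
      c q.1 • ((q.2.1.map x).prod ⊗ₜ[ℂ] (q.2.2.map x).prod)).sum := by
  induction L with
  | nil => simp [wordSplits, differenceQuotient_map_one hD]
  | cons a L ih =>
    rw [List.map_cons, List.prod_cons, hD, hx, ih, wordSplits, List.map_cons, List.sum_cons]
    congr 1
    · simp
    · rw [← List.sum_map_mul_left, List.map_map]
      congr 1
      refine List.map_congr_left fun q _ => ?_
      simp

end Words

lemma tensorFunctional_left_mul (α β : 𝒜 →ₗ[ℂ] ℂ) (w : 𝒜) (t : 𝒜 ⊗[ℂ] 𝒜) :
    tensorFunctional α β ((w ⊗ₜ 1) * t) =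
      tensorFunctional (α ∘ₗ LinearMap.mulLeft ℂ w) β t := by
  induction t with
  | zero => simp
  | tmul a b => simp
  | add s t hs ht => rw [mul_add, map_add, map_add, hs, ht]

lemma tensorFunctional_right_mul (α β : 𝒜 →ₗ[ℂ] ℂ) (w : 𝒜) (t : 𝒜 ⊗[ℂ] 𝒜) :
    tensorFunctional α β (t * (1 ⊗ₜ w)) =
      tensorFunctional α (β ∘ₗ LinearMap.mulRight ℂ w) t := by
  induction t with
  | zero => simp
  | tmul a b => simp
  | add s t hs ht => rw [add_mul, map_add, map_add, hs, ht]

section AlternatingProducts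
variable {φ : 𝒜 →ₗ[ℂ] ℂ} {C B : Subalgebra ℂ 𝒜}

lemma alternatingProducts_zero : alternatingProducts φ C B 0 = centeredPart φ B := by
  simp [alternatingProducts]

lemma alternatingProducts_mul_mul (r t : ℕ) : alternatingProducts φ C B r *
    (centeredPart φ C * alternatingProducts φ C B t) = alternatingProducts φ C B (r + t + 1) := by
  rw [alternatingProducts, alternatingProducts, alternatingProducts, add_right_comm, pow_add,
    pow_succ]
  simp only [mul_assoc]

lemma alternatingProducts_succ (n : ℕ) : alternatingProducts φ C B (n + 1) =
    alternatingProducts φ C B n * (centeredPart φ C * centeredPart φ B) := by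
  rw [← alternatingProducts_mul_mul n 0, alternatingProducts_zero]

lemma alternatingProducts_succ' (n : ℕ) : alternatingProducts φ C B (n + 1) =
    centeredPart φ B * (centeredPart φ C * alternatingProducts φ C B n) := by
  rw [← zero_add n, ← alternatingProducts_mul_mul 0 n, alternatingProducts_zero, zero_add]

end AlternatingProducts

/-- A list of letters `(i, a)` that is alternating in `i` and centered. -/
def IsAlternatingList (φ : 𝒜 →ₗ[ℂ] ℂ) {κ : Type*} (A : κ → Subalgebra ℂ 𝒜)
    (l : List (κ × 𝒜)) : Prop :=
  l.IsChain (fun p q => p.1 ≠ q.1) ∧ ∀ p ∈ l, p.2 ∈ centeredPart φ (A p.1)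

namespace LoopCalculus

variable {S : SecondOrderNCPS 𝒜} {ι : Type*} {x : ι → 𝒜} {B : Subalgebra ℂ 𝒜}
  (T : LoopCalculus S x B)

local notation "C" => Algebra.adjoin ℂ (Set.range x)
local notation "W" => alternatingProducts S.φ (Algebra.adjoin ℂ (Set.range x)) B
local notation "K" => orthogonalPart S.φ (Algebra.adjoin ℂ (Set.range x))

lemma D_one (T : LoopCalculus S x B) (f : ι) : T.D f 1 = 0 :=
  differenceQuotient_map_one (T.D_mul f)

lemma D_word (T : LoopCalculus S x B) (f : ι) (L : List ι) : T.D f (L.map x).prod =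
    ((wordSplits L).map fun q => T.c f q.1 • ((q.2.1.map x).prod ⊗ₜ[ℂ] (q.2.2.map x).prod)).sum :=
  differenceQuotient_word (T.D_mul f) (T.D_gen f) L

/-- On the algebra generated by the `x f`, difference quotients are sums of tensors of elements of
that algebra. -/
lemma D_induction (T : LoopCalculus S x B) (f : ι) {P : 𝒜 ⊗[ℂ] 𝒜 → Prop}
    (htmul : ∀ U ∈ C, ∀ V ∈ C, P (U ⊗ₜ V)) (h0 : P 0) (hadd : ∀ s t, P s → P t → P (s + t)) {p : 𝒜}
    (hp : p ∈ C) : P (T.D f p) := by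
  have key : T.D f p ∈ AddSubmonoid.closure {t | ∃ U ∈ C, ∃ V ∈ C, t = U ⊗ₜ[ℂ] V} := by
    have hsmul : ∀ (c : ℂ) (t : 𝒜 ⊗[ℂ] 𝒜),
        t ∈ AddSubmonoid.closure {t | ∃ U ∈ C, ∃ V ∈ C, t = U ⊗ₜ[ℂ] V} →
        c • t ∈ AddSubmonoid.closure {t | ∃ U ∈ C, ∃ V ∈ C, t = U ⊗ₜ[ℂ] V} := fun c t ht => by
      induction ht using AddSubmonoid.closure_induction with
      | mem t ht =>
        obtain ⟨U, hU, V, hV, rfl⟩ := ht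
        exact AddSubmonoid.subset_closure ⟨c • U, Subalgebra.smul_mem _ hU c, V, hV,
          TensorProduct.smul_tmul' _ _ _⟩
      | zero => simp
      | add s t _ _ hs ht => rw [smul_add]; exact add_mem hs ht
    refine adjoin_range_induction x (p := fun p => T.D f p ∈ _) (fun L => ?_)
      (fun a b ha hb => by rw [map_add]; exact add_mem ha hb)
      (fun c a ha => by rw [map_smul]; exact hsmul c _ ha) hp
    rw [T.D_word]
    refine list_sum_mem fun y hy => ?_
    obtain ⟨q, -, rfl⟩ := List.mem_map.1 hy
    exact hsmul _ _ (AddSubmonoid.subset_closure ⟨_, list_map_prod_mem_adjoin x _, _,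
      list_map_prod_mem_adjoin x _, rfl⟩)
  generalize T.D f p = t at key
  induction key using AddSubmonoid.closure_induction with
  | mem t ht =>
    obtain ⟨U, hU, V, hV, rfl⟩ := ht
    exact htmul U hU V hV
  | zero => exact h0
  | add s t _ _ hs ht => exact hadd s t hs ht

lemma φ_eq_zero_of_mem {u : 𝒜} (hu : u ∈ K) : S.φ u = 0 := by
  simpa using hu 1 (Subalgebra.one_mem _)

/-- Traciality moves `p` to the front, where it is absorbed by the test element of `C`. -/
lemma mul_mem_right {u p : 𝒜} (hu : u ∈ K) (hp : p ∈ C) : u * p ∈ K := fun w hw => by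
  rw [← mul_assoc, S.φ_tracial, ← mul_assoc]
  exact hu _ (Subalgebra.mul_mem _ hp hw)

lemma mul_mem_left {u p : 𝒜} (hu : u ∈ K) (hp : p ∈ C) : p * u ∈ K := fun w hw => by
  rw [← mul_assoc]
  exact hu _ (Subalgebra.mul_mem _ hw hp)

lemma tensorFunctional_D_word_mul (f : ι) (L : List ι) (α β : 𝒜 →ₗ[ℂ] ℂ) (z : 𝒜) :
    tensorFunctional α β (T.D f (L.map x).prod * (1 ⊗ₜ z)) = ((wordSplits L).map fun q =>
      T.c f q.1 * (α (q.2.1.map x).prod * β ((q.2.2.map x).prod * z))).sum := by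
  rw [T.D_word, ← List.sum_map_mul_right, map_list_sum, List.map_map]
  congr 1
  refine List.map_congr_left fun q _ => ?_
  simp

/-- `D f` can cut `z` only inside a factor from `C`. The left leg is then `w y U` with `y` a shorter
alternating product and `U ∈ C`, and `φ` kills it whatever functional acts on the right leg. -/
lemma tensorFunctional_D_left {n : ℕ} (h : ∀ i < n, W i ≤ K) (f : ι) {z : 𝒜} (hz : z ∈ W n)
    {w : 𝒜} (hw : w ∈ C) (β : 𝒜 →ₗ[ℂ] ℂ) :
    tensorFunctional S.φ β ((w ⊗ₜ 1) * T.D f z) = 0 := by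
  induction n generalizing z β with
  | zero =>
    rw [alternatingProducts_zero, mem_centeredPart] at hz
    rw [T.D_eq_zero f z hz.1, mul_zero, map_zero]
  | succ n ih =>
    have hn : W n ≤ K := h n (Nat.lt_succ_self n)
    rw [alternatingProducts_succ] at hz
    induction hz using Submodule.mul_induction_on' with
    | mem_mul_mem y hy pa hpa =>
      induction hpa using Submodule.mul_induction_on' with
      | mem_mul_mem p hp a ha =>
        rw [mem_centeredPart] at hp ha
        rw [T.D_mul, T.D_mul, T.D_eq_zero f a ha.1, mul_zero, add_zero, mul_add, map_add,
          ← mul_assoc, tensorFunctional_right_mul, ih (fun i hi => h i (by omega)) hy, zero_add]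
        refine T.D_induction f (P := fun t =>
          tensorFunctional S.φ β ((w ⊗ₜ 1) * ((y ⊗ₜ 1) * (t * (1 ⊗ₜ a)))) = 0)
          (fun U hU V _ => ?_) (by simp) (fun s t hs ht => by
            rw [add_mul, mul_add, mul_add, map_add, hs, ht, add_zero]) hp.1
        have : S.φ (w * (y * U)) = 0 := mul_mem_right (hn hy) hU w hw
        simp [this]
      | add a _ b _ ha hb => rw [mul_add, map_add, mul_add, map_add, ha, hb, add_zero]
    | add a _ b _ ha hb => rw [map_add, mul_add, map_add, ha, hb, add_zero]

/-- The mirror image: after a cut, the right leg is an element of `C` followed by a shorter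
alternating product. -/
lemma tensorFunctional_D_right {n : ℕ} (h : ∀ i < n, W i ≤ K) (f : ι) {z : 𝒜} (hz : z ∈ W n)
    (α : 𝒜 →ₗ[ℂ] ℂ) : tensorFunctional α S.φ (T.D f z) = 0 := by
  induction n generalizing z α with
  | zero =>
    rw [alternatingProducts_zero, mem_centeredPart] at hz
    rw [T.D_eq_zero f z hz.1, map_zero]
  | succ n ih =>
    have hn : W n ≤ K := h n (Nat.lt_succ_self n)
    rw [alternatingProducts_succ'] at hz
    induction hz using Submodule.mul_induction_on' with
    | mem_mul_mem a ha py hpy =>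
      induction hpy using Submodule.mul_induction_on' with
      | mem_mul_mem p hp y hy =>
        rw [mem_centeredPart] at hp ha
        rw [T.D_mul, T.D_mul, T.D_eq_zero f a ha.1, zero_mul, zero_add, mul_add, map_add,
          tensorFunctional_left_mul, tensorFunctional_left_mul, tensorFunctional_left_mul,
          ih (fun i hi => h i (by omega)) hy, add_zero]
        refine T.D_induction f (P := fun t => tensorFunctional (α ∘ₗ LinearMap.mulLeft ℂ a) S.φ
          (t * (1 ⊗ₜ y)) = 0) (fun U _ V hV => ?_) (by simp) (fun s t hs ht => by
            rw [add_mul, map_add, hs, ht, add_zero]) hp.1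
        have : S.φ (V * y) = 0 := hn hy V hV
        simp [this]
      | add a _ b _ ha hb => rw [mul_add, map_add, map_add, ha, hb, add_zero]
    | add a _ b _ ha hb => rw [map_add, map_add, ha, hb, add_zero]

/-- The case `w = 1` of the vanishing statement. Traciality carries the first factor of `B` to the
end, where it merges with the last one; splitting that product into centered part and scalar leaves
expressions with fewer factors from `C` in the `W` part, covered by `h`. -/
lemma φ_eq_zero_of_mem_alternatingProducts_aux {n : ℕ} (h : ∀ i < n, W i ≤ K) {z : 𝒜}
    (hz : z ∈ W n) : S.φ z = 0 := by
  rcases n with _ | n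
  · rw [alternatingProducts_zero, mem_centeredPart] at hz
    exact hz.2
  have h0 : centeredPart S.φ B ≤ K := by
    have := h 0 (by omega)
    rwa [alternatingProducts_zero] at this
  rw [alternatingProducts_succ'] at hz
  induction hz using Submodule.mul_induction_on' with
  | mem_mul_mem a ha py hpy =>
    induction hpy using Submodule.mul_induction_on' with
    | mem_mul_mem p hp y hy =>
      rw [mem_centeredPart] at hp
      have ha' := (mem_centeredPart.1 ha).1
      rw [S.φ_tracial, mul_assoc]
      rcases n with _ | k
      · rw [alternatingProducts_zero] at hy
        obtain ⟨b, hb, hyab⟩ := S.exists_eq_add (B.mul_mem (mem_centeredPart.1 hy).1 ha')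
        rw [hyab, mul_add, map_add, mul_smul_comm, map_smul, mul_one, hp.2, smul_zero, add_zero]
        exact h0 hb p hp.1
      · have hk : W k ≤ K := h k (by omega)
        have hk1 : W (k + 1) ≤ K := h (k + 1) (by omega)
        rw [alternatingProducts_succ] at hy
        induction hy using Submodule.mul_induction_on' with
        | mem_mul_mem y hy pb hpb =>
          induction hpb using Submodule.mul_induction_on' with
          | mem_mul_mem q hq b hb =>
            obtain ⟨b', hb', hba⟩ := S.exists_eq_add (B.mul_mem (mem_centeredPart.1 hb).1 ha')
            rw [mul_assoc, mul_assoc, hba, mul_add, mul_add, mul_add, map_add]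
            have e1 : S.φ (p * (y * (q * b'))) = 0 := hk1 (by
              rw [alternatingProducts_succ]
              exact Submodule.mul_mem_mul hy (Submodule.mul_mem_mul hq hb')) p hp.1
            have e2 : S.φ (p * (y * q)) = 0 := mul_mem_right (hk hy) (mem_centeredPart.1 hq).1 p hp.1
            rw [e1, mul_smul_comm, mul_smul_comm, mul_smul_comm, mul_one, map_smul, e2, smul_zero,
              add_zero]
          | add a _ b _ ha hb => rw [mul_add, add_mul, mul_add, map_add, ha, hb, add_zero]
        | add a _ b _ ha hb => rw [add_mul, mul_add, map_add, ha, hb, add_zero]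
    | add a _ b _ ha hb => rw [mul_add, map_add, ha, hb, add_zero]
  | add a _ b _ ha hb => rw [map_add, ha, hb, add_zero]

include T in
/-- The vanishing statement behind freeness. -/
theorem alternatingProducts_le (n : ℕ) : W n ≤ K := by
  induction n using Nat.strong_induction_on with
  | _ n ih =>
    intro z hz w hw
    refine adjoin_range_induction x (p := fun w => S.φ (w * z) = 0) (fun L => ?_)
      (fun a b ha hb => by rw [add_mul, map_add, ha, hb, add_zero])
      (fun c a ha => by rw [smul_mul_assoc, map_smul, ha, smul_zero]) hw
    -- Inner induction on the word in `C`: a cut inside the word leaves a shorter suffix in front of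
    -- `z`, and a cut inside `z` contributes zero by `tensorFunctional_D_left`.
    induction hL : L.length using Nat.strong_induction_on generalizing L with
    | _ l ihl =>
      rcases L with _ | ⟨f, L⟩
      · simpa using φ_eq_zero_of_mem_alternatingProducts_aux ih hz
      · rw [List.map_cons, List.prod_cons, mul_assoc, T.φ_loop, T.D_mul, map_add,
          T.tensorFunctional_D_left ih f hz (list_map_prod_mem_adjoin x L), add_zero,
          tensorFunctional_D_word_mul]
        refine List.sum_eq_zero fun y hy => ?_
        obtain ⟨q, hq, rfl⟩ := List.mem_map.1 hy
        rw [ihl q.2.2.length ?_ q.2.2 rfl]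
        · simp
        · rw [← hL, eq_of_mem_wordSplits hq]
          simp
          omega

include T in
lemma φ_mul_of_mem {z w : 𝒜} {n : ℕ} (hz : z ∈ W n) (hw : w ∈ C) : S.φ (w * z) = 0 :=
  T.alternatingProducts_le n hz w hw

/-- The elements `u` with `φ(w u) = φ(w) φ(u)` for `w` in the algebra generated by the `x f`. -/
lemma φ_mul_of_mem_sup {u w : 𝒜} (hu : u ∈ K ⊔ Submodule.span ℂ {1}) (hw : w ∈ C) :
    S.φ (w * u) = S.φ w * S.φ u := by
  obtain ⟨k, hk, y, hy, rfl⟩ := Submodule.mem_sup.1 hu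
  obtain ⟨c, rfl⟩ := Submodule.mem_span_singleton.1 hy
  rw [mul_add, map_add, map_add, hk w hw, φ_eq_zero_of_mem hk, mul_smul_comm, mul_one, map_smul,
    map_smul, S.φ_one]
  simp [mul_comm]

include T in
-- Fold at the junction: `a a'` is a centered element plus a scalar, and for the scalar the
-- neighbours `p q` meet and are split likewise. A multiple of `1` can appear only if both products
-- are used up simultaneously, that is for `r = t`.
lemma mul_mem_of_mem_alternatingProducts {r t : ℕ} {z z' : 𝒜} (hz : z ∈ W r) (hz' : z' ∈ W t) :
    z * z' ∈ K ⊔ Submodule.span ℂ {1} ∧ (r ≠ t → z * z' ∈ K) := by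
  have hW := T.alternatingProducts_le
  have h0 : centeredPart S.φ B ≤ K := by
    have := hW 0
    rwa [alternatingProducts_zero] at this
  have hK : ∀ u ∈ K, u ∈ K ⊔ Submodule.span ℂ {1} := fun u hu => Submodule.mem_sup_left hu
  have h1 : ∀ c : ℂ, c • (1 : 𝒜) ∈ (K ⊔ Submodule.span ℂ {1} : Submodule ℂ 𝒜) := fun c =>
    Submodule.mem_sup_right (Submodule.mem_span_singleton.2 ⟨c, rfl⟩)
  have hadd : ∀ a b : 𝒜, (a ∈ K ⊔ Submodule.span ℂ {1} ∧ (r ≠ t → a ∈ K)) →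
      (b ∈ K ⊔ Submodule.span ℂ {1} ∧ (r ≠ t → b ∈ K)) →
      (a + b ∈ K ⊔ Submodule.span ℂ {1} ∧ (r ≠ t → a + b ∈ K)) := fun a b ha hb =>
    ⟨add_mem ha.1 hb.1, fun h => add_mem (ha.2 h) (hb.2 h)⟩
  induction r generalizing t z z' with
  | zero =>
    rw [alternatingProducts_zero] at hz
    have hzB := (mem_centeredPart.1 hz).1
    rcases t with _ | t
    · rw [alternatingProducts_zero] at hz'
      obtain ⟨b, hb, hab⟩ := S.exists_eq_add (B.mul_mem hzB (mem_centeredPart.1 hz').1)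
      rw [hab]
      exact ⟨add_mem (hK _ (h0 hb)) (h1 _), fun h => absurd rfl h⟩
    · suffices h : z * z' ∈ K from ⟨hK _ h, fun _ => h⟩
      clear hadd
      rw [alternatingProducts_succ'] at hz'
      induction hz' using Submodule.mul_induction_on' with
      | mem_mul_mem a ha py hpy =>
        obtain ⟨b, hb, hab⟩ := S.exists_eq_add (B.mul_mem hzB (mem_centeredPart.1 ha).1)
        rw [← mul_assoc, hab, add_mul, smul_mul_assoc, one_mul]
        refine add_mem (hW (t + 1) ?_) (Submodule.smul_mem _ _ ?_)
        · rw [alternatingProducts_succ']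
          exact Submodule.mul_mem_mul hb hpy
        · induction hpy using Submodule.mul_induction_on' with
          | mem_mul_mem p hp y hy => exact mul_mem_left (hW t hy) (mem_centeredPart.1 hp).1
          | add a _ b _ ha hb => exact add_mem ha hb
      | add a _ b _ ha hb => rw [mul_add]; exact add_mem ha hb
  | succ r ih =>
    rw [alternatingProducts_succ] at hz
    induction hz using Submodule.mul_induction_on' with
    | mem_mul_mem y hy pa hpa =>
      induction hpa using Submodule.mul_induction_on' with
      | mem_mul_mem p hp a ha =>
        have haB := (mem_centeredPart.1 ha).1
        have hpC := (mem_centeredPart.1 hp).1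
        rcases t with _ | t
        · rw [alternatingProducts_zero] at hz'
          suffices h : y * (p * a) * z' ∈ K from ⟨hK _ h, fun _ => h⟩
          obtain ⟨b, hb, hab⟩ := S.exists_eq_add (B.mul_mem haB (mem_centeredPart.1 hz').1)
          rw [mul_assoc, mul_assoc, hab, mul_add, mul_add]
          refine add_mem (hW (r + 1) ?_) ?_
          · rw [alternatingProducts_succ]
            exact Submodule.mul_mem_mul hy (Submodule.mul_mem_mul hp hb)
          · rw [mul_smul_comm, mul_smul_comm, mul_one]
            exact Submodule.smul_mem _ _ (mul_mem_right (hW r hy) hpC)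
        · rw [alternatingProducts_succ'] at hz'
          induction hz' using Submodule.mul_induction_on' with
          | mem_mul_mem a' ha' qy hqy =>
            induction hqy using Submodule.mul_induction_on' with
            | mem_mul_mem q hq y' hy' =>
              obtain ⟨b, hb, hab⟩ := S.exists_eq_add (B.mul_mem haB (mem_centeredPart.1 ha').1)
              obtain ⟨d, hd, hpq⟩ := S.exists_eq_add
                (Subalgebra.mul_mem _ hpC (mem_centeredPart.1 hq).1)
              generalize S.φ (a * a') = c₁ at hab
              generalize S.φ (p * q) = c₂ at hpq
              -- The first two summands are elements of `K`, being or reducing to alternating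
              -- products; the last is the same problem with both products shortened, and keeps `r ≠
              -- t`.
              have e : y * (p * a) * (a' * (q * y')) = y * (p * (b * (q * y'))) +
                  (c₁ • (y * (d * y')) + (c₁ * c₂) • (y * y')) := by
                have e1 : y * (p * a) * (a' * (q * y')) = y * (p * ((a * a') * (q * y'))) := by
                  simp only [mul_assoc]
                have e2 : y * (p * (q * y')) = y * ((p * q) * y') := by simp only [mul_assoc]
                rw [e1, hab]
                simp only [add_mul, mul_add, smul_mul_assoc, one_mul, mul_smul_comm, e2, hpq,
                  smul_add, smul_smul]
              have m1 : y * (p * (b * (q * y'))) ∈ K := hW (r + (t + 1) + 1) (by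
                rw [← alternatingProducts_mul_mul, alternatingProducts_succ']
                exact Submodule.mul_mem_mul hy (Submodule.mul_mem_mul hp (Submodule.mul_mem_mul hb
                  (Submodule.mul_mem_mul hq hy'))))
              have m2 : y * (d * y') ∈ K := hW (r + t + 1) (by
                rw [← alternatingProducts_mul_mul]
                exact Submodule.mul_mem_mul hy (Submodule.mul_mem_mul hd hy'))
              have m3 := ih hy hy' fun a b ha hb =>
                ⟨add_mem ha.1 hb.1, fun h => add_mem (ha.2 h) (hb.2 h)⟩
              rw [e]
              exact ⟨add_mem (hK _ m1) (add_mem (Submodule.smul_mem _ _ (hK _ m2))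
                (Submodule.smul_mem _ _ m3.1)), fun h => add_mem m1 (add_mem
                (Submodule.smul_mem _ _ m2) (Submodule.smul_mem _ _ (m3.2 (by omega))))⟩
            | add a _ b _ ha hb => rw [mul_add, mul_add]; exact hadd _ _ ha hb
          | add a _ b _ ha hb => rw [mul_add]; exact hadd _ _ ha hb
      | add a _ b _ ha hb => rw [mul_add, add_mul]; exact hadd _ _ ha hb
    | add a _ b _ ha hb => rw [add_mul]; exact hadd _ _ ha hb

include T

/-- The centered part of `p` joins `z` and `z'` to one alternating product, which `φ` kills after
`w`. Only the scalar part remains, and then `z z'` factors off from `w`. -/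
lemma φ_mul_four {r t : ℕ} {z z' w p : 𝒜} (hz : z ∈ W r) (hz' : z' ∈ W t) (hw : w ∈ C)
    (hp : p ∈ C) : S.φ (w * (z * (p * z'))) = S.φ w * S.φ p * S.φ (z * z') := by
  obtain ⟨d, hd, hpd⟩ := S.exists_eq_add hp
  have h1 : S.φ (w * (z * (d * z'))) = 0 := T.φ_mul_of_mem (n := r + t + 1) (by
    rw [← alternatingProducts_mul_mul]
    exact Submodule.mul_mem_mul hz (Submodule.mul_mem_mul hd hz')) hw
  conv_lhs => rw [hpd]
  rw [add_mul, mul_add, mul_add, map_add, h1, smul_mul_assoc, one_mul, mul_smul_comm,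
    mul_smul_comm, map_smul, φ_mul_of_mem_sup (T.mul_mem_of_mem_alternatingProducts hz hz').1 hw,
    smul_eq_mul]
  ring

/-- For a term `U ⊗ V` of `D f q` the argument is, up to cyclic rotation, `(U w) z V (Q P)`, to
which `φ_mul_four` applies. This says that the merging term behaves as if `D f` acted on the element
`φ(z Q P) q` of `C`. -/
lemma φ_mul_flipMul {r t : ℕ} {z w q P Q : 𝒜} (hz : z ∈ W r) (hQP : Q * P ∈ W t) (hw : w ∈ C)
    (hq : q ∈ C) (f : ι) :
    S.φ (w * (z * flipMul ((P ⊗ₜ 1) * T.D f q * (1 ⊗ₜ Q)))) =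
      S.φ (z * (Q * P)) * tensorFunctional S.φ S.φ ((w ⊗ₜ 1) * T.D f q) := by
  refine T.D_induction f (P := fun t => S.φ (w * (z * flipMul ((P ⊗ₜ 1) * t * (1 ⊗ₜ Q)))) =
      S.φ (z * (Q * P)) * tensorFunctional S.φ S.φ ((w ⊗ₜ 1) * t)) (fun U hU V hV => ?_)
    (by simp) (fun s t hs ht => ?_) hq
  · have e : w * (z * (V * Q * (P * U))) = (w * (z * (V * (Q * P)))) * U := by
      simp only [mul_assoc]
    have e2 : S.φ (U * w) = S.φ (w * U) := S.φ_tracial _ _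
    simp only [Algebra.TensorProduct.tmul_mul_tmul, one_mul, mul_one, flipMul_tmul,
      tensorFunctional_tmul, e]
    rw [S.φ_tracial, ← mul_assoc, T.φ_mul_four hz hQP (Subalgebra.mul_mem _ hU hw) hV, e2]
    ring
  · simp only [mul_add, add_mul, map_add, hs, ht]

/-- Reduction of `ρ(p z, v)` for `p` in the algebra generated by the `x f`. -/
lemma ρ_mul_eq {n : ℕ} {z v q : 𝒜} (hz : z ∈ W n) (hq0 : S.φ q = 0)
    (h : ∀ w ∈ C, ∀ f, S.φ (w * (z * flipMul (T.D f v))) =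
      tensorFunctional S.φ S.φ ((w ⊗ₜ 1) * T.D f q)) {p : 𝒜} (hp : p ∈ C) :
    S.ρ (p * z) v = S.φ p * S.ρ z v + S.φ (p * q) := by
  -- By assumption `h`, the merging term equals the part of the loop equation for `φ(p q)` in which
  -- `q` is cut. The remaining cuts are inside `p`, so `φ(p q)` and `ρ(p z, v) - φ(p) ρ(z, v)` obey
  -- the same recursion in the word `p`; at `p = 1` they agree because `φ(q) = 0`.
  refine adjoin_range_induction x
    (p := fun p => S.ρ (p * z) v = S.φ p * S.ρ z v + S.φ (p * q)) (fun L => ?_)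
    (fun a b ha hb => by
      simp only [add_mul, map_add, LinearMap.add_apply, ha, hb]
      ring)
    (fun c a ha => by
      simp only [smul_mul_assoc, map_smul, LinearMap.smul_apply, ha, smul_eq_mul]
      ring) hp
  induction hL : L.length using Nat.strong_induction_on generalizing L with
  | _ l ih =>
    rcases L with _ | ⟨f, L⟩
    · simp [S.φ_one, hq0]
    · have hLC := list_map_prod_mem_adjoin x L
      have hW := fun i (_ : i < n) => T.alternatingProducts_le i
      have hz0 : ∀ q' : ι × List ι × List ι, S.φ ((q'.2.2.map x).prod * z) = 0 := fun q' =>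
        T.φ_mul_of_mem hz (list_map_prod_mem_adjoin x _)
      rw [List.map_cons, List.prod_cons, mul_assoc, mul_assoc, T.ρ_loop, T.φ_loop, T.φ_loop,
        mul_assoc, h _ hLC, T.D_mul, T.D_mul, map_add, map_add, map_add,
        T.tensorFunctional_D_left hW f hz hLC, tensorFunctional_left_mul (S.ρ.flip v),
        T.tensorFunctional_D_right hW f hz, T.tensorFunctional_D_word_mul,
        T.tensorFunctional_D_word_mul, T.tensorFunctional_D_word_mul]
      simp only [hz0, mul_zero, List.map_const', List.sum_replicate, smul_zero, add_zero]
      rw [← add_assoc]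
      congr 1
      rw [← mul_one (T.D f _), Algebra.TensorProduct.one_def, T.tensorFunctional_D_word_mul,
        ← List.sum_map_mul_right, ← List.sum_map_add]
      congr 1
      refine List.map_congr_left fun q' hq' => ?_
      have := ih q'.2.2.length (by
        rw [← hL, eq_of_mem_wordSplits hq']
        simp
        omega) q'.2.2 rfl
      rw [LinearMap.flip_apply, this, mul_one]
      ring

/-- Since `D f v = 0`, nothing merges, and the recursion reduces everything to `ρ(1, v) = 0`. -/
lemma ρ_eq_zero_of_mem_of_mem {p v : 𝒜} (hp : p ∈ C) (hv : v ∈ B) : S.ρ p v = 0 := by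
  refine adjoin_range_induction x (p := fun p => S.ρ p v = 0) (fun L => ?_)
    (fun a b ha hb => by rw [map_add, LinearMap.add_apply, ha, hb, add_zero])
    (fun c a ha => by rw [map_smul, LinearMap.smul_apply, ha, smul_zero]) hp
  induction hL : L.length using Nat.strong_induction_on generalizing L with
  | _ l ih =>
    rcases L with _ | ⟨f, L⟩
    · simp [S.ρ_one_left]
    · rw [List.map_cons, List.prod_cons, T.ρ_loop, T.D_eq_zero f v hv, map_zero, mul_zero, map_zero,
        add_zero, ← mul_one (T.D f _), Algebra.TensorProduct.one_def,
        T.tensorFunctional_D_word_mul, T.tensorFunctional_D_word_mul]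
      have h : ∀ q ∈ wordSplits L, S.ρ (q.2.1.map x).prod v = 0 ∧ S.ρ (q.2.2.map x).prod v = 0 :=
        fun q hq => by
        have e : (f :: L).length = q.2.1.length + q.2.2.length + 2 := by
          rw [List.length_cons, eq_of_mem_wordSplits hq]
          simp
          omega
        exact ⟨ih _ (by omega) _ rfl, ih _ (by omega) _ rfl⟩
      rw [List.sum_eq_zero, List.sum_eq_zero, add_zero]
      · intro y hy
        obtain ⟨q, hq, rfl⟩ := List.mem_map.1 hy
        simp [(h q hq).1]
      · intro y hy
        obtain ⟨q, hq, rfl⟩ := List.mem_map.1 hy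
        simp [(h q hq).2]

/-- The merging term vanishes, so `q = 0` is admissible in `ρ_mul_eq`: a cut of `v ∈ C` puts an
element of `C` next to `z`, which `φ` kills, and for `v ∈ B` there are no cuts. -/
lemma ρ_mul_eq_zero {n : ℕ} {z v p : 𝒜} (hz : z ∈ W n) (hv : v ∈ C ∨ v ∈ B)
    (hp : p ∈ centeredPart S.φ C) : S.ρ (p * z) v = 0 := by
  rw [mem_centeredPart] at hp
  rw [T.ρ_mul_eq (q := 0) hz (map_zero _) (fun w hw f => ?_) hp.1, hp.2]
  · simp
  rw [map_zero, mul_zero, map_zero]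
  rcases hv with hv | hv
  · refine T.D_induction f (P := fun t => S.φ (w * (z * flipMul t)) = 0) (fun U hU V hV => ?_)
      (by simp) (fun s t hs ht => by rw [map_add, mul_add, mul_add, map_add, hs, ht, add_zero]) hv
    rw [flipMul_tmul]
    exact mul_mem_right (T.alternatingProducts_le n hz) (Subalgebra.mul_mem _ hV hU) w hw
  · rw [T.D_eq_zero f v hv, map_zero, mul_zero, mul_zero, map_zero]

/-! ### Alternating lists -/

omit T in
-- Colour `0` is the Gaussian algebra and colour `1` is `B`. A list starting in `B` ends in `B` for
-- odd length and in the Gaussian algebra for even length.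
lemma prod_mem_alternatingProducts {l : List (Fin 2 × 𝒜)} (hl : IsAlternatingList S.φ ![C, B] l)
    (h1 : ∀ p ∈ l.head?, p.1 = 1) :
    (∀ r, l.length = 2 * r + 1 → (l.map Prod.snd).prod ∈ W r) ∧
      ∀ r, l.length = 2 * r + 2 → (l.map Prod.snd).prod ∈ W r * centeredPart S.φ C := by
  induction hn : l.length using Nat.strong_induction_on generalizing l with
  | _ n ih =>
    rcases l with _ | ⟨a, _ | ⟨p, l⟩⟩
    · simp at hn
      subst hn
      exact ⟨fun r hr => by omega, fun r hr => by omega⟩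
    · have ha : a.2 ∈ centeredPart S.φ B := by
        have := hl.2 a (by simp)
        rwa [h1 a (by simp)] at this
      simp at hn
      subst hn
      refine ⟨fun r hr => ?_, fun r hr => by omega⟩
      obtain rfl : r = 0 := by omega
      simpa [alternatingProducts_zero] using ha
    · have ha1 : a.1 = 1 := h1 a (by simp)
      have ha : a.2 ∈ centeredPart S.φ B := by
        have := hl.2 a (by simp)
        rwa [ha1] at this
      have hap : a.1 ≠ p.1 := (List.isChain_cons_cons.1 hl.1).1
      have hp0 : p.1 = 0 := by
        rw [ha1] at hap
        omega
      have hp : p.2 ∈ centeredPart S.φ C := by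
        have := hl.2 p (by simp)
        rwa [hp0] at this
      have hl' : IsAlternatingList S.φ ![C, B] l :=
        ⟨(List.isChain_cons_cons.1 hl.1).2.tail, fun q hq => hl.2 q (by simp [hq])⟩
      have hl1 : ∀ q ∈ l.head?, q.1 = 1 := fun q hq => by
        have : p.1 ≠ q.1 := List.IsChain.rel_head? (List.isChain_cons_cons.1 hl.1).2 hq
        rw [hp0] at this
        omega
      obtain ⟨i1, i2⟩ := ih l.length (by simp at hn; omega) hl' hl1 rfl
      simp only [List.length_cons] at hn
      simp only [List.map_cons, List.prod_cons]
      refine ⟨fun r hr => ?_, fun r hr => ?_⟩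
      · obtain ⟨r, rfl⟩ : ∃ r', r = r' + 1 := ⟨r - 1, by omega⟩
        rw [alternatingProducts_succ']
        exact Submodule.mul_mem_mul ha (Submodule.mul_mem_mul hp (i1 r (by omega)))
      · rcases r with _ | r
        · obtain rfl : l = [] := List.eq_nil_of_length_eq_zero (by omega)
          rw [alternatingProducts_zero]
          simpa using Submodule.mul_mem_mul ha hp
        · rw [alternatingProducts_succ', mul_assoc, mul_assoc]
          exact Submodule.mul_mem_mul ha (Submodule.mul_mem_mul hp (i2 r (by omega)))

/-- Freeness, in terms of alternating lists. -/
theorem φ_alternatingList {l : List (Fin 2 × 𝒜)} (hl : IsAlternatingList S.φ ![C, B] l)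
    (h0 : l ≠ []) : S.φ (l.map Prod.snd).prod = 0 := by
  -- Lists starting in `B` are treated with a prefactor from the Gaussian algebra, so that an
  -- initial letter of the other colour can be absorbed in it.
  have key : ∀ l : List (Fin 2 × 𝒜), IsAlternatingList S.φ ![C, B] l →
      (∀ p ∈ l.head?, p.1 = 1) → l ≠ [] → ∀ p ∈ C, S.φ (p * (l.map Prod.snd).prod) = 0 := by
    intro l hl h1 h0 p hp
    obtain ⟨i1, i2⟩ := prod_mem_alternatingProducts hl h1
    have hpos := List.length_pos_of_ne_nil h0
    rcases Nat.even_or_odd' l.length with ⟨r, hr | hr⟩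
    · have hm := i2 (r - 1) (by omega)
      generalize (l.map Prod.snd).prod = u at hm ⊢
      induction hm using Submodule.mul_induction_on' with
      | mem_mul_mem z hz q hq =>
        exact mul_mem_right (T.alternatingProducts_le _ hz) (mem_centeredPart.1 hq).1 p hp
      | add a _ b _ ha hb => rw [mul_add, map_add, ha, hb, add_zero]
    · exact T.φ_mul_of_mem (i1 r hr) hp
  rcases l with _ | ⟨p, l⟩
  · exact absurd rfl h0
  by_cases hp1 : p.1 = 1
  · simpa using key (p :: l) hl (by simpa using hp1) h0 1 (Subalgebra.one_mem _)
  · have hp0 : p.1 = 0 := by omega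
    have hp : p.2 ∈ centeredPart S.φ C := by
      have := hl.2 p (by simp)
      rwa [hp0] at this
    rcases List.eq_nil_or_concat l with rfl | ⟨l', q, rfl⟩
    · simpa using (mem_centeredPart.1 hp).2
    · rw [List.map_cons, List.prod_cons]
      refine key _ ⟨hl.1.tail, fun q hq => hl.2 q (List.mem_cons_of_mem _ hq)⟩ (fun q hq => ?_)
        (by simp) _ (mem_centeredPart.1 hp).1
      have : p.1 ≠ q.1 := List.IsChain.rel_head? hl.1 hq
      rw [hp0] at this
      omega

omit T in
lemma isAlternatingList_ofFn {n : ℕ} {i : Fin n → Fin 2} {a : Fin n → 𝒜}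
    (h : ∀ k, a k ∈ ![C, B] (i k)) (h0 : ∀ k, S.φ (a k) = 0)
    (hi : ∀ (k : ℕ) (h : k + 1 < n), i ⟨k, Nat.lt_of_succ_lt h⟩ ≠ i ⟨k + 1, h⟩) :
    IsAlternatingList S.φ ![C, B] (List.ofFn fun k => (i k, a k)) := by
  refine ⟨List.isChain_iff_getElem.2 fun k hk => ?_, fun p hp => ?_⟩
  · simpa using hi k (by simpa using hk)
  · obtain ⟨k, rfl⟩ := List.mem_ofFn.1 hp
    exact mem_centeredPart.2 ⟨h k, h0 k⟩

theorem isFreeFamily : IsFreeFamily S.φ ![C, B] := fun n hn i a h hi h0 => by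
  have := T.φ_alternatingList (isAlternatingList_ofFn h h0 hi) (by simp; omega)
  rwa [List.map_ofFn] at this

lemma D_tupleProd (f : ι) {n : ℕ} (b : Fin n → 𝒜) : T.D f (tupleProd b) =
    ∑ l : Fin n, (((List.ofFn b).take l).prod ⊗ₜ 1) * T.D f (b l) *
      (1 ⊗ₜ ((List.ofFn b).drop (l + 1)).prod) := by
  induction n with
  | zero => simp [tupleProd, T.D_one]
  | succ n ih =>
    rw [tupleProd_succ, T.D_mul, ih, Fin.sum_univ_succ, Finset.mul_sum]
    congr 1
    · simp [tupleProd, List.ofFn_succ, ← Algebra.TensorProduct.one_def]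
    · refine Finset.sum_congr rfl fun l _ => ?_
      simp [List.ofFn_succ, ← mul_assoc]

/-- The value of `φ` on a product of two alternating products. -/
lemma φ_reverse_mul (L : List (Fin 2 × 𝒜 × 𝒜)) (hL : L.IsChain fun p q => p.1 ≠ q.1)
    (h : ∀ p ∈ L, p.2.1 ∈ centeredPart S.φ (![C, B] p.1) ∧
      p.2.2 ∈ centeredPart S.φ (![C, B] p.1)) :
    S.φ ((L.reverse.map fun p => p.2.1).prod * (L.map fun p => p.2.2).prod) =
      (L.map fun p => S.φ (p.2.1 * p.2.2)).prod := by
  induction L with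
  | nil => simp [S.φ_one]
  | cons p L ih =>
    have hp := h p List.mem_cons_self
    simp only [mem_centeredPart] at hp
    obtain ⟨d, hd, hpd⟩ := S.exists_eq_add (Subalgebra.mul_mem _ hp.1.1 hp.2.1)
    -- Replacing the middle product `p.2.1 * p.2.2` by its centered part `d` leaves a single
    -- alternating centered list, on which `φ` vanishes. Only the scalar part lets the collapse
    -- continue outwards.
    have h0 : S.φ ((L.reverse.map fun p => p.2.1).prod * (d * (L.map fun p => p.2.2).prod)) = 0 := by
      have := T.φ_alternatingList (l := (L.map fun p => (p.1, p.2.1)).reverse ++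
        (p.1, d) :: L.map fun p => (p.1, p.2.2)) ⟨?_, ?_⟩ (by simp)
      · simpa [List.map_reverse, Function.comp_def] using this
      · rw [List.isChain_append]
        refine ⟨?_, ?_, ?_⟩
        · rw [List.isChain_reverse, List.isChain_map]
          exact hL.tail.imp fun _ _ h => h.symm
        · have : ((p.1, d) :: L.map fun p => (p.1, p.2.2)).IsChain fun p q => p.1 ≠ q.1 := by
            rcases L with _ | ⟨q, L⟩
            · simp
            · rw [List.isChain_cons_cons] at hL
              rw [List.map_cons, List.isChain_cons_cons]
              refine ⟨hL.1, ?_⟩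
              have := hL.2
              rw [← List.map_cons (f := fun p : Fin 2 × 𝒜 × 𝒜 => (p.1, p.2.2)), List.isChain_map]
              exact this
          exact this
        · intro q hq r hr
          rcases L with _ | ⟨q', L⟩
          · simp at hq
          · simp only [List.map_cons, List.reverse_cons, List.getLast?_append, List.getLast?_singleton,
              Option.some_or, Option.mem_def, Option.some.injEq] at hq
            simp only [List.head?_cons, Option.mem_def, Option.some.injEq] at hr
            rw [← hq, ← hr]
            exact (List.isChain_cons_cons.1 hL).1.symm
      · intro q hq
        simp only [List.mem_append, List.mem_reverse, List.mem_map, List.mem_cons] at hq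
        rcases hq with ⟨r, hr, rfl⟩ | rfl | ⟨r, hr, rfl⟩
        · exact (h r (List.mem_cons_of_mem _ hr)).1
        · exact hd
        · exact (h r (List.mem_cons_of_mem _ hr)).2
    rw [List.reverse_cons, List.map_append, List.prod_append, List.map_cons, List.map_cons,
      List.map_nil, List.prod_singleton, List.prod_cons, List.map_cons, List.prod_cons, mul_assoc,
      ← mul_assoc p.2.1, hpd, add_mul, mul_add, map_add, h0, zero_add, smul_mul_assoc, one_mul,
      mul_smul_comm, map_smul, ih hL.tail fun q hq => h q (List.mem_cons_of_mem _ hq), ← hpd,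
      smul_eq_mul]

omit T in
-- Removing a letter of colour `0` from an alternating cycle of even length `n + 1` leaves an odd
-- word beginning and ending in `B`, with `(n - 1) / 2` letters of colour `0`.
lemma mem_alternatingProducts {n : ℕ} {a : Fin (n + 1) → 𝒜} {i : Fin (n + 1) → Fin 2} (hn : 1 ≤ n)
    (ha : ∀ k, a k ∈ ![C, B] (i k)) (hi : ∀ k, i k ≠ i (k + 1)) (ha0 : ∀ k, S.φ (a k) = 0)
    (l : Fin (n + 1)) (hl : i l = 0) :
    (tupleProd fun k : Fin n => a (l + k.succ)) ∈ W ((n - 1) / 2) := by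
  obtain ⟨e, he⟩ := alternating_even hi
  have hl1 : ∀ k : Fin n, i (l + k.succ) = Fin.ofNat 2 (k + 1) := fun k => by
    rw [alternating_add_succ hi, hl, zero_add]
  have := (prod_mem_alternatingProducts (S := S) (x := x) (B := B)
    (l := List.ofFn fun k : Fin n => (i (l + k.succ), a (l + k.succ)))
    (isAlternatingList_ofFn (fun k => ha _) (fun k => ha0 _) fun k hk => ?_) ?_).1
    ((n - 1) / 2) (by simp; omega)
  · rwa [List.map_ofFn] at this
  · rw [hl1, hl1]
    rw [Ne, Fin.ext_iff, Fin.val_ofNat, Fin.val_ofNat]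
    simp only
    omega
  · rcases n with _ | n
    · omega
    · intro p hp
      simp only [List.ofFn_succ, List.head?_cons, Option.mem_def, Option.some.injEq] at hp
      rw [← hp, hl1]
      simp

/-- The starting point for the evaluation of `ρ` on products of cyclically alternating tuples. -/
lemma ρ_tupleProd {n m : ℕ} {a : Fin (n + 1) → 𝒜} {b : Fin (m + 1) → 𝒜}
    {i : Fin (n + 1) → Fin 2} {j : Fin (m + 1) → Fin 2}
    (hn : 1 ≤ n) (hm : 1 ≤ m)
    (ha : ∀ k, a k ∈ ![C, B] (i k)) (hb : ∀ k, b k ∈ ![C, B] (j k))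
    (hi : ∀ k, i k ≠ i (k + 1)) (hj : ∀ k, j k ≠ j (k + 1))
    (ha0 : ∀ k, S.φ (a k) = 0) (hb0 : ∀ k, S.φ (b k) = 0) (h0 : i 0 = 0) :
    S.ρ (tupleProd a) (tupleProd b) = ∑ l, if j l = 0 then
      S.φ ((tupleProd fun k : Fin n => a k.succ) * tupleProd fun k : Fin m => b (l + k.succ)) *
        S.φ (a 0 * b l) else 0 := by
  have hz : (tupleProd fun k : Fin n => a k.succ) ∈ W ((n - 1) / 2) := by
    simpa using mem_alternatingProducts hn ha hi ha0 0 h0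
  have ha00 : a 0 ∈ C := by
    have := ha 0
    rwa [h0] at this
  -- The element `q` collects the possible partners `b l` of `a 0`, each weighted by `φ` of the two
  -- words left after opening both cycles. Letters of colour `1` are killed by `D f` and do not
  -- contribute.
  rw [tupleProd_succ, T.ρ_mul_eq (q := ∑ l, if j l = 0 then
      S.φ ((tupleProd fun k : Fin n => a k.succ) * tupleProd fun k : Fin m => b (l + k.succ)) • b l
        else 0) hz ?_ ?_ ha00, ha0 0, zero_mul, zero_add, Finset.mul_sum, map_sum]
  · refine Finset.sum_congr rfl fun l _ => ?_
    split_ifs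
    · rw [mul_smul_comm, map_smul, smul_eq_mul]
    · rw [mul_zero, map_zero]
  · rw [map_sum]
    refine Finset.sum_eq_zero fun l _ => ?_
    split_ifs
    · rw [map_smul, hb0, smul_zero]
    · rw [map_zero]
  · intro w hw f
    rw [T.D_tupleProd, map_sum, map_sum, Finset.mul_sum, Finset.mul_sum, Finset.mul_sum, map_sum,
      map_sum]
    refine Finset.sum_congr rfl fun l _ => ?_
    split_ifs with hl
    · have hbl : b l ∈ C := by
        have := hb l
        rwa [hl] at this
      have e : ((List.ofFn b).drop (l + 1)).prod * ((List.ofFn b).take l).prod =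
          tupleProd fun k : Fin m => b (l + k.succ) := by
        rw [← List.prod_append, drop_append_take_ofFn, tupleProd]
      rw [T.φ_mul_flipMul hz (t := (m - 1) / 2)
        (by rw [e]; exact mem_alternatingProducts hm hb hj hb0 l hl) hw hbl, e,
        map_smul, mul_smul_comm, map_smul, smul_eq_mul]
    · have hbl : b l ∈ B := by
        have := hb l
        rwa [show j l = 1 by omega] at this
      rw [T.D_eq_zero f _ hbl]
      simp

lemma ρ_spoke {n : ℕ} {a b : Fin (n + 1) → 𝒜} {i j : Fin (n + 1) → Fin 2} (hn : 1 ≤ n)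
    (ha : ∀ k, a k ∈ ![C, B] (i k)) (hb : ∀ k, b k ∈ ![C, B] (j k))
    (hi : ∀ k, i k ≠ i (k + 1)) (hj : ∀ k, j k ≠ j (k + 1))
    (ha0 : ∀ k, S.φ (a k) = 0) (hb0 : ∀ k, S.φ (b k) = 0) (h0 : i 0 = 0) :
    S.ρ (tupleProd a) (tupleProd b) = ∑ l, ∏ k, S.φ (a k * b (k.rev + l)) := by
  rw [T.ρ_tupleProd hn hn ha hb hi hj ha0 hb0 h0]
  -- In the spoke sum the partner of `a 0` is `b (last + l)`, so the summation index is shifted by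
  -- `Fin.last n`.
  refine Eq.symm (Fintype.sum_equiv (Equiv.addLeft (Fin.last n)) _ _ fun l => ?_)
  simp only [Fin.prod_univ_succ, Equiv.coe_addLeft, Fin.rev_zero]
  obtain ⟨l', hl'⟩ : ∃ l', Fin.last n + l = l' := ⟨_, rfl⟩
  simp only [hl']
  have e : ∀ k : Fin n, (k.succ).rev + l = l' + (k.rev).succ := fun k => by
    have h1 : (k.succ).rev = (k.rev).succ + Fin.last n := by
      apply Fin.ext
      rw [Fin.val_add, Fin.val_rev, Fin.val_succ, Fin.val_succ, Fin.val_rev, Fin.val_last,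
        show n - (k + 1) + 1 + n = (n + 1 - (k + 1 + 1)) + (n + 1) by omega, Nat.add_mod_right,
        Nat.mod_eq_of_lt (by omega)]
    rw [h1, add_assoc, hl', add_comm _ l']
  simp only [e]
  obtain ⟨m, hm⟩ := alternating_even hi
  split_ifs with hl
  · rw [mul_comm]
    congr 1
    have h1 : ∀ k : Fin n, i k.succ = Fin.ofNat 2 (k + 1) := fun k => by
      have := alternating_add_succ hi 0 k
      rwa [zero_add, h0, zero_add] at this
    have h2 : ∀ k : Fin n, j (l' + k.succ) = Fin.ofNat 2 (k + 1) := fun k => by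
      rw [alternating_add_succ hj, hl, zero_add]
    have h3 : ∀ k : Fin n, i (k.rev).succ = Fin.ofNat 2 (k + 1) := fun k => by
      rw [h1, Fin.val_rev]
      apply Fin.ext
      rw [Fin.val_ofNat, Fin.val_ofNat]
      omega
    -- The entries from `a` are listed backwards because `φ_reverse_mul` reverses them; the
    -- innermost pair is the last `a` with the first `b` after `l'`.
    have := T.φ_reverse_mul (List.ofFn fun k : Fin n =>
      (Fin.ofNat 2 (k + 1), a (k.rev).succ, b (l' + k.succ))) ?_ ?_
    · rw [List.map_reverse, List.map_ofFn, List.map_ofFn, List.map_ofFn] at this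
      rw [← Equiv.prod_comp Fin.revPerm, ← List.prod_ofFn]
      simp only [Fin.revPerm_apply, Fin.rev_rev]
      refine Eq.trans ?_ ((congrArg S.φ ?_).trans this).symm
      · rfl
      · rw [tupleProd, tupleProd]
        congr 2
        refine List.ext_getElem (by simp) fun t h1 h2 => ?_
        simp only [List.getElem_ofFn, List.getElem_reverse, Function.comp_apply]
        congr 2
        apply Fin.ext
        simp at h1 ⊢
        omega
    · refine List.isChain_iff_getElem.2 fun k hk => ?_
      rw [List.getElem_ofFn, List.getElem_ofFn, Ne, Fin.ext_iff, Fin.val_ofNat, Fin.val_ofNat]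
      simp only
      omega
    · intro p hp
      obtain ⟨k, rfl⟩ := List.mem_ofFn.1 hp
      refine ⟨mem_centeredPart.2 ⟨?_, ha0 _⟩, mem_centeredPart.2 ⟨?_, hb0 _⟩⟩
      · rw [← h3]
        exact ha _
      · rw [← h2]
        exact hb _
  -- If `b l'` has the other colour, the factor `φ(a 0 * b l')` vanishes by freeness, matching the
  -- zero term on the other side.
  · have := T.φ_alternatingList (l := [(i 0, a 0), (j l', b l')]) ⟨by
      simpa [h0] using fun h => hl h.symm, by
      simpa using ⟨mem_centeredPart.2 ⟨ha _, ha0 _⟩, mem_centeredPart.2 ⟨hb _, hb0 _⟩⟩⟩ (by simp)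
    simp at this
    rw [this, zero_mul]

omit T in
lemma ρ_tupleProd_rotate {n : ℕ} (a : Fin (n + 1) → 𝒜) (v : 𝒜) :
    S.ρ (tupleProd fun k => a (k + 1)) v = S.ρ (tupleProd a) v := by
  rw [tupleProd_rotate, tupleProd_succ, S.ρ_tracial_left]

omit T in
-- Rotating `a` shifts the spoke pattern, which a shift of the summation index compensates.
lemma sum_spoke_rotate {n : ℕ} (a b : Fin (n + 1) → 𝒜) :
    ∑ l, ∏ k, S.φ (a (k + 1) * b (k.rev + l)) = ∑ l, ∏ k, S.φ (a k * b (k.rev + l)) := by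
  refine Eq.symm (Fintype.sum_equiv (Equiv.subRight 1) _ _ fun l => ?_)
  refine Eq.symm (Fintype.prod_equiv (Equiv.addRight 1) _ _ fun k => ?_)
  rw [Equiv.coe_addRight, Equiv.subRight_apply, ← fin_rev_add_one k, add_assoc,
    add_sub_cancel]

/-- After opening both cycles the two alternating words have different lengths, and `φ` of their
product vanishes. A single letter as second argument is handled by `ρ_mul_eq_zero`. -/
lemma ρ_tupleProd_eq_zero_of_ne {n m : ℕ} {a : Fin (n + 1) → 𝒜} {b : Fin (m + 1) → 𝒜}
    {i : Fin (n + 1) → Fin 2} (hn : 1 ≤ n)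
    (ha : ∀ k, a k ∈ ![C, B] (i k)) (hb : CyclicallyAlternating ![C, B] b)
    (hi : ∀ k, i k ≠ i (k + 1)) (ha0 : ∀ k, S.φ (a k) = 0) (hb0 : ∀ k, S.φ (b k) = 0)
    (h0 : i 0 = 0) (hnm : n ≠ m) : S.ρ (tupleProd a) (tupleProd b) = 0 := by
  obtain ⟨j, hb, hj⟩ := hb
  have ha00 : a 0 ∈ C := by
    have := ha 0
    rwa [h0] at this
  rcases Nat.eq_zero_or_pos m with rfl | hm
  · have hz := mem_alternatingProducts hn ha hi ha0 0 h0
    rw [tupleProd_succ]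
    refine T.ρ_mul_eq_zero (z := tupleProd fun k : Fin n => a k.succ) (by simpa using hz) ?_
      (mem_centeredPart.2 ⟨ha00, ha0 0⟩)
    have := hb 0
    rw [tupleProd, List.ofFn_succ, List.ofFn_zero, List.prod_singleton]
    by_cases h : j 0 = 0
    · rw [h] at this
      exact Or.inl this
    · rw [Fin.eq_one_of_ne_zero _ h] at this
      exact Or.inr this
  · have hj := hj (by omega)
    rw [T.ρ_tupleProd hn hm ha hb hi hj ha0 hb0 h0]
    refine Finset.sum_eq_zero fun l _ => ?_
    split_ifs with hl
    · have h1 := mem_alternatingProducts hn ha hi ha0 0 h0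
      have h2 := mem_alternatingProducts hm hb hj hb0 l hl
      obtain ⟨e, he⟩ := alternating_even hi
      obtain ⟨e', he'⟩ := alternating_even hj
      have := (T.mul_mem_of_mem_alternatingProducts h1 h2).2 (by omega)
      simp only [zero_add] at this
      rw [φ_eq_zero_of_mem this, zero_mul]
    · rfl

/-- The loop equations imply freeness of second order. -/
theorem isFreeOfSecondOrder : S.IsFreeOfSecondOrder ![C, B] where
  free := T.isFreeFamily
  length_ne := by
    have key : ∀ (n m : ℕ) (a : Fin (n + 1) → 𝒜) (b : Fin (m + 1) → 𝒜),
        CyclicallyAlternating ![C, B] a → CyclicallyAlternating ![C, B] b →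
        (∀ k, S.φ (a k) = 0) → (∀ k, S.φ (b k) = 0) → n ≠ m → 1 ≤ n →
        S.ρ (tupleProd a) (tupleProd b) = 0 := by
      rintro n m a b ⟨i, ha, hi⟩ hb ha0 hb0 hnm hn
      have hi := hi (by omega)
      by_cases h0 : i 0 = 0
      · exact T.ρ_tupleProd_eq_zero_of_ne hn ha hb hi ha0 hb0 h0 hnm
      · rw [← ρ_tupleProd_rotate]
        exact T.ρ_tupleProd_eq_zero_of_ne hn (i := fun k => i (k + 1)) (fun k => ha _) hb
          (fun k => hi _) (fun k => ha0 _) hb0 (fin_two_eq_zero h0 (hi 0))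
          hnm
    intro n m _ _ a b ha hb ha0 hb0 hnm
    obtain ⟨n, rfl⟩ := Nat.exists_eq_succ_of_ne_zero (NeZero.ne n)
    obtain ⟨m, rfl⟩ := Nat.exists_eq_succ_of_ne_zero (NeZero.ne m)
    rcases Nat.eq_zero_or_pos n with rfl | hn
    -- A tuple of length one need not contain a Gaussian letter; by symmetry of `ρ` the longer
    -- tuple, which does, takes the first place.
    · rw [T.ρ_symm]
      exact key _ _ _ _ hb ha hb0 ha0 (by omega) (by omega)
    · exact key _ _ _ _ ha hb ha0 hb0 (by omega) hn
  different := fun i j hij a ha b hb => by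
    rcases (show i = 0 ∨ i = 1 from em (i = 0) |>.imp id (Fin.eq_one_of_ne_zero i)) with rfl | rfl
    · obtain rfl : j = 1 := Fin.eq_one_of_ne_zero j hij.symm
      exact T.ρ_eq_zero_of_mem_of_mem ha hb
    · obtain rfl : j = 0 := fin_two_eq_zero one_ne_zero hij
      rw [T.ρ_symm]
      exact T.ρ_eq_zero_of_mem_of_mem hb ha
  spoke := by
    rintro n _ a b hn ⟨i, ha, hi⟩ ⟨j, hb, hj⟩ ha0 hb0
    have hi := hi hn
    have hj := hj hn
    obtain ⟨n, rfl⟩ := Nat.exists_eq_succ_of_ne_zero (NeZero.ne n)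
    by_cases h0 : i 0 = 0
    · exact T.ρ_spoke (by omega) ha hb hi hj ha0 hb0 h0
    · rw [← ρ_tupleProd_rotate]
      refine (T.ρ_spoke (by omega) (i := fun k => i (k + 1)) (fun k => ha _) hb (fun k => hi _) hj
        (fun k => ha0 _) hb0 (fin_two_eq_zero h0 (hi 0))).trans (sum_spoke_rotate a b)

end LoopCalculus

end LoopCalculus

/-! ### Moments of traces of polynomials in random matrices -/

section MatrixMoments
variable {Ω : Type*} [MeasurableSpace Ω] {P : Measure Ω} {α : Type*} {N : ℕ}

lemma HasAllMoments.finset_sum {ι : Type*} [IsFiniteMeasure P] {f : ι → Ω → ℂ} (S : Finset ι)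
    (hf : ∀ i, HasAllMoments P (f i)) : HasAllMoments P fun ω => ∑ i ∈ S, f i ω := by
  classical
  induction S using Finset.induction with
  | empty => simpa using hasAllMoments_const 0
  | insert i S hi ih => simpa only [Finset.sum_insert hi] using (hf i).add ih

lemma HasAllMoments.multiset_prod {ι : Type*} [IsFiniteMeasure P] {f : ι → Ω → ℂ} (s : Multiset ι)
    (hf : ∀ i, HasAllMoments P (f i)) : HasAllMoments P fun ω => (s.map fun i => f i ω).prod := by
  induction s using Multiset.induction with
  | empty => simpa using hasAllMoments_const 1
  | cons i s ih => simpa only [Multiset.map_cons, Multiset.prod_cons] using (hf i).mul ih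

variable {Z : α → Ω → Matrix (Fin N) (Fin N) ℂ}

lemma hasAllMoments_matrixPoly [IsFiniteMeasure P]
    (hZ : ∀ a k l, HasAllMoments P fun ω => Z a ω k l) (p : FreeAlgebra ℂ α) (k l : Fin N) :
    HasAllMoments P fun ω => matrixPoly (fun a => Z a ω) p k l := by
  induction p using FreeAlgebra.induction generalizing k l with
  | grade0 c =>
    simp only [matrixPoly, AlgHom.commutes]
    exact hasAllMoments_const _
  | grade1 a =>
    simp only [matrixPoly, FreeAlgebra.lift_ι_apply]
    exact hZ a k l
  | mul p q hp hq =>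
    have : ∀ ω, matrixPoly (fun a => Z a ω) (p * q) k l =
        ∑ j, matrixPoly (fun a => Z a ω) p k j * matrixPoly (fun a => Z a ω) q j l := fun ω => by
      simp only [matrixPoly, map_mul, Matrix.mul_apply]
    simp only [this]
    exact HasAllMoments.finset_sum _ fun j => (hp k j).mul (hq j l)
  | add p q hp hq =>
    simp only [matrixPoly, map_add, Matrix.add_apply]
    exact (hp k l).add (hq k l)

lemma hasAllMoments_trace [IsFiniteMeasure P]
    (hZ : ∀ a k l, HasAllMoments P fun ω => Z a ω k l) (p : FreeAlgebra ℂ α) :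
    HasAllMoments P fun ω => (matrixPoly (fun a => Z a ω) p).trace :=
  HasAllMoments.finset_sum _ fun k => hasAllMoments_matrixPoly hZ p k k

/-- The mixed moments of traces of polynomials in the random matrices `Z a`. -/
noncomputable def matrixMoment (P : Measure Ω) (Z : α → Ω → Matrix (Fin N) (Fin N) ℂ)
    (s : Multiset (FreeAlgebra ℂ α)) : ℂ :=
  ∫ ω, (s.map fun p => (matrixPoly (fun a => Z a ω) p).trace).prod ∂P

lemma isMultilinearMoment_matrixMoment [IsProbabilityMeasure P]
    (hZ : ∀ a k l, HasAllMoments P fun ω => Z a ω k l) :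
    IsMultilinearMoment (matrixMoment P Z) where
  zero := by simp [matrixMoment]
  add a b s := by
    have h := fun p => ((hasAllMoments_trace hZ p).mul
      (HasAllMoments.multiset_prod s (hasAllMoments_trace hZ))).integrable
    simp only [matrixMoment, Multiset.map_cons, Multiset.prod_cons]
    rw [← integral_add (h a) (h b)]
    simp only [matrixPoly, map_add, Matrix.trace_add, add_mul]
  smul c a s := by
    simp only [matrixMoment, Multiset.map_cons, Multiset.prod_cons]
    rw [← integral_const_mul]
    simp only [matrixPoly, map_smul, Matrix.trace_smul, smul_eq_mul, mul_assoc]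

lemma matrixMoment_mul_comm (p q : FreeAlgebra ℂ α) (s : Multiset (FreeAlgebra ℂ α)) :
    matrixMoment P Z ((p * q) ::ₘ s) = matrixMoment P Z ((q * p) ::ₘ s) := by
  simp only [matrixMoment, Multiset.map_cons, matrixPoly, map_mul]
  simp only [Matrix.trace_mul_comm (FreeAlgebra.lift ℂ _ p)]

lemma matrixMoment_cons_of_const {p : FreeAlgebra ℂ α} {c : ℂ}
    (hp : ∀ ω, (matrixPoly (fun a => Z a ω) p).trace = c) (s : Multiset (FreeAlgebra ℂ α)) :
    matrixMoment P Z (p ::ₘ s) = c * matrixMoment P Z s := by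
  simp only [matrixMoment, Multiset.map_cons, Multiset.prod_cons, hp, integral_const_mul]

/-- The candidate `c` times the indicator of the empty multiset is `c` times the unit of the
convolution. -/
lemma abstractCumulant_of_const {V : Type*} {m : Multiset V → ℂ} (hm : m 0 = 1) {a : V} {c : ℂ}
    (h : ∀ s, m (a ::ₘ s) = c * m s) (s : Multiset V) :
    abstractCumulant m a s = if s.card = 0 then c else 0 := by
  refine (congrFun (eq_abstractCumulant hm (a := a) (g := fun s => if s.card = 0 then c else 0)
    fun s => ?_) s).symm
  rw [multisetConv_comm, multisetConv_eq_add, Multiset.sum_eq_zero, h]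
  · simp [mul_comm]
  · intro y hy
    obtain ⟨p, hp, rfl⟩ := Multiset.mem_map.1 hy
    rw [if_neg (Multiset.mem_filter.1 hp).2, mul_zero]

lemma jointCumulant_trace [IsProbabilityMeasure P] {r : ℕ} (p : Fin (r + 1) → FreeAlgebra ℂ α) :
    jointCumulant P (fun j ω => (matrixPoly (fun a => Z a ω) (p j)).trace) =
      abstractCumulant (matrixMoment P Z) (p 0)
        (Finset.univ.val.map fun i : Fin r => p i.succ) := by
  refine jointCumulant_eq_abstractCumulant (by simp [matrixMoment]) _ _ fun B => ?_
  rw [matrixMoment]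
  simp only [Multiset.map_map, Function.comp_def]
  rfl

lemma jointCumulant_normTrace [IsProbabilityMeasure P] (p : FreeAlgebra ℂ α) :
    jointCumulant P ![fun ω => normTrace (matrixPoly (fun a => Z a ω) p)] =
      1 / (N : ℂ) * abstractCumulant (matrixMoment P Z) p 0 := by
  have key : ∀ y : Ω → ℂ, jointCumulant P ![y] = ∫ ω, y ω ∂P := fun y => by
    have := jointCumulant_eq_abstractCumulant (P := P) (m := fun s : Multiset (Ω → ℂ) =>
      ∫ ω, (s.map fun f => f ω).prod ∂P) (by simp) (r := 0) ![y] ![y] fun B => by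
        simp only [Multiset.map_map, Function.comp_def]
        rfl
    exact this.trans ((abstractCumulant_zero (by simp) _).trans (by simp))
  rw [key, abstractCumulant_zero (by simp [matrixMoment]), matrixMoment, ← integral_const_mul]
  simp [normTrace]

end MatrixMoments

/-! ### Second order limits in terms of normalized cumulants -/

section Convergence
variable {α : Type*} {Ω : ℕ → Type*} [∀ N, MeasurableSpace (Ω N)] {P : ∀ N, Measure (Ω N)}
  [∀ N, IsProbabilityMeasure (P N)] {Z : ∀ N, α → Ω N → Matrix (Fin N) (Fin N) ℂ}

lemma multiset_eq_map_fin {V : Type*} (s : Multiset V) :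
    ∃ f : Fin s.card → V, s = Finset.univ.val.map f := by
  refine ⟨fun i => s.toList.get (i.cast (by simp)), ?_⟩
  conv_lhs => rw [← s.coe_toList, ← List.ofFn_get s.toList]
  rw [← Fin.univ_val_map]
  have : ∀ n (h : n = s.toList.length), (Finset.univ.val : Multiset (Fin s.toList.length)).map
      s.toList.get = (Finset.univ.val : Multiset (Fin n)).map fun i => s.toList.get (i.cast h) := by
    rintro n rfl
    rfl
  exact this _ (by simp)

lemma normCumulant_map {V V' : Type*} (φ : V → V') {m : ℕ → Multiset V' → ℂ} (hm : ∀ N, m N 0 = 1)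
    (w : V) (s : Multiset V) :
    normCumulant m (φ w) (s.map φ) = normCumulant (fun N t => m N (t.map φ)) w s := by
  funext N
  rw [normCumulant, normCumulant, Multiset.card_map, abstractCumulant_map φ (hm N)]

lemma limCumulant_map {V V' : Type*} (φ : V → V') {m : ℕ → Multiset V' → ℂ} (hm : ∀ N, m N 0 = 1)
    (w : V) (s : Multiset V) :
    limCumulant m (φ w) (s.map φ) = limCumulant (fun N t => m N (t.map φ)) w s := by
  rw [limCumulant, limCumulant, normCumulant_map φ hm]

lemma cumulantConverges_map {V V' : Type*} (φ : V → V') {m : ℕ → Multiset V' → ℂ}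
    (hm : ∀ N, m N 0 = 1) (w : V) (s : Multiset V) :
    CumulantConverges m (φ w) (s.map φ) ↔ CumulantConverges (fun N t => m N (t.map φ)) w s := by
  rw [CumulantConverges, CumulantConverges, limCumulant_map φ hm, normCumulant_map φ hm,
    Multiset.card_map]

/-- A second order limit distribution makes all normalized cumulants converge. -/
lemma ConvergesToSecondOrder.cumulantConverges {𝒜 : Type*} [Ring 𝒜] [Algebra ℂ 𝒜]
    {S : SecondOrderNCPS 𝒜} {a : α → 𝒜} (h : ConvergesToSecondOrder P Z S a)
    (p : FreeAlgebra ℂ α) (s : Multiset (FreeAlgebra ℂ α)) :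
    CumulantConverges (fun N => matrixMoment (P N) (Z N)) p s := by
  obtain ⟨f, hf⟩ := multiset_eq_map_fin s
  generalize hr : s.card = r at f
  subst hf
  rcases r with _ | _ | r
  · refine cumulantConverges_of_tendsto ((h.first p).congr fun N => ?_) (by simp)
    rw [jointCumulant_normTrace]
    simp [normCumulant]
  · refine cumulantConverges_of_tendsto ((h.second p (f 0)).congr fun N => ?_) (by simp)
    rw [normCumulant_of_ne (by simp)]
    convert jointCumulant_trace (P := P N) (Z := Z N) ![p, f 0] using 2
    · funext j
      fin_cases j <;> rfl
    · rfl
    · rfl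
  · refine cumulantConverges_of_tendsto ((h.higher (r + 3) (by omega) (Fin.cons p f)).congr
      fun N => ?_) fun _ => rfl
    rw [normCumulant_of_ne (by simp), jointCumulant_trace]
    simp

/-- Convergence of all normalized cumulants to the functionals of a second order probability
space. -/
lemma convergesToSecondOrder_of {𝒜 : Type*} [Ring 𝒜] [Algebra ℂ 𝒜]
    {S : SecondOrderNCPS 𝒜} {a : α → 𝒜} (hZ : ∀ N a k l, HasAllMoments (P N) fun ω => Z N a ω k l)
    (h : ∀ p s, CumulantConverges (fun N => matrixMoment (P N) (Z N)) p s)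
    (h1 : ∀ p, S.φ (FreeAlgebra.lift ℂ a p) =
      limCumulant (fun N => matrixMoment (P N) (Z N)) p 0)
    (h2 : ∀ p q, S.ρ (FreeAlgebra.lift ℂ a p) (FreeAlgebra.lift ℂ a q) =
      limCumulant (fun N => matrixMoment (P N) (Z N)) p {q}) :
    ConvergesToSecondOrder P Z S a where
  moments N i k l q := hZ N i k l q
  first p := by
    rw [h1]
    refine (h p 0).1.congr fun N => ?_
    rw [jointCumulant_normTrace]
    simp [normCumulant]
  second p q := by
    rw [h2]
    refine (h p {q}).1.congr fun N => ?_
    rw [normCumulant_of_ne (by simp)]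
    symm
    convert jointCumulant_trace (P := P N) (Z := Z N) ![p, q] using 2
    · funext j
      fin_cases j <;> rfl
    · rfl
    · rfl
  higher r hr p := by
    obtain ⟨r, rfl⟩ : ∃ r', r = r' + 1 := ⟨r - 1, by omega⟩
    have := h (p 0) (Finset.univ.val.map fun i : Fin r => p i.succ)
    rw [← this.2 (by simp; omega)]
    refine this.1.congr fun N => ?_
    rw [normCumulant_of_ne (by simp; omega), jointCumulant_trace]

end Convergence

/-! ### Loop equations for Hermitian Gaussian random matrices -/

section Gaussian
variable {H : Type*} [NormedAddCommGroup H] [InnerProductSpace ℝ H]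
  {Ω : Type*} [MeasurableSpace Ω] {P : Measure Ω} {N : ℕ} {X : H → Ω → Matrix (Fin N) (Fin N) ℂ}

/-- The covariances are prescribed on the upper triangle only; Hermiticity reflects the other
entries into it, up to conjugation. -/
lemma IsHermitianGaussianFamily.integral_mul (hX : IsHermitianGaussianFamily P N X) (f g : H)
    (i j k l : Fin N) : ∫ ω, X f ω i j * X g ω k l ∂P =
      1 / (N : ℂ) * ((inner ℝ f g : ℝ) * if i = l ∧ j = k then 1 else 0) := by
  have hconj : ∀ (f : H) (i j : Fin N), ∀ᵐ ω ∂P, X f ω i j = (starRingEnd ℂ) (X f ω j i) :=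
    fun f i j => (hX.hermitian f).mono fun ω h => (h.apply i j).symm
  have hif : ∀ {p q : Prop} [Decidable p] [Decidable q],
      (if p then (1 : ℂ) else 0) * (if q then 1 else 0) = if p ∧ q then 1 else 0 := by
    intro p q _ _
    split_ifs <;> simp_all
  by_cases hij : i ≤ j
  · by_cases hlk : l ≤ k
    · rw [integral_congr_ae ((hconj g k l).mono fun ω h => by simp only [h]; rfl),
        hX.cov_conj f g i j l k hij hlk, hif]
      ring
    · push Not at hlk
      rcases hij.lt_or_eq with hij | rfl
      · rw [hX.cov f g i j k l hij hlk, if_neg, mul_zero, mul_zero]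
        rintro ⟨rfl, rfl⟩
        exact lt_asymm hij hlk
      -- A diagonal entry is excluded from `cov`, but it is real almost surely, so `cov_conj`
      -- applies with the factors exchanged.
      · rw [integral_congr_ae ((hconj f i i).mono fun ω h =>
          (mul_comm _ _).trans (congrArg (X g ω k l * ·) h)), hX.cov_conj g f k l i i hlk.le le_rfl, hif,
          real_inner_comm, if_congr (show (k = i ∧ l = i) ↔ (i = l ∧ i = k) from
            ⟨fun h => ⟨h.2.symm, h.1.symm⟩, fun h => ⟨h.2.symm, h.1.symm⟩⟩) rfl rfl]
        ring
  · push Not at hij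
    by_cases hlk : k ≤ l
    · rw [integral_congr_ae ((hconj f i j).mono fun ω h => by
        simp only [h]; exact mul_comm _ _), hX.cov_conj g f k l j i hlk hij.le, hif,
        real_inner_comm, if_congr (show (k = j ∧ l = i) ↔ (i = l ∧ j = k) from
          ⟨fun h => ⟨h.2.symm, h.1.symm⟩, fun h => ⟨h.2.symm, h.1.symm⟩⟩) rfl rfl]
      ring
    · push Not at hlk
      have : ∀ᵐ ω ∂P, X f ω i j * X g ω k l = (starRingEnd ℂ) (X f ω j i * X g ω l k) := by
        filter_upwards [hconj f i j, hconj g k l] with ω h1 h2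
        rw [h1, h2, map_mul]
      rw [integral_congr_ae this, integral_conj, hX.cov f g j i l k hij hlk, map_zero, if_neg,
        mul_zero, mul_zero]
      rintro ⟨rfl, rfl⟩
      exact lt_asymm hij hlk

/-- The expectation of a polynomial in random variables with moments of all orders. -/
noncomputable def polyExpectation [IsFiniteMeasure P] {T : Type*} {Y : T → Ω → ℂ}
    (hY : ∀ t, HasAllMoments P (Y t)) : MvPolynomial T ℂ →ₗ[ℂ] ℂ where
  toFun F := ∫ ω, MvPolynomial.eval (fun t => Y t ω) F ∂P
  map_add' F F' := by
    rw [← integral_add (HasAllMoments.eval hY F).integrable (HasAllMoments.eval hY F').integrable]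
    simp only [map_add]
  map_smul' c F := by
    simp only [MvPolynomial.smul_eval, integral_const_mul, RingHom.id_apply, smul_eq_mul]

/-- The matrices of indeterminates of a joint family. -/
noncomputable def genericMatrix {ι κ : Type*} {N : ℕ} : ι ⊕ κ →
    Matrix (Fin N) (Fin N) (MvPolynomial ((ι × Fin N × Fin N) ⊕ (κ × Fin N × Fin N)) ℂ)
  | .inl a => .of fun k l => .X (.inl (a, k, l))
  | .inr a => .of fun k l => .X (.inr (a, k, l))

/-- The monomial of a word. -/
noncomputable def wordMonomial {α : Type*} (w : List α) : FreeAlgebra ℂ α :=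
  (w.map (FreeAlgebra.ι ℂ)).prod

lemma lift_wordMonomial {α 𝒜 : Type*} [Ring 𝒜] [Algebra ℂ 𝒜] (a : α → 𝒜) (w : List α) :
    FreeAlgebra.lift ℂ a (wordMonomial w) = (w.map a).prod := by
  rw [wordMonomial, map_list_prod, List.map_map]
  congr 2
  funext i
  simp

variable {κ : Type*} {A : κ → Ω → Matrix (Fin N) (Fin N) ℂ}

/-- The entries of a joint family of random matrices. -/
def jointEntries (X : H → Ω → Matrix (Fin N) (Fin N) ℂ) (A : κ → Ω → Matrix (Fin N) (Fin N) ℂ) :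
    (H × Fin N × Fin N) ⊕ (κ × Fin N × Fin N) → Ω → ℂ :=
  Sum.elim (fun t ω => X t.1 ω t.2.1 t.2.2) (fun t ω => A t.1 ω t.2.1 t.2.2)

omit [NormedAddCommGroup H] [InnerProductSpace ℝ H] [MeasurableSpace Ω] in
lemma eval_wordMatrix_trace (w : List (H ⊕ κ)) (ω : Ω) :
    MvPolynomial.eval (fun t => jointEntries X A t ω) (wordMatrix genericMatrix w).trace =
      (matrixPoly (fun a => Sum.elim X A a ω) (wordMonomial w)).trace := by
  have h1 : (MvPolynomial.eval fun t => jointEntries X A t ω).mapMatrix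
      (wordMatrix genericMatrix w) = matrixPoly (fun a => Sum.elim X A a ω) (wordMonomial w) := by
    rw [matrixPoly, lift_wordMonomial, wordMatrix, map_list_prod, List.map_map]
    congr 2
    funext a
    ext k l
    rcases a with a | a <;> simp [genericMatrix, jointEntries]
  rw [← h1]
  simp [Matrix.trace, map_sum]

omit [NormedAddCommGroup H] [InnerProductSpace ℝ H] in
lemma matrixMoment_wordMonomial [IsFiniteMeasure P]
    (hY : ∀ t, HasAllMoments P (jointEntries X A t)) (s : Multiset (List (H ⊕ κ))) :
    matrixMoment P (Sum.elim X A) (s.map wordMonomial) =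
      traceMoment genericMatrix (polyExpectation hY) s := by
  rw [traceMoment, matrixMoment]
  refine integral_congr_ae (Eventually.of_forall fun ω => ?_)
  simp only [map_multiset_prod, Multiset.map_map, Function.comp_def, eval_wordMatrix_trace]

lemma IsHermitianGaussianFamily.matrixStein [IsProbabilityMeasure P]
    (hX : IsHermitianGaussianFamily P N X)
    (hA : ∀ a k l, HasAllMoments P fun ω => A a ω k l)
    (hind : IndepFun (fun ω (t : H × Fin N × Fin N) => X t.1 ω t.2.1 t.2.2)
        (fun ω (t : κ × Fin N × Fin N) => A t.1 ω t.2.1 t.2.2) P)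
    (hY : ∀ t, HasAllMoments P (jointEntries X A t)) (f : H) :
    MatrixStein (genericMatrix (κ := κ)) (polyExpectation hY) (genericMatrix (.inl f))
      (1 / (N : ℂ)) (Sum.elim (fun g => ((inner ℝ f g : ℝ) : ℂ)) fun _ => 0) := by
  intro i j
  refine ⟨_, ?_, fun F => (Eq.trans ?_ (stein_sum hX.gaussian (fun t => hX.centered _ _ _)
    (fun t => hA _ _ _) hind (f, i, j) F))⟩
  · rintro (g | a) k l
    · rw [genericMatrix, Matrix.of_apply, MvPolynomial.mkDerivation_X, Sum.elim_inl, Sum.elim_inl,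
        hX.integral_mul]
      rfl
    · simp [genericMatrix]
  · refine integral_congr_ae (Eventually.of_forall fun ω => ?_)
    simp [genericMatrix, jointEntries]

lemma IsHermitianGaussianFamily.hasAllMoments_entry (hX : IsHermitianGaussianFamily P N X)
    (f : H) (k l : Fin N) : HasAllMoments P fun ω => X f ω k l :=
  hX.gaussian.hasAllMoments (f, k, l)

end Gaussian

/-! ### Convergence of cumulants for the joint family -/

section Limits
variable {H : Type*} [NormedAddCommGroup H] [InnerProductSpace ℝ H] {κ : Type*} [DecidableEq (H ⊕ κ)]
  {Ω : ℕ → Type*} [∀ N, MeasurableSpace (Ω N)] {P : ∀ N, Measure (Ω N)}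
  [∀ N, IsProbabilityMeasure (P N)] {X : ∀ N, H → Ω N → Matrix (Fin N) (Fin N) ℂ}
  {A : ∀ N, κ → Ω N → Matrix (Fin N) (Fin N) ℂ}

lemma loopEquation_gaussian (hX : ∀ N, IsHermitianGaussianFamily (P N) N (X N))
    (hA : ∀ N a k l, HasAllMoments (P N) fun ω => A N a ω k l)
    (hind : ∀ N, IndepFun (fun ω (t : H × Fin N × Fin N) => X N t.1 ω t.2.1 t.2.2)
        (fun ω (t : κ × Fin N × Fin N) => A N t.1 ω t.2.1 t.2.2) (P N)) (f : H) :
    LoopEquation (fun N t => matrixMoment (P N) (Sum.elim (X N) (A N)) (t.map wordMonomial))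
      (Sum.inl f) (Sum.elim (fun g => ((inner ℝ f g : ℝ) : ℂ)) fun _ => 0) := by
  intro N w s
  have hY : ∀ t, HasAllMoments (P N) (jointEntries (X N) (A N) t) := by
    rintro (t | t)
    · exact (hX N).hasAllMoments_entry _ _ _
    · exact hA N _ _ _
  simp only [matrixMoment_wordMonomial hY]
  exact traceMoment_loop ((hX N).matrixStein (hA N) (hind N) hY f) w s

omit [DecidableEq (H ⊕ κ)] [InnerProductSpace ℝ H] [NormedAddCommGroup H]
  [∀ N, IsProbabilityMeasure (P N)] in
lemma matrixMoment_map_inr (N : ℕ) (s : Multiset (FreeAlgebra ℂ κ)) :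
    matrixMoment (P N) (Sum.elim (X N) (A N))
      (s.map (FreeAlgebra.lift ℂ fun a => FreeAlgebra.ι ℂ (Sum.inr a))) =
      matrixMoment (P N) (A N) s := by
  have : ∀ (ω : Ω N) (p : FreeAlgebra ℂ κ), matrixPoly (fun a => Sum.elim (X N) (A N) a ω)
      (FreeAlgebra.lift ℂ (fun a => FreeAlgebra.ι ℂ (Sum.inr a)) p) =
      matrixPoly (fun a => A N a ω) p := fun ω p => by
    rw [matrixPoly, matrixPoly, ← AlgHom.comp_apply]
    congr 1
    ext a
    simp
  simp only [matrixMoment, Multiset.map_map, Function.comp_def, this]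

omit [DecidableEq (H ⊕ κ)] [InnerProductSpace ℝ H] [NormedAddCommGroup H] in
lemma exists_map_inr {w : List (H ⊕ κ)} (h : w.countP Sum.isLeft = 0) :
    (w.filterMap Sum.getRight?).map Sum.inr = w := by
  induction w with
  | nil => rfl
  | cons a w ih =>
    rw [List.countP_cons] at h
    rcases a with a | a
    · simp at h
    · simp [ih (by omega)]

lemma span_wordMonomial (α : Type*) :
    Submodule.span ℂ (Set.range (wordMonomial : List α → FreeAlgebra ℂ α)) = ⊤ := by
  rw [eq_top_iff, ← Algebra.top_toSubmodule, ← FreeAlgebra.adjoin_range_ι]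
  exact adjoin_range_le_span _

/-- All cumulants of the joint family converge. -/
theorem cumulantConverges_joint (hX : ∀ N, IsHermitianGaussianFamily (P N) N (X N))
    (hA : ∀ N a k l, HasAllMoments (P N) fun ω => A N a ω k l)
    (hind : ∀ N, IndepFun (fun ω (t : H × Fin N × Fin N) => X N t.1 ω t.2.1 t.2.2)
        (fun ω (t : κ × Fin N × Fin N) => A N t.1 ω t.2.1 t.2.2) (P N))
    (hconv : ∀ p s, CumulantConverges (fun N => matrixMoment (P N) (A N)) p s)
    (p : FreeAlgebra ℂ (H ⊕ κ)) (s : Multiset (FreeAlgebra ℂ (H ⊕ κ))) :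
    CumulantConverges (fun N => matrixMoment (P N) (Sum.elim (X N) (A N))) p s := by
  have hY : ∀ N (t : H ⊕ κ) k l, HasAllMoments (P N) fun ω => Sum.elim (X N) (A N) t ω k l := by
    rintro N (t | t) k l
    · exact (hX N).hasAllMoments_entry _ _ _
    · exact hA N _ _ _
  refine cumulantConverges_of_span wordMonomial (span_wordMonomial _)
    (fun N => isMultilinearMoment_matrixMoment (hY N)) (fun w s => ?_) p s
  refine cumulantConverges_word (p := Sum.isLeft) (by simp [matrixMoment]) (fun N a w s => ?_)
    (fun f hf => ?_) (fun w s hws => ?_) w s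
  · simp only [Multiset.map_cons, wordMonomial, List.map_cons, List.prod_cons, List.map_append,
      List.prod_append, List.map_nil, List.prod_nil, mul_one]
    exact matrixMoment_mul_comm _ _ _
  · rcases f with f | a
    · exact ⟨_, loopEquation_gaussian hX hA hind f⟩
    · simp at hf
  -- Without Gaussian letters, all words are images of words in the second family, whose cumulants
  -- converge by `hconv`.
  · rw [letterCount_cons] at hws
    have hs : ∀ v ∈ s, v.countP Sum.isLeft = 0 := fun v hv => by
      obtain ⟨t, rfl⟩ := Multiset.exists_cons_of_mem hv
      rw [letterCount_cons] at hws
      omega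
    have hs' : (s.map fun v => v.filterMap Sum.getRight?).map (List.map Sum.inr) = s := by
      rw [Multiset.map_map]
      conv_rhs => rw [← Multiset.map_id s]
      exact Multiset.map_congr rfl fun v hv => exists_map_inr (hs v hv)
    rw [← exists_map_inr (show w.countP Sum.isLeft = 0 by omega), ← hs',
      cumulantConverges_map (List.map Sum.inr)
        (m := fun N t => matrixMoment (P N) (Sum.elim (X N) (A N)) (t.map wordMonomial))
        (by simp [matrixMoment])]
    have e : ∀ (N : ℕ) (t : Multiset (List κ)), matrixMoment (P N) (Sum.elim (X N) (A N))
        ((t.map (List.map Sum.inr)).map wordMonomial) =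
        matrixMoment (P N) (A N) (t.map wordMonomial) := fun N t => by
      rw [← matrixMoment_map_inr (X := X), Multiset.map_map, Multiset.map_map]
      congr 2
      funext v
      simp [wordMonomial, map_list_prod, Function.comp_def]
    simp only [e]
    exact (cumulantConverges_map wordMonomial (m := fun N => matrixMoment (P N) (A N))
      (by simp [matrixMoment]) _ _).1 (hconv _ _)

end Limits

/-! ### Free difference quotients -/

section FreeDifferenceQuotient

open scoped TensorProduct

variable {α : Type*}

/-- The algebra homomorphism from which the free difference quotient is read off. -/
noncomputable def differenceQuotientHom (b : α → ℂ) : FreeAlgebra ℂ α →ₐ[ℂ]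
    Matrix (Fin 2) (Fin 2) (FreeAlgebra ℂ α ⊗[ℂ] FreeAlgebra ℂ α) :=
  FreeAlgebra.lift ℂ fun a => !![FreeAlgebra.ι ℂ a ⊗ₜ 1, b a • (1 ⊗ₜ 1); 0, 1 ⊗ₜ FreeAlgebra.ι ℂ a]

/-- The hom is upper triangular with diagonal `p ⊗ 1`, `1 ⊗ p`, so multiplicativity read in the
upper right corner is the Leibniz rule of the difference quotient. -/
lemma differenceQuotientHom_apply (b : α → ℂ) (p : FreeAlgebra ℂ α) :
    differenceQuotientHom b p 0 0 = p ⊗ₜ 1 ∧ differenceQuotientHom b p 1 0 = 0 ∧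
      differenceQuotientHom b p 1 1 = 1 ⊗ₜ p := by
  induction p using FreeAlgebra.induction with
  | grade0 c =>
    rw [AlgHom.commutes]
    simp only [Matrix.algebraMap_matrix_apply, if_true, one_ne_zero, if_false, true_and]
    refine ⟨Algebra.TensorProduct.algebraMap_apply _, ?_⟩
    rw [Algebra.TensorProduct.algebraMap_apply, Algebra.algebraMap_eq_smul_one,
      TensorProduct.smul_tmul]
  | grade1 a => simp [differenceQuotientHom]
  | mul p q hp hq => simp [Matrix.mul_apply, hp, hq]
  | add p q hp hq => simp [hp, hq, TensorProduct.add_tmul, TensorProduct.tmul_add]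

/-- The free difference quotient, weighted by `b`. -/
noncomputable def differenceQuotient (b : α → ℂ) :
    FreeAlgebra ℂ α →ₗ[ℂ] FreeAlgebra ℂ α ⊗[ℂ] FreeAlgebra ℂ α :=
  (Matrix.entryLinearMap ℂ _ 0 1) ∘ₗ (differenceQuotientHom b).toLinearMap

lemma differenceQuotient_mul (b : α → ℂ) (p q : FreeAlgebra ℂ α) :
    differenceQuotient b (p * q) =
      differenceQuotient b p * (1 ⊗ₜ q) + (p ⊗ₜ 1) * differenceQuotient b q := by
  simp [differenceQuotient, Matrix.mul_apply, (differenceQuotientHom_apply b p).1,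
    (differenceQuotientHom_apply b q).2.2, add_comm]

lemma differenceQuotient_ι (b : α → ℂ) (a : α) :
    differenceQuotient b (FreeAlgebra.ι ℂ a) = b a • (1 ⊗ₜ 1) := by
  simp [differenceQuotient, differenceQuotientHom]

lemma differenceQuotient_one (b : α → ℂ) : differenceQuotient b 1 = 0 := by
  simp [differenceQuotient]

lemma differenceQuotient_wordMonomial (b : α → ℂ) (w : List α) :
    differenceQuotient b (wordMonomial w) = ((wordSplits w).map fun q =>
      b q.1 • (wordMonomial q.2.1 ⊗ₜ[ℂ] wordMonomial q.2.2)).sum :=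
  differenceQuotient_word (differenceQuotient_mul b) (differenceQuotient_ι b) w

lemma tensorFunctional_differenceQuotient_wordMonomial (b : α → ℂ) (w : List α)
    (φ ψ : FreeAlgebra ℂ α →ₗ[ℂ] ℂ) :
    tensorFunctional φ ψ (differenceQuotient b (wordMonomial w)) = ((wordSplits w).map fun q =>
      b q.1 * (φ (wordMonomial q.2.1) * ψ (wordMonomial q.2.2))).sum := by
  rw [differenceQuotient_wordMonomial, map_list_sum, List.map_map]
  congr 1
  refine List.map_congr_left fun q _ => ?_
  simp

lemma differenceQuotient_eq_zero {κ : Type*} {i : κ → α} {b : α → ℂ} (hb : ∀ k, b (i k) = 0)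
    {p : FreeAlgebra ℂ α} (hp : p ∈ Algebra.adjoin ℂ (Set.range fun k => FreeAlgebra.ι ℂ (i k))) :
    differenceQuotient b p = 0 := by
  induction hp using Algebra.adjoin_induction with
  | mem x hx =>
    obtain ⟨k, rfl⟩ := hx
    rw [differenceQuotient_ι, hb, zero_smul]
  | algebraMap r => rw [Algebra.algebraMap_eq_smul_one, map_smul, differenceQuotient_one, smul_zero]
  | add x y _ _ hx hy => rw [map_add, hx, hy, add_zero]
  | mul x y _ _ hx hy => rw [differenceQuotient_mul, hx, hy, zero_mul, mul_zero, add_zero]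

lemma linearMap_ext_wordMonomial {V : Type*} [AddCommGroup V] [Module ℂ V]
    {f g : FreeAlgebra ℂ α →ₗ[ℂ] V} (h : ∀ w, f (wordMonomial w) = g (wordMonomial w)) : f = g :=
  LinearMap.ext_on_range (span_wordMonomial α) h

end FreeDifferenceQuotient

/-! ### The limit of the joint family -/

section LimitSpace
variable {α : Type*} {Ω : ℕ → Type*} [∀ N, MeasurableSpace (Ω N)] {P : ∀ N, Measure (Ω N)}
  [∀ N, IsProbabilityMeasure (P N)] {Z : ∀ N, α → Ω N → Matrix (Fin N) (Fin N) ℂ}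

lemma limCumulant_congr {V : Type*} {m : ℕ → Multiset V → ℂ} (hm : ∀ N, m N 0 = 1) {a b : V}
    (h : ∀ N s, m N (a ::ₘ s) = m N (b ::ₘ s)) (s : Multiset V) :
    limCumulant m a s = limCumulant m b s := by
  have : normCumulant m a s = normCumulant m b s := by
    funext N
    rw [normCumulant, normCumulant, abstractCumulant_congr (hm N) (h N)]
  rw [limCumulant, limCumulant, this]

lemma limCumulant_of_const {V : Type*} {m : ℕ → Multiset V → ℂ} (hm : ∀ N, m N 0 = 1) {a : V}
    {c : ℕ → ℂ} (h : ∀ N s, m N (a ::ₘ s) = c N * m N s) {s : Multiset V} (hs : s.card ≠ 0) :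
    Tendsto (normCumulant m a s) atTop (𝓝 0) := by
  refine tendsto_const_nhds.congr fun N => ?_
  rw [normCumulant, abstractCumulant_of_const (hm N) (h N), if_neg hs, if_neg hs, mul_zero]

lemma matrixMoment_zero (N : ℕ) : matrixMoment (P N) (Z N) 0 = 1 := by simp [matrixMoment]

omit [∀ N, IsProbabilityMeasure (P N)] in
lemma matrixMoment_one_cons (N : ℕ) (s : Multiset (FreeAlgebra ℂ α)) :
    matrixMoment (P N) (Z N) (1 ::ₘ s) = N * matrixMoment (P N) (Z N) s :=
  matrixMoment_cons_of_const (fun ω => by simp [matrixPoly]) s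

/-- The second order probability space of limits of cumulants of traces. -/
noncomputable def limitSpace (hm : ∀ N, IsMultilinearMoment (matrixMoment (P N) (Z N)))
    (h : ∀ p s, CumulantConverges (fun N => matrixMoment (P N) (Z N)) p s) :
    SecondOrderNCPS (FreeAlgebra ℂ α) :=
  have hρ : ∀ p, limCumulant (fun N => matrixMoment (P N) (Z N)) 1 {p} = 0 := fun p =>
    tendsto_nhds_unique (h 1 {p}).1
      (limCumulant_of_const matrixMoment_zero matrixMoment_one_cons (by simp))
  have htr : ∀ p q s, limCumulant (fun N => matrixMoment (P N) (Z N)) (p * q) s =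
      limCumulant (fun N => matrixMoment (P N) (Z N)) (q * p) s := fun p q s =>
    limCumulant_congr matrixMoment_zero (fun N s => matrixMoment_mul_comm p q s) s
  { φ := limFirst hm h
    ρ := limSecond hm h
    φ_one := by
      -- The normalized trace of `1` equals one only for `N ≠ 0`, hence the eventual congruence.
      refine tendsto_nhds_unique (h 1 0).1 (tendsto_const_nhds.congr'
        ((eventually_ne_atTop 0).mono fun N hN => ?_))
      have hN' : (N : ℂ) ≠ 0 := by exact_mod_cast hN
      rw [normCumulant_zero, abstractCumulant_zero (matrixMoment_zero N), ← Multiset.cons_zero,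
        matrixMoment_one_cons, matrixMoment_zero, mul_one, one_div_mul_cancel hN']
    φ_tracial := fun p q => htr p q 0
    ρ_tracial_left := fun p q r => htr p q {r}
    ρ_tracial_right := fun p q r =>
      (limCumulant_comm hm _ _).trans ((htr p q {r}).trans (limCumulant_comm hm _ _))
    ρ_one_right := fun p => (limCumulant_comm hm _ _).trans (hρ p)
    ρ_one_left := hρ }

end LimitSpace

/-! ### Limit loop equations and the main theorem -/

section Main
variable {H : Type*} [NormedAddCommGroup H] [InnerProductSpace ℝ H] {κ : Type*}
  {Ω : ℕ → Type*} [∀ N, MeasurableSpace (Ω N)] {P : ∀ N, Measure (Ω N)}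
  [∀ N, IsProbabilityMeasure (P N)] {X : ∀ N, H → Ω N → Matrix (Fin N) (Fin N) ℂ}
  {A : ∀ N, κ → Ω N → Matrix (Fin N) (Fin N) ℂ}

open scoped TensorProduct in
/-- The loop equations in the limit. -/
noncomputable def gaussianLoopCalculus (hX : ∀ N, IsHermitianGaussianFamily (P N) N (X N))
    (hA : ∀ N a k l, HasAllMoments (P N) fun ω => A N a ω k l)
    (hind : ∀ N, IndepFun (fun ω (t : H × Fin N × Fin N) => X N t.1 ω t.2.1 t.2.2)
        (fun ω (t : κ × Fin N × Fin N) => A N t.1 ω t.2.1 t.2.2) (P N))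
    (hm : ∀ N, IsMultilinearMoment (matrixMoment (P N) (Sum.elim (X N) (A N))))
    (h : ∀ p s, CumulantConverges (fun N => matrixMoment (P N) (Sum.elim (X N) (A N))) p s) :
    LoopCalculus (limitSpace hm h) (fun f : H => FreeAlgebra.ι ℂ (Sum.inl f : H ⊕ κ))
      (Algebra.adjoin ℂ (Set.range fun a : κ => FreeAlgebra.ι ℂ (Sum.inr a : H ⊕ κ))) := by
  classical
  let b : H → H ⊕ κ → ℂ := fun f => Sum.elim (fun g => ((inner ℝ f g : ℝ) : ℂ)) fun _ => 0
  have hm0 : ∀ N, matrixMoment (P N) (Sum.elim (X N) (A N)) 0 = 1 := matrixMoment_zero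
  have hloop := loopEquation_gaussian hX hA hind
  have hlim : ∀ w s, limCumulant (fun N => matrixMoment (P N) (Sum.elim (X N) (A N)))
      (wordMonomial w) (s.map wordMonomial) = limCumulant (fun N t =>
        matrixMoment (P N) (Sum.elim (X N) (A N)) (t.map wordMonomial)) w s :=
    limCumulant_map wordMonomial hm0
  have hw : ∀ w s, CumulantConverges (fun N t =>
      matrixMoment (P N) (Sum.elim (X N) (A N)) (t.map wordMonomial)) w s := fun w s =>
    (cumulantConverges_map wordMonomial hm0 w s).1 (h _ _)
  have hm0' : ∀ N, matrixMoment (P N) (Sum.elim (X N) (A N))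
      ((0 : Multiset (List (H ⊕ κ))).map wordMonomial) = 1 := hm0
  have hφ : ∀ w, (limitSpace hm h).φ (wordMonomial w) = limCumulant (fun N t =>
        matrixMoment (P N) (Sum.elim (X N) (A N)) (t.map wordMonomial)) w 0 := fun w => hlim w 0
  have hρ : ∀ w v, (limitSpace hm h).ρ (wordMonomial w) (wordMonomial v) = limCumulant (fun N t =>
        matrixMoment (P N) (Sum.elim (X N) (A N)) (t.map wordMonomial)) w {v} :=
    fun w v => hlim w {v}
  have hcons : ∀ (f : H) (w : List (H ⊕ κ)), FreeAlgebra.ι ℂ (Sum.inl f) * wordMonomial w =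
      wordMonomial (Sum.inl f :: w) := fun f w => by simp [wordMonomial]
  exact
  { c := fun f g => ((inner ℝ f g : ℝ) : ℂ)
    D := fun f => differenceQuotient (b f)
    D_mul := fun f => differenceQuotient_mul _
    D_gen := fun f g => differenceQuotient_ι _ _
    D_eq_zero := fun f p hp => differenceQuotient_eq_zero (i := Sum.inr) (b := b f) (fun _ => rfl) hp
    φ_loop := fun f w => by
      -- On words, both sides are limits of the same sequence of normalized cumulants; linearity
      -- extends the identity to all polynomials.
      have : (limitSpace hm h).φ ∘ₗ LinearMap.mulLeft ℂ (FreeAlgebra.ι ℂ (Sum.inl f)) =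
          tensorFunctional (limitSpace hm h).φ (limitSpace hm h).φ ∘ₗ
            differenceQuotient (b f) := by
        refine linearMap_ext_wordMonomial fun w => ?_
        simp only [LinearMap.comp_apply, LinearMap.mulLeft_apply, hcons,
          tensorFunctional_differenceQuotient_wordMonomial, hφ]
        exact tendsto_nhds_unique (hw _ _).1
          ((hloop f).tendsto_first hm0' w fun q _ => ⟨hw _ _, hw _ _, hw _ _⟩)
      exact LinearMap.congr_fun this w
    ρ_loop := fun f w v => by
      set S := limitSpace hm h
      let Ψ : FreeAlgebra ℂ (H ⊕ κ) → FreeAlgebra ℂ (H ⊕ κ) → ℂ := fun w v =>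
        tensorFunctional S.φ (S.ρ.flip v) (differenceQuotient (b f) w) +
          tensorFunctional (S.ρ.flip v) S.φ (differenceQuotient (b f) w) +
          S.φ (w * flipMul (differenceQuotient (b f) v))
      have hflip : ∀ (w v : List (H ⊕ κ)), S.φ (wordMonomial w *
          flipMul (differenceQuotient (b f) (wordMonomial v))) = ((wordSplits v).map fun q =>
            b f q.1 * limCumulant (fun N t => matrixMoment (P N) (Sum.elim (X N) (A N))
              (t.map wordMonomial)) (w ++ q.2.2 ++ q.2.1) 0).sum := fun w v => by
        rw [differenceQuotient_wordMonomial, map_list_sum, List.map_map, ← List.sum_map_mul_left,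
          map_list_sum, List.map_map]
        congr 1
        refine List.map_congr_left fun q _ => ?_
        rw [← hφ]
        simp [wordMonomial, S]
      have hword : ∀ w v : List (H ⊕ κ), S.ρ (FreeAlgebra.ι ℂ (Sum.inl f) * wordMonomial w)
          (wordMonomial v) = Ψ (wordMonomial w) (wordMonomial v) := fun w v => by
        simp only [Ψ]
        rw [hcons, hflip, tensorFunctional_differenceQuotient_wordMonomial,
          tensorFunctional_differenceQuotient_wordMonomial, ← List.sum_map_add]
        simp only [LinearMap.flip_apply, S, hφ, hρ, ← mul_add]
        exact tendsto_nhds_unique (hw _ _).1 ((hloop f).tendsto_second hm0' w v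
          (fun q _ => ⟨hw _ _, hw _ _, hw _ _, hw _ _, hw _ _⟩) fun q _ => hw _ _)
      have hΨ1 : ∀ v : List (H ⊕ κ), S.ρ (FreeAlgebra.ι ℂ (Sum.inl f) * w) (wordMonomial v) =
          Ψ w (wordMonomial v) := fun v => by
        have : S.ρ.flip (wordMonomial v) ∘ₗ LinearMap.mulLeft ℂ (FreeAlgebra.ι ℂ (Sum.inl f)) =
            tensorFunctional S.φ (S.ρ.flip (wordMonomial v)) ∘ₗ differenceQuotient (b f) +
              tensorFunctional (S.ρ.flip (wordMonomial v)) S.φ ∘ₗ differenceQuotient (b f) +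
              S.φ ∘ₗ LinearMap.mulRight ℂ
                (flipMul (differenceQuotient (b f) (wordMonomial v))) :=
          linearMap_ext_wordMonomial fun w => hword w v
        exact LinearMap.congr_fun this w
      -- Linearity in `v` of the two tensor terms is not visible from their form, so linear maps
      -- representing them are built by induction on the tensor; then comparing on words `v`
      -- suffices.
      have hadd : ∀ (g : FreeAlgebra ℂ (H ⊕ κ) →ₗ[ℂ] ℂ)
          (t : FreeAlgebra ℂ (H ⊕ κ) ⊗[ℂ] FreeAlgebra ℂ (H ⊕ κ)),
          (∃ L : FreeAlgebra ℂ (H ⊕ κ) →ₗ[ℂ] ℂ, ∀ v, L v = tensorFunctional g (S.ρ.flip v) t) ∧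
          ∃ L : FreeAlgebra ℂ (H ⊕ κ) →ₗ[ℂ] ℂ, ∀ v, L v = tensorFunctional (S.ρ.flip v) g t := by
        intro g t
        induction t with
        | zero => exact ⟨⟨0, by simp⟩, ⟨0, by simp⟩⟩
        | tmul p q => exact ⟨⟨g p • S.ρ q, by simp⟩, ⟨g q • S.ρ p, by simp [mul_comm]⟩⟩
        | add s t hs ht =>
          obtain ⟨⟨L1, h1⟩, ⟨L2, h2⟩⟩ := hs
          obtain ⟨⟨L3, h3⟩, ⟨L4, h4⟩⟩ := ht
          exact ⟨⟨L1 + L3, by simp [h1, h3]⟩, ⟨L2 + L4, by simp [h2, h4]⟩⟩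
      obtain ⟨⟨L1, h1⟩, ⟨L2, h2⟩⟩ := hadd S.φ (differenceQuotient (b f) w)
      have : S.ρ (FreeAlgebra.ι ℂ (Sum.inl f) * w) =
          L1 + L2 + S.φ ∘ₗ LinearMap.mulLeft ℂ w ∘ₗ flipMul ∘ₗ differenceQuotient (b f) :=
        linearMap_ext_wordMonomial fun v => by
          rw [hΨ1]
          simp [Ψ, h1, h2]
      rw [this, ← h1, ← h2]
      rfl
    ρ_symm := fun p q => limCumulant_comm hm p q }

/-- Asymptotic freeness of second order, if the cumulants of the family `A` converge. -/
theorem asymptoticallyFree_of_cumulantConverges {H : Type u} [NormedAddCommGroup H]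
    [InnerProductSpace ℝ H] {κ : Type v}
    {X : ∀ N, H → Ω N → Matrix (Fin N) (Fin N) ℂ} {A : ∀ N, κ → Ω N → Matrix (Fin N) (Fin N) ℂ}
    (hX : ∀ N, IsHermitianGaussianFamily (P N) N (X N))
    (hA : ∀ N a k l, HasAllMoments (P N) fun ω => A N a ω k l)
    (hind : ∀ N, IndepFun (fun ω (t : H × Fin N × Fin N) => X N t.1 ω t.2.1 t.2.2)
        (fun ω (t : κ × Fin N × Fin N) => A N t.1 ω t.2.1 t.2.2) (P N))
    (hconv : ∀ p s, CumulantConverges (fun N => matrixMoment (P N) (A N)) p s) :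
    AsymptoticallyFreeOfSecondOrder P X A := by
  classical
  have h := cumulantConverges_joint hX hA hind hconv
  have hY : ∀ N (t : H ⊕ κ) k l, HasAllMoments (P N) fun ω => Sum.elim (X N) (A N) t ω k l := by
    rintro N (t | t) k l
    · exact (hX N).hasAllMoments_entry _ _ _
    · exact hA N _ _ _
  have hm := fun N => isMultilinearMoment_matrixMoment (hY N)
  have hlift : ∀ p : FreeAlgebra ℂ (H ⊕ κ), FreeAlgebra.lift ℂ
      (Sum.elim (fun f : H => FreeAlgebra.ι ℂ (Sum.inl f : H ⊕ κ))
        fun a : κ => FreeAlgebra.ι ℂ (Sum.inr a : H ⊕ κ)) p = p := fun p => by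
    have : FreeAlgebra.lift ℂ (Sum.elim (fun f : H => FreeAlgebra.ι ℂ (Sum.inl f : H ⊕ κ))
        fun a : κ => FreeAlgebra.ι ℂ (Sum.inr a : H ⊕ κ)) = AlgHom.id ℂ _ := by
      ext (t | t) <;> simp
    rw [this, AlgHom.id_apply]
  -- The limit elements are the free generators themselves, so evaluating a polynomial at them is
  -- the identity (`hlift`) and the limits of cumulants are the functionals by construction.
  refine ⟨FreeAlgebra ℂ (H ⊕ κ), inferInstance, inferInstance, limitSpace hm h,
    fun f => FreeAlgebra.ι ℂ (Sum.inl f), fun a => FreeAlgebra.ι ℂ (Sum.inr a), ?_,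
    (gaussianLoopCalculus hX hA hind hm h).isFreeOfSecondOrder⟩
  refine convergesToSecondOrder_of hY h (fun p => ?_) fun p q => ?_
  · rw [hlift]
    rfl
  · rw [hlift, hlift]
    rfl

/-- Cumulants of traces of non-random matrices. -/
lemma cumulantConverges_of_nonrandom {D : ∀ N, κ → Matrix (Fin N) (Fin N) ℂ}
    (hD : ∀ p : FreeAlgebra ℂ κ, ∃ L, Tendsto (fun N => normTrace (matrixPoly (D N) p)) atTop (𝓝 L))
    (p : FreeAlgebra ℂ κ) (s : Multiset (FreeAlgebra ℂ κ)) :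
    CumulantConverges (fun N => matrixMoment (P N) fun i _ => D N i) p s := by
  set m : ℕ → Multiset (FreeAlgebra ℂ κ) → ℂ := fun N => matrixMoment (P N) fun i _ => D N i
  have hm : ∀ N, m N 0 = 1 := fun N => by simp [m, matrixMoment]
  have hc : ∀ N s, m N (p ::ₘ s) = (matrixPoly (D N) p).trace * m N s := fun N s => by
    simp only [m, matrixMoment, Multiset.map_cons, Multiset.prod_cons, integral_const_mul]
  by_cases hs : s.card = 0
  · rw [Multiset.card_eq_zero] at hs
    subst hs
    obtain ⟨L, hL⟩ := hD p
    refine cumulantConverges_of_tendsto (hL.congr fun N => ?_) (by simp)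
    rw [normCumulant_zero, abstractCumulant_of_const (hm N) (hc N), if_pos (by simp), normTrace]
  -- A deterministic trace factors out of every moment, so its cumulants with further arguments are
  -- zero.
  · exact cumulantConverges_of_tendsto (limCumulant_of_const hm hc hs) fun _ => rfl

end Main

theorem mainTheorem8 {H : Type u} [NormedAddCommGroup H] [InnerProductSpace ℝ H] [CompleteSpace H]
    {Ω : ℕ → Type v} [∀ N, MeasurableSpace (Ω N)]
    (P : ∀ N, Measure (Ω N)) [∀ N, IsProbabilityMeasure (P N)]
    (X : ∀ N, H → Ω N → Matrix (Fin N) (Fin N) ℂ)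
    (hX : ∀ N, IsHermitianGaussianFamily (P N) N (X N)) (s : ℕ) :
    (∀ A : ∀ N, Fin s → Ω N → Matrix (Fin N) (Fin N) ℂ,
      HasSecondOrderLimitDistribution.{w} P A →
      (∀ N, IndepFun (fun ω (t : H × Fin N × Fin N) => X N t.1 ω t.2.1 t.2.2)
        (fun ω (t : Fin s × Fin N × Fin N) => A N t.1 ω t.2.1 t.2.2) (P N)) →
      AsymptoticallyFreeOfSecondOrder P X A) ∧
    (∀ D : ∀ N, Fin s → Matrix (Fin N) (Fin N) ℂ,
      HasLimitDistribution.{w} D →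
      AsymptoticallyFreeOfSecondOrder P X (fun N i _ => D N i)) := by
  constructor
  · rintro A ⟨𝒜, _, _, S, a, h⟩ hind
    exact asymptoticallyFree_of_cumulantConverges hX (fun N i k l q => h.moments N i k l q) hind
      fun p s => h.cumulantConverges p s
  · rintro D ⟨𝒟, _, _, ψ, d, -, -, h⟩
    exact asymptoticallyFree_of_cumulantConverges hX (fun N i k l => hasAllMoments_const _)
      (fun N => indepFun_const_right _ _)
      fun p s => cumulantConverges_of_nonrandom (fun p => ⟨_, h p⟩) p s
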